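/- Let $\mathsf{A}$ be an abelian category and let $(\mathcal{T},\mathcal{F})$ be a torsion pair in $\mathsf{A}$: two full subcategories, closed under isomorphism, such that $\operatorname{Hom}(T,F)=0$ for all $T\in\mathcal{T}$, $F\in\mathcal{F}$, and such that every object $X$ sits in a short exact sequence $0\to T\to X\to F\to 0$ with $T\in\mathcal{T}$, $F\in\mathcal{F}$. The pair is *cotilting* if every object of $\mathsf{A}$ is a quotient of an object of $\mathcal{F}$, and *tilting* if every object of $\mathsf{A}$ is a subobject of an object of $\mathcal{T}$. (No existence of enough injectives or projectives is assumed.) *The tilted category $\mathsf{B}$.* Its objects are the two-term complexes $\mathbb{X}=[d\colon X^{-1}\to X^0]$ in $\mathsf{A}$ with $\ker d\in\mathcal{F}$ and $\operatorname{coker}d\in\mathcal{T}$. A butterfly from $\mathbb{X}$ to $\mathbb{Y}$ is an object $E$ of $\mathsf{A}$ with morphisms $\kappa\colon X^{-1}\to E$, $\iota\colon Y^{-1}\to E$, $\sigma\colon E\to X^0$, $\rho\colon E\to Y^0$ such that $\sigma\kappa=d_{\mathbb{X}}$, $\rho\iota=d_{\mathbb{Y}}$, $\rho\kappa=0$ and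 $0\to Y^{-1}\xrightarrow{\iota}E\xrightarrow{\sigma}X^0\to 0$ is short exact. A morphism $\mathbb{X}\to\mathbb{Y}$ of $\mathsf{B}$ is an isomorphism class of butterflies; the composition of butterflies $E\colon\mathbb{X}\to\mathbb{Y}$ and $F\colon\mathbb{Y}\to\mathbb{Z}$ is $\operatorname{coker}\bigl((\iota_E,\kappa_F)\colon Y^{-1}\to E\times_{Y^0}F\bigr)$ with the induced maps. The category $\mathsf{B}$ is abelian. A strict morphism $\mathbb{X}\to\mathbb{Y}$ is a morphism of complexes $(f^{-1},f^0)$; it defines the morphism of $\mathsf{B}$ given by the butterfly $X^0\oplus Y^{-1}$ with $\kappa=(d_{\mathbb X},-f^{-1})$, $\iota$ the inclusion, $\sigma$ the projection and $\rho=f^0+d_{\mathbb{Y}}$. *The functor $\operatorname{Tot}$.* Let $\mathsf{Ch}^{st}(\mathsf{B})$ be the category whose objects are the (cochain) complexes $({}^n\mathbb{X})_{n\in\mathbb{Z}}$ in $\mathsf{B}$ and whose morphisms are the families of strict morphisms ${}^n\mathbb{X}\to{}^n\mathbb{Y}$ that commute in $\mathsf{B}$ with the differentials. For such a complex let $E^n$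 be the middle object of a butterfly representing the differential ${}^{n-1}\mathbb{X}\to{}^n\mathbb{X}$, let $\delta\colon E^n\to E^{n+1}$ be the unique morphism with $\delta\kappa_n=0$, $\delta\iota_n=\kappa_{n+1}$, $\sigma_{n+1}\delta=\rho_n$, $\rho_{n+1}\delta=0$, and let $M^n=\iota_n({}^nX^{-1})\subseteq E^n$. Then $\operatorname{Tot}({}^\bullet\mathbb{X})=(E^\bullet,M^\bullet)$ is a complex in $\mathsf{A}$ with a subobject $M^n\subseteq E^n$ in each degree, such that the map $M^n\to E^{n+1}/M^{n+1}$ induced by $\delta$ has its kernel in $\mathcal{F}$ and its cokernel in $\mathcal{T}$ for all $n$. A morphism $(f_n)$ of $\mathsf{Ch}^{st}(\mathsf{B})$ is sent to the family of the unique morphisms $E^n\to E'^n$ compatible, through $\kappa,\iota,\sigma,\rho$, with $f_{n-1}$ and $f_n$; it is a morphism of complexes and respects the subobjects. Let $\Phi$ be the functor that forgets the subobjects, $(E^\bullet,M^\bullet)\mapsto E^\bullet$. **Theorem (Happel–Reiten–Smalø).** Up to isomorphism there is exactly one functor $$\Phi\circ\operatorname{Tot}\colon\mathcal{D}(\mathsf{B})\to\mathcal{D}(\mathsf{A})$$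 whose composition with the canonical functor $\mathsf{Ch}^{st}(\mathsf{B})\to\mathcal{D}(\mathsf{B})$ is naturally isomorphic to ${}^\bullet\mathbb{X}\mapsto\Phi(\operatorname{Tot}({}^\bullet\mathbb{X}))\in\mathcal{D}(\mathsf{A})$. It is a triangle functor (for a suitable isomorphism of commutation with the shifts) and maps $\mathcal{D}^*(\mathsf{B})$ into $\mathcal{D}^*(\mathsf{A})$ for $*=-,+,b$. If $(\mathcal{T},\mathcal{F})$ is cotilting, then its restriction $$\Phi\circ\operatorname{Tot}\colon\mathcal{D}^*(\mathsf{B})\to\mathcal{D}^*(\mathsf{A})$$ is an equivalence of triangulated categories for $*=-$ and for $*=b$. If $(\mathcal{T},\mathcal{F})$ is tilting, the same holds for $*=+$ and for $*=b$. -/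

import Mathlib

open CategoryTheory CategoryTheory.Limits

noncomputable section

namespace HRS

attribute [local simp] pullback.lift_fst pullback.lift_fst_assoc pullback.lift_snd
  pullback.lift_snd_assoc

universe w w' v u

/-- A torsion pair in an abelian category: two full subcategories (closed under isomorphism)
without nonzero morphisms from the first to the second, such that every object is an extension of
an object of the second by an object of the first. -/
structure TorsionPair (A : Type u) [Category.{v} A] [Abelian A] where
  torsion : ObjectProperty A
  free : ObjectProperty A
  torsion_iso : torsion.IsClosedUnderIsomorphisms
  free_iso : free.IsClosedUnderIsomorphisms
  hom_eq_zero : ∀ {T F : A}, torsion T → free F → ∀ f : T ⟶ F, f = 0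
  exists_shortExact : ∀ X : A, ∃ (T F : A) (i : T ⟶ X) (p : X ⟶ F) (w : i ≫ p = 0),
    torsion T ∧ free F ∧ (ShortComplex.mk i p w).ShortExact

namespace TorsionPair

variable {A : Type u} [Category.{v} A] [Abelian A] (t : TorsionPair A)

/-- Every object is a quotient of a torsion-free object. -/
def IsCotilting : Prop := ∀ X : A, ∃ (F : A) (p : F ⟶ X), t.free F ∧ Epi p

/-- Every object is a subobject of a torsion object. -/
def IsTilting : Prop := ∀ X : A, ∃ (T : A) (i : X ⟶ T), t.torsion T ∧ Mono i

lemma torsion_of_forall {X : A} (h : ∀ (F : A), t.free F → ∀ f : X ⟶ F, f = 0) :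
    t.torsion X := by
  obtain ⟨T, F, i, p, w, hT, hF, hS⟩ := t.exists_shortExact X
  have := hS.mono_f
  have hp : p = 0 := h F hF p
  have : Epi i := hS.exact.epi_f hp
  have : IsIso i := isIso_of_mono_of_epi i
  have := t.torsion_iso
  exact t.torsion.prop_of_iso (asIso i) hT

lemma free_of_forall {X : A} (h : ∀ (T : A), t.torsion T → ∀ f : T ⟶ X, f = 0) :
    t.free X := by
  obtain ⟨T, F, i, p, w, hT, hF, hS⟩ := t.exists_shortExact X
  have := hS.epi_g
  have hp : i = 0 := h T hT i
  have : Mono p := hS.exact.mono_g hp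
  have : IsIso p := isIso_of_mono_of_epi p
  have := t.free_iso
  exact t.free.prop_of_iso (asIso p).symm hF

lemma torsion_of_epi {X Y : A} (p : X ⟶ Y) [Epi p] (h : t.torsion X) : t.torsion Y :=
  t.torsion_of_forall fun F hF f => by
    rw [← cancel_epi p, comp_zero]; exact t.hom_eq_zero h hF _

lemma free_of_mono {X Y : A} (i : X ⟶ Y) [Mono i] (h : t.free Y) : t.free X :=
  t.free_of_forall fun T hT f => by
    rw [← cancel_mono i, zero_comp]; exact t.hom_eq_zero hT h _

end TorsionPair

variable {A : Type u} [Category.{v} A] [Abelian A]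

/-- The objects of the tilted category: two-term complexes `d : X⁻¹ ⟶ X⁰` in `A` with torsion-free
kernel and torsion cokernel. -/
structure Tilt (t : TorsionPair A) where
  X₁ : A
  X₀ : A
  d : X₁ ⟶ X₀
  free_kernel : t.free (kernel d)
  torsion_cokernel : t.torsion (cokernel d)

variable {t : TorsionPair A}

/-- A map from an object vanishing on the image of `d` to an object killed by `d` is zero. -/
lemma Tilt.eq_zero {X Y : Tilt t} (f : X.X₀ ⟶ Y.X₁) (h₁ : X.d ≫ f = 0) (h₀ : f ≫ Y.d = 0) :
    f = 0 := by
  have : cokernel.desc X.d (kernel.lift Y.d f h₀)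
      (by rw [← cancel_mono (kernel.ι Y.d)]; simp [h₁]) = 0 :=
    t.hom_eq_zero X.torsion_cokernel Y.free_kernel _
  have h2 : kernel.lift Y.d f h₀ = 0 := by
    rw [← cokernel.π_desc X.d (kernel.lift Y.d f h₀)
      (by rw [← cancel_mono (kernel.ι Y.d)]; simp [h₁]), this, comp_zero]
  rw [← kernel.lift_ι Y.d f h₀, h2, zero_comp]

/-- Butterflies between two-term complexes. -/
structure Butterfly (X Y : Tilt t) where
  E : A
  κ : X.X₁ ⟶ E
  ι : Y.X₁ ⟶ E
  σ : E ⟶ X.X₀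
  ρ : E ⟶ Y.X₀
  κσ : κ ≫ σ = X.d
  ιρ : ι ≫ ρ = Y.d
  κρ : κ ≫ ρ = 0
  ισ : ι ≫ σ = 0
  shortExact : (ShortComplex.mk ι σ ισ).ShortExact

attribute [simp] Butterfly.κσ Butterfly.ιρ Butterfly.κρ Butterfly.ισ

namespace Butterfly

variable {X Y Z W : Tilt t}

@[simp]
lemma κσ_assoc (P : Butterfly X Y) {T : A} (h : X.X₀ ⟶ T) : P.κ ≫ P.σ ≫ h = X.d ≫ h := by
  rw [← Category.assoc, P.κσ]

@[simp]
lemma ιρ_assoc (P : Butterfly X Y) {T : A} (h : Y.X₀ ⟶ T) : P.ι ≫ P.ρ ≫ h = Y.d ≫ h := by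
  rw [← Category.assoc, P.ιρ]

@[simp]
lemma κρ_assoc (P : Butterfly X Y) {T : A} (h : Y.X₀ ⟶ T) : P.κ ≫ P.ρ ≫ h = 0 := by
  rw [← Category.assoc, P.κρ, zero_comp]

@[simp]
lemma ισ_assoc (P : Butterfly X Y) {T : A} (h : X.X₀ ⟶ T) : P.ι ≫ P.σ ≫ h = 0 := by
  rw [← Category.assoc, P.ισ, zero_comp]

instance (P : Butterfly X Y) : Mono P.ι := P.shortExact.mono_f
instance (P : Butterfly X Y) : Epi P.σ := P.shortExact.epi_g

/-- The map `f` of the middle objects respects the four arrows of the butterflies. -/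
structure IsMap (P Q : Butterfly X Y) (f : P.E ⟶ Q.E) : Prop where
  κ : P.κ ≫ f = Q.κ
  ι : P.ι ≫ f = Q.ι
  σ : f ≫ Q.σ = P.σ
  ρ : f ≫ Q.ρ = P.ρ

lemma IsMap.isIso {P Q : Butterfly X Y} {f : P.E ⟶ Q.E} (h : IsMap P Q f) : IsIso f := by
  let φ : ShortComplex.mk P.ι P.σ P.ισ ⟶ ShortComplex.mk Q.ι Q.σ Q.ισ :=
    { τ₁ := 𝟙 _, τ₂ := f, τ₃ := 𝟙 _
      comm₁₂ := by simp [h.ι]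
      comm₂₃ := by simp [h.σ] }
  exact ShortComplex.isIso₂_of_shortExact_of_isIso₁₃' φ P.shortExact Q.shortExact
    (inferInstanceAs (IsIso (𝟙 _))) (inferInstanceAs (IsIso (𝟙 _)))

/-- Two butterflies are isomorphic if there is an isomorphism of the middle objects
respecting the four arrows. -/
instance setoid (X Y : Tilt t) : Setoid (Butterfly X Y) where
  r P Q := ∃ e : P.E ≅ Q.E, IsMap P Q e.hom
  iseqv :=
    { refl := fun P => ⟨Iso.refl _, by constructor <;> simp⟩
      symm := by
        rintro P Q ⟨e, h⟩
        exact ⟨e.symm, by simp [← h.κ], by simp [← h.ι], by simp [← h.σ], by simp [← h.ρ]⟩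
      trans := by
        rintro P Q R ⟨e, h⟩ ⟨e', h'⟩
        exact ⟨e ≪≫ e', by simp [reassoc_of% h.κ, h'.κ], by simp [reassoc_of% h.ι, h'.ι],
          by simp [h.σ, h'.σ], by simp [h.ρ, h'.ρ]⟩ }

/-- The composition of butterflies `E` and `F` is the quotient of `E ×_{Y⁰} F` by `Y⁻¹`. -/
def comp (P : Butterfly X Y) (Q : Butterfly Y Z) : Butterfly X Z where
  E := cokernel (pullback.lift P.ι Q.κ (by simp) : Y.X₁ ⟶ pullback P.ρ Q.σ)
  κ := pullback.lift P.κ 0 (by simp) ≫ cokernel.π _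
  ι := pullback.lift 0 Q.ι (by simp) ≫ cokernel.π _
  σ := cokernel.desc _ (pullback.fst _ _ ≫ P.σ) (by simp)
  ρ := cokernel.desc _ (pullback.snd _ _ ≫ Q.ρ) (by simp)
  κσ := by simp
  ιρ := by simp
  κρ := by simp
  ισ := by simp
  shortExact := by
    have hm : Mono (pullback.lift P.ι Q.κ (by simp) : Y.X₁ ⟶ pullback P.ρ Q.σ) :=
      mono_of_mono_fac (pullback.lift_fst _ _ _)
    have hk := Abelian.monoIsKernelOfCokernel _
      (cokernelIsCokernel (pullback.lift P.ι Q.κ (P.ιρ.trans Q.κσ.symm)))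
    refine ShortComplex.ShortExact.mk' ?_ ?_ ?_
    · rw [ShortComplex.exact_iff_exact_up_to_refinements]
      intro T x hx
      dsimp at x hx
      obtain ⟨T₁, a, _, y, hy⟩ := surjective_up_to_refinements_of_epi
        (cokernel.π (pullback.lift P.ι Q.κ (by simp) : Y.X₁ ⟶ pullback P.ρ Q.σ)) x
      have h1 : (y ≫ pullback.fst _ _) ≫ P.σ = 0 := by
        have := a ≫= hx
        rw [reassoc_of% hy] at this
        simpa using this
      let b : T₁ ⟶ Y.X₁ := P.shortExact.fIsKernel.lift (KernelFork.ofι _ h1)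
      have hb : b ≫ P.ι = y ≫ pullback.fst _ _ := P.shortExact.fIsKernel.fac
        (KernelFork.ofι _ h1) WalkingParallelPair.zero
      have h2 : (y ≫ pullback.snd _ _ - b ≫ Q.κ) ≫ Q.σ = 0 := by
        simp [← pullback.condition, ← reassoc_of% hb]
      let c : T₁ ⟶ Z.X₁ := Q.shortExact.fIsKernel.lift (KernelFork.ofι _ h2)
      have hc : c ≫ Q.ι = y ≫ pullback.snd _ _ - b ≫ Q.κ := Q.shortExact.fIsKernel.fac
        (KernelFork.ofι _ h2) WalkingParallelPair.zero
      refine ⟨T₁, a, inferInstance, c, ?_⟩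
      have h3 : y = c ≫ pullback.lift 0 Q.ι (by simp) +
          b ≫ pullback.lift P.ι Q.κ (by simp) := by
        apply pullback.hom_ext <;> simp [hb, hc]
      dsimp
      rw [hy, h3]
      simp
    · apply Preadditive.mono_of_cancel_zero
      intro T g hg
      dsimp at g hg
      rw [← Category.assoc] at hg
      let b : T ⟶ Y.X₁ := hk.lift (KernelFork.ofι _ hg)
      have hb : b ≫ pullback.lift P.ι Q.κ (P.ιρ.trans Q.κσ.symm) =
          g ≫ pullback.lift 0 Q.ι (by simp) :=
        hk.fac (KernelFork.ofι _ hg) WalkingParallelPair.zero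
      have h1 := hb =≫ pullback.fst _ _
      have h2 := hb =≫ pullback.snd _ _
      simp only [Category.assoc, pullback.lift_fst, comp_zero, pullback.lift_snd] at h1 h2
      have hb0 : b = 0 := by rw [← cancel_mono P.ι, h1, zero_comp]
      rw [hb0, zero_comp] at h2
      rw [← cancel_mono Q.ι, ← h2, zero_comp]
    · have : Epi (cokernel.π (pullback.lift P.ι Q.κ (by simp) : Y.X₁ ⟶ pullback P.ρ Q.σ) ≫
          cokernel.desc _ (pullback.fst _ _ ≫ P.σ) (by simp)) := by
        rw [cokernel.π_desc]; infer_instance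
      exact epi_of_epi (cokernel.π (pullback.lift P.ι Q.κ (P.ιρ.trans Q.κσ.symm))) _

/-- The projection from `E ×_{Y⁰} F` to the middle object of the composition. -/
def compπ (P : Butterfly X Y) (Q : Butterfly Y Z) : pullback P.ρ Q.σ ⟶ (P.comp Q).E :=
  cokernel.π (pullback.lift P.ι Q.κ (by simp) : Y.X₁ ⟶ pullback P.ρ Q.σ)

instance (P : Butterfly X Y) (Q : Butterfly Y Z) : Epi (P.compπ Q) :=
  inferInstanceAs (Epi (cokernel.π _))

/-- The universal property of the middle object of a composition. -/
def compDesc (P : Butterfly X Y) (Q : Butterfly Y Z) {T : A} (f : pullback P.ρ Q.σ ⟶ T)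
    (hf : pullback.lift P.ι Q.κ (by simp) ≫ f = 0) : (P.comp Q).E ⟶ T :=
  cokernel.desc _ f hf

@[simp]
lemma compπ_desc (P : Butterfly X Y) (Q : Butterfly Y Z) {T : A} (f : pullback P.ρ Q.σ ⟶ T)
    (hf : pullback.lift P.ι Q.κ (by simp) ≫ f = 0) : P.compπ Q ≫ P.compDesc Q f hf = f :=
  cokernel.π_desc _ _ _

lemma exists_of_compπ_eq_zero (P : Butterfly X Y) (Q : Butterfly Y Z) {T : A}
    (f : T ⟶ pullback P.ρ Q.σ) (hf : f ≫ P.compπ Q = 0) :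
    ∃ b : T ⟶ Y.X₁, b ≫ pullback.lift P.ι Q.κ (by simp) = f := by
  have hm : Mono (pullback.lift P.ι Q.κ (by simp) : Y.X₁ ⟶ pullback P.ρ Q.σ) :=
    mono_of_mono_fac (pullback.lift_fst _ _ _)
  have hk := Abelian.monoIsKernelOfCokernel _
    (cokernelIsCokernel (pullback.lift P.ι Q.κ (P.ιρ.trans Q.κσ.symm)))
  exact ⟨hk.lift (KernelFork.ofι _ hf),
    hk.fac (KernelFork.ofι _ hf) WalkingParallelPair.zero⟩

/-- Criterion for a butterfly to be the composition of two butterflies. -/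
structure IsComp (P : Butterfly X Y) (Q : Butterfly Y Z) (R : Butterfly X Z)
    (f : pullback P.ρ Q.σ ⟶ R.E) : Prop where
  κ : pullback.lift P.κ 0 (by simp) ≫ f = R.κ
  ι : pullback.lift 0 Q.ι (by simp) ≫ f = R.ι
  zero : pullback.lift P.ι Q.κ (by simp) ≫ f = 0
  σ : f ≫ R.σ = pullback.fst _ _ ≫ P.σ
  ρ : f ≫ R.ρ = pullback.snd _ _ ≫ Q.ρ

lemma IsMap.equiv {P Q : Butterfly X Y} {f : P.E ⟶ Q.E} (h : IsMap P Q f) : P ≈ Q :=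
  have := h.isIso
  ⟨asIso f, h⟩

lemma isComp_comp (P : Butterfly X Y) (Q : Butterfly Y Z) :
    IsComp P Q (P.comp Q) (P.compπ Q) where
  κ := rfl
  ι := rfl
  zero := cokernel.condition _
  σ := cokernel.π_desc _ _ _
  ρ := cokernel.π_desc _ _ _

lemma IsComp.equiv {P : Butterfly X Y} {Q : Butterfly Y Z} {R : Butterfly X Z}
    {f : pullback P.ρ Q.σ ⟶ R.E} (h : IsComp P Q R f) : P.comp Q ≈ R :=
  have h' := isComp_comp P Q
  IsMap.equiv (f := P.compDesc Q f h.zero)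
    { κ := by rw [← h'.κ]; simp [h.κ]
      ι := by rw [← h'.ι]; simp [h.ι]
      σ := by rw [← cancel_epi (P.compπ Q), h'.σ, ← h.σ, ← Category.assoc, compπ_desc]
      ρ := by rw [← cancel_epi (P.compπ Q), h'.ρ, ← h.ρ, ← Category.assoc, compπ_desc] }

lemma comp_equiv {P P' : Butterfly X Y} {Q Q' : Butterfly Y Z} (hP : P ≈ P') (hQ : Q ≈ Q') :
    P.comp Q ≈ P'.comp Q' := by
  obtain ⟨e, he⟩ := hP
  obtain ⟨e', he'⟩ := hQ
  have h := isComp_comp P' Q'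
  refine IsComp.equiv (f := pullback.map _ _ _ _ e.hom e'.hom (𝟙 _) (by simp [he.ρ])
    (by simp [he'.σ]) ≫ P'.compπ Q') ⟨?_, ?_, ?_, ?_, ?_⟩
  · rw [← h.κ, ← Category.assoc]; congr 1; ext <;> simp [he.κ]
  · rw [← h.ι, ← Category.assoc]; congr 1; ext <;> simp [he'.ι]
  · rw [← h.zero, ← Category.assoc]; congr 1; ext <;> simp [he'.κ, he.ι]
  · simp [h.σ, he.σ]
  · simp [h.ρ, he'.ρ]

lemma comp_assoc (P : Butterfly X Y) (Q : Butterfly Y Z) (R : Butterfly Z W) :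
    (P.comp Q).comp R ≈ P.comp (Q.comp R) := by
  have hPQ := isComp_comp P Q
  have hQR := isComp_comp Q R
  have hP := isComp_comp P (Q.comp R)
  set π₁ := P.compπ Q with hπ₁
  set π₂ := Q.compπ R
  set π₃ := P.compπ (Q.comp R)
  have : Epi π₁ := by rw [hπ₁]; infer_instance
  let T := pullback π₁ (pullback.fst (P.comp Q).ρ R.σ)
  let q : T ⟶ pullback (P.comp Q).ρ R.σ := pullback.snd _ _
  let p : T ⟶ pullback P.ρ Q.σ := pullback.fst _ _
  have hpq : p ≫ π₁ = q ≫ pullback.fst _ _ := pullback.condition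
  have : Epi q := by dsimp [q]; infer_instance
  let r : T ⟶ pullback Q.ρ R.σ := pullback.lift (p ≫ pullback.snd _ _) (q ≫ pullback.snd _ _)
    (by rw [Category.assoc, Category.assoc, ← hPQ.ρ, reassoc_of% hpq, pullback.condition])
  let θ' : T ⟶ pullback P.ρ (Q.comp R).σ := pullback.lift (p ≫ pullback.fst _ _) (r ≫ π₂)
    (by rw [Category.assoc, Category.assoc, hQR.σ, pullback.condition]; simp [r])
  let θ : T ⟶ (P.comp (Q.comp R)).E := θ' ≫ π₃
  have hθ : kernel.ι q ≫ θ = 0 := by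
    have h0 : (kernel.ι q ≫ p) ≫ π₁ = 0 := by
      rw [Category.assoc, hpq, kernel.condition_assoc, zero_comp]
    obtain ⟨b, hb⟩ := exists_of_compπ_eq_zero _ _ _ h0
    have h1 : kernel.ι q ≫ r = b ≫ pullback.lift Q.κ 0 (by simp) := by
      ext
      · simp [r, ← reassoc_of% hb]
      · simp [r]
    have h2 : kernel.ι q ≫ θ' = b ≫ pullback.lift P.ι (Q.comp R).κ (by simp) := by
      ext
      · simp [θ', ← reassoc_of% hb]
      · simp [θ', reassoc_of% h1, hQR.κ]
    rw [← Category.assoc, h2, Category.assoc, hP.zero, comp_zero]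
  have key : ∀ {S : A} (g : S ⟶ T), (g ≫ q) ≫ Abelian.epiDesc q θ hθ = g ≫ θ := fun g => by
    rw [Category.assoc, Abelian.comp_epiDesc]
  refine IsComp.equiv (f := Abelian.epiDesc q θ hθ) ⟨?_, ?_, ?_, ?_, ?_⟩
  · let g : X.X₁ ⟶ T := pullback.lift (pullback.lift P.κ 0 (by simp))
      (pullback.lift (P.comp Q).κ 0 (by simp)) (by rw [hPQ.κ]; simp)
    have hg : g ≫ q = pullback.lift (P.comp Q).κ 0 (by simp) := pullback.lift_snd _ _ _
    have hg' : g ≫ p = pullback.lift P.κ 0 (by simp) := pullback.lift_fst _ _ _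
    rw [← hg, key, ← hP.κ]
    dsimp only [θ]
    rw [← Category.assoc]
    congr 1
    have : g ≫ r = 0 := by ext <;> simp [r, reassoc_of% hg, reassoc_of% hg']
    ext <;> simp [θ', reassoc_of% hg', reassoc_of% this]
  · let g : W.X₁ ⟶ T := pullback.lift 0 (pullback.lift 0 R.ι (by simp)) (by simp)
    have hg : g ≫ q = pullback.lift 0 R.ι (by simp) := pullback.lift_snd _ _ _
    have hg' : g ≫ p = 0 := pullback.lift_fst _ _ _
    rw [← hg, key, ← hP.ι]
    dsimp only [θ]
    rw [← Category.assoc]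
    congr 1
    have : g ≫ r = pullback.lift 0 R.ι (by simp) := by
      ext <;> simp [r, reassoc_of% hg, reassoc_of% hg']
    ext <;> simp [θ', reassoc_of% hg', reassoc_of% this, hQR.ι]
  · let g : Z.X₁ ⟶ T := pullback.lift (pullback.lift 0 Q.ι (by simp))
      (pullback.lift (P.comp Q).ι R.κ (by simp)) (by rw [hPQ.ι]; simp)
    have hg : g ≫ q = pullback.lift (P.comp Q).ι R.κ (by simp) := pullback.lift_snd _ _ _
    have hg' : g ≫ p = pullback.lift 0 Q.ι (by simp) := pullback.lift_fst _ _ _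
    rw [← hg, key]
    have : g ≫ r = pullback.lift Q.ι R.κ (by simp) := by
      ext <;> simp [r, reassoc_of% hg, reassoc_of% hg']
    have h2 : g ≫ θ' = 0 := by
      ext <;> simp [θ', reassoc_of% hg', reassoc_of% this, hQR.zero]
    rw [← Category.assoc, h2, zero_comp]
  · rw [← cancel_epi q, Abelian.comp_epiDesc_assoc]
    dsimp only [θ]
    rw [Category.assoc, hP.σ, ← reassoc_of% hpq, hPQ.σ]
    simp [θ']
  · rw [← cancel_epi q, Abelian.comp_epiDesc_assoc]
    dsimp only [θ]
    rw [Category.assoc, hP.ρ]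
    simp [θ', hQR.ρ, r]

end Butterfly

/-- Strict morphisms: morphisms of two-term complexes. -/
@[ext]
structure StrictHom (X Y : Tilt t) where
  f₁ : X.X₁ ⟶ Y.X₁
  f₀ : X.X₀ ⟶ Y.X₀
  comm : f₁ ≫ Y.d = X.d ≫ f₀

attribute [simp] StrictHom.comm

namespace StrictHom

variable {X Y Z W : Tilt t}

@[simp]
lemma comm_assoc (f : StrictHom X Y) {T : A} (h : Y.X₀ ⟶ T) :
    f.f₁ ≫ Y.d ≫ h = X.d ≫ f.f₀ ≫ h := by
  rw [← Category.assoc, f.comm, Category.assoc]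

/-- The identity strict morphism. -/
@[simps]
def id (X : Tilt t) : StrictHom X X where
  f₁ := 𝟙 _
  f₀ := 𝟙 _
  comm := by simp

/-- The composition of strict morphisms. -/
@[simps]
def comp (f : StrictHom X Y) (g : StrictHom Y Z) : StrictHom X Z where
  f₁ := f.f₁ ≫ g.f₁
  f₀ := f.f₀ ≫ g.f₀
  comm := by simp

/-- The zero strict morphism. -/
@[simps]
def zero (X Y : Tilt t) : StrictHom X Y where
  f₁ := 0
  f₀ := 0
  comm := by simp

/-- The butterfly of a strict morphism, with middle object `X⁰ ⊞ Y⁻¹`. -/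
def toButterfly (f : StrictHom X Y) : Butterfly X Y where
  E := X.X₀ ⊞ Y.X₁
  κ := biprod.lift X.d (-f.f₁)
  ι := biprod.inr
  σ := biprod.fst
  ρ := biprod.desc f.f₀ Y.d
  κσ := by simp
  ιρ := by simp
  κρ := by simp
  ισ := by simp
  shortExact := ShortComplex.ShortExact.mk' (by
    rw [ShortComplex.exact_iff_exact_up_to_refinements]
    intro T x hx
    exact ⟨T, 𝟙 _, inferInstance, x ≫ biprod.snd, by
      ext
      · simpa using hx
      · simp⟩)
    (by dsimp; infer_instance) (by dsimp; infer_instance)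

/-- The second projection of the middle object of a strict butterfly. -/
def snd (f : StrictHom X Y) : f.toButterfly.E ⟶ Y.X₁ := biprod.snd

/-- The first inclusion in the middle object of a strict butterfly. -/
def inl (f : StrictHom X Y) : X.X₀ ⟶ f.toButterfly.E := biprod.inl

@[simp] lemma κ_snd (f : StrictHom X Y) : f.toButterfly.κ ≫ f.snd = -f.f₁ := biprod.lift_snd _ _
@[simp] lemma ι_snd (f : StrictHom X Y) : f.toButterfly.ι ≫ f.snd = 𝟙 _ := biprod.inr_snd
@[simp] lemma inl_snd (f : StrictHom X Y) : f.inl ≫ f.snd = 0 := biprod.inl_snd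
@[simp] lemma inl_σ (f : StrictHom X Y) : f.inl ≫ f.toButterfly.σ = 𝟙 _ := biprod.inl_fst
@[simp] lemma inl_ρ (f : StrictHom X Y) : f.inl ≫ f.toButterfly.ρ = f.f₀ := biprod.inl_desc _ _

@[simp] lemma κ_snd_assoc (f : StrictHom X Y) {T : A} (h : Y.X₁ ⟶ T) :
    f.toButterfly.κ ≫ f.snd ≫ h = -f.f₁ ≫ h := by rw [← Category.assoc, κ_snd, Preadditive.neg_comp]
@[simp] lemma ι_snd_assoc (f : StrictHom X Y) {T : A} (h : Y.X₁ ⟶ T) :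
    f.toButterfly.ι ≫ f.snd ≫ h = h := by rw [← Category.assoc, ι_snd, Category.id_comp]
@[simp] lemma inl_snd_assoc (f : StrictHom X Y) {T : A} (h : Y.X₁ ⟶ T) :
    f.inl ≫ f.snd ≫ h = 0 := by rw [← Category.assoc, inl_snd, zero_comp]
@[simp] lemma inl_σ_assoc (f : StrictHom X Y) {T : A} (h : X.X₀ ⟶ T) :
    f.inl ≫ f.toButterfly.σ ≫ h = h := by rw [← Category.assoc, inl_σ, Category.id_comp]
@[simp] lemma inl_ρ_assoc (f : StrictHom X Y) {T : A} (h : Y.X₀ ⟶ T) :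
    f.inl ≫ f.toButterfly.ρ ≫ h = f.f₀ ≫ h := by rw [← Category.assoc, inl_ρ]

lemma hom_ext_from (f : StrictHom X Y) {T : A} {a b : f.toButterfly.E ⟶ T}
    (h₀ : f.inl ≫ a = f.inl ≫ b) (h₁ : f.toButterfly.ι ≫ a = f.toButterfly.ι ≫ b) : a = b :=
  biprod.hom_ext' _ _ h₀ h₁

lemma hom_ext_to (f : StrictHom X Y) {T : A} {a b : T ⟶ f.toButterfly.E}
    (h₀ : a ≫ f.toButterfly.σ = b ≫ f.toButterfly.σ) (h₁ : a ≫ f.snd = b ≫ f.snd) : a = b :=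
  biprod.hom_ext _ _ h₀ h₁

lemma ρ_eq (f : StrictHom X Y) :
    f.toButterfly.ρ = f.toButterfly.σ ≫ f.f₀ + f.snd ≫ Y.d :=
  f.hom_ext_from (by simp) (by simp)

lemma κ_eq (f : StrictHom X Y) :
    f.toButterfly.κ = X.d ≫ f.inl - f.f₁ ≫ f.toButterfly.ι :=
  f.hom_ext_to (by simp) (by simp)

end StrictHom

namespace Butterfly

variable {X Y Z W : Tilt t}

/-- A map between the middle objects of butterflies `X ⟶ Y` and `X' ⟶ Y'` over strict morphisms
`X ⟶ X'` and `Y ⟶ Y'`. -/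
structure IsMapOver {X' Y' : Tilt t} (P : Butterfly X Y) (P' : Butterfly X' Y')
    (f : StrictHom X X') (g : StrictHom Y Y') (φ : P.E ⟶ P'.E) : Prop where
  κ : P.κ ≫ φ = f.f₁ ≫ P'.κ
  ι : P.ι ≫ φ = g.f₁ ≫ P'.ι
  σ : φ ≫ P'.σ = P.σ ≫ f.f₀
  ρ : φ ≫ P'.ρ = P.ρ ≫ g.f₀

lemma strict_comp_equiv_iff (f : StrictHom X Y) (P : Butterfly Y Z) (R : Butterfly X Z) :
    f.toButterfly.comp P ≈ R ↔ ∃ ψ : R.E ⟶ P.E, IsMapOver R P f (StrictHom.id Z) ψ := by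
  have h := isComp_comp f.toButterfly P
  constructor
  · rintro ⟨e, he⟩
    let ψ : (f.toButterfly.comp P).E ⟶ P.E := compDesc _ _
      (pullback.snd _ _ - pullback.fst f.toButterfly.ρ P.σ ≫ f.snd ≫ P.κ) (by simp)
    have hψ : compπ _ _ ≫ ψ = pullback.snd _ _ -
        pullback.fst f.toButterfly.ρ P.σ ≫ f.snd ≫ P.κ := by simp [ψ]
    refine ⟨e.inv ≫ ψ, ⟨?_, ?_, ?_, ?_⟩⟩
    · rw [← he.κ, ← h.κ]; simp [hψ]
    · rw [← he.ι, ← h.ι]; simp [hψ]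
    · rw [Category.assoc, Iso.inv_comp_eq, ← Category.assoc, he.σ, ← cancel_epi (compπ _ _),
        reassoc_of% hψ, reassoc_of% h.σ, Preadditive.sub_comp, ← pullback.condition]
      simp [f.ρ_eq]
    · rw [Category.assoc, Iso.inv_comp_eq, ← Category.assoc, he.ρ, ← cancel_epi (compπ _ _),
        reassoc_of% hψ, reassoc_of% h.ρ]
      simp
  · rintro ⟨ψ, hψ⟩
    let l : R.E ⟶ pullback f.toButterfly.ρ P.σ := pullback.lift (R.σ ≫ f.inl) ψ
      (by simp [hψ.σ])
    have hl₁ : l ≫ pullback.fst _ _ = R.σ ≫ f.inl := pullback.lift_fst _ _ _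
    have hl₂ : l ≫ pullback.snd _ _ = ψ := pullback.lift_snd _ _ _
    refine Setoid.symm (IsMap.equiv (f := l ≫ compπ _ _) ⟨?_, ?_, ?_, ?_⟩)
    · have : R.κ ≫ l = pullback.lift f.toButterfly.κ 0 (by simp) +
          f.f₁ ≫ pullback.lift f.toButterfly.ι P.κ (by simp) := by
        apply pullback.hom_ext
        · simp [hl₁, f.κ_eq]
        · simp [hl₂, hψ.κ]
      rw [reassoc_of% this, Preadditive.add_comp, h.κ, Category.assoc, h.zero, comp_zero, add_zero]
    · rw [← h.ι, ← Category.assoc]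
      congr 1
      apply pullback.hom_ext
      · simp [hl₁]
      · simp [hl₂, hψ.ι]
    · rw [Category.assoc, h.σ, reassoc_of% hl₁]; simp
    · rw [Category.assoc, h.ρ, reassoc_of% hl₂, hψ.ρ]; simp

lemma comp_strict_equiv_iff (P : Butterfly X Y) (g : StrictHom Y Z) (R : Butterfly X Z) :
    P.comp g.toButterfly ≈ R ↔ ∃ ψ : P.E ⟶ R.E, IsMapOver P R (StrictHom.id X) g ψ := by
  have h := isComp_comp P g.toButterfly
  constructor
  · rintro ⟨e, he⟩
    let l : P.E ⟶ pullback P.ρ g.toButterfly.σ := pullback.lift (𝟙 _) (P.ρ ≫ g.inl) (by simp)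
    have hl₁ : l ≫ pullback.fst _ _ = 𝟙 _ := pullback.lift_fst _ _ _
    have hl₂ : l ≫ pullback.snd _ _ = P.ρ ≫ g.inl := pullback.lift_snd _ _ _
    refine ⟨l ≫ compπ _ _ ≫ e.hom, ⟨?_, ?_, ?_, ?_⟩⟩
    · have : P.κ ≫ l = pullback.lift P.κ 0 (by simp) := by
        apply pullback.hom_ext
        · simp [hl₁]
        · simp [hl₂]
      rw [reassoc_of% this, reassoc_of% h.κ, he.κ]; simp
    · have : P.ι ≫ l = pullback.lift P.ι g.toButterfly.κ (by simp) +
          g.f₁ ≫ pullback.lift 0 g.toButterfly.ι (by simp) := by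
        apply pullback.hom_ext
        · simp [hl₁]
        · simp [hl₂, g.κ_eq]
      rw [reassoc_of% this, Preadditive.add_comp, reassoc_of% h.zero, Category.assoc,
        reassoc_of% h.ι, he.ι]
      simp
    · rw [Category.assoc, Category.assoc, he.σ, h.σ, reassoc_of% hl₁]; simp
    · rw [Category.assoc, Category.assoc, he.ρ, h.ρ, reassoc_of% hl₂]; simp
  · rintro ⟨ψ, hψ⟩
    refine IsComp.equiv (f := pullback.fst _ _ ≫ ψ +
      pullback.snd P.ρ g.toButterfly.σ ≫ g.snd ≫ R.ι) ⟨?_, ?_, ?_, ?_, ?_⟩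
    · simp [hψ.κ]
    · simp
    · simp [hψ.ι]
    · simp [hψ.σ]
    · simp [hψ.ρ, pullback.condition_assoc, g.ρ_eq]

end Butterfly

/-- The tilted category: morphisms are isomorphism classes of butterflies. -/
instance : Category (Tilt t) where
  Hom X Y := Quotient (Butterfly.setoid X Y)
  id X := Quotient.mk _ (StrictHom.id X).toButterfly
  comp f g := Quotient.map₂ Butterfly.comp (fun _ _ h _ _ h' => Butterfly.comp_equiv h h') f g
  id_comp := by
    rintro X Y ⟨P⟩
    exact Quotient.sound ((Butterfly.strict_comp_equiv_iff _ _ _).2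
      ⟨𝟙 _, by simp, by simp, by simp, by simp⟩)
  comp_id := by
    rintro X Y ⟨P⟩
    exact Quotient.sound ((Butterfly.comp_strict_equiv_iff _ _ _).2
      ⟨𝟙 _, by simp, by simp, by simp, by simp⟩)
  assoc := by
    rintro X Y Z W ⟨P⟩ ⟨Q⟩ ⟨R⟩
    exact Quotient.sound (Butterfly.comp_assoc P Q R)

namespace Butterfly

variable {X Y Z W : Tilt t}

/-- The morphism of the tilted category given by a butterfly. -/
def toHom (P : Butterfly X Y) : X ⟶ Y := Quotient.mk (Butterfly.setoid X Y) P

lemma exists_toHom (f : X ⟶ Y) : ∃ P : Butterfly X Y, P.toHom = f := Quotient.exists_rep f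

lemma toHom_eq_iff (P Q : Butterfly X Y) : P.toHom = Q.toHom ↔ P ≈ Q := Quotient.eq

lemma toHom_comp (P : Butterfly X Y) (Q : Butterfly Y Z) :
    P.toHom ≫ Q.toHom = (P.comp Q).toHom := rfl

end Butterfly

namespace StrictHom

variable {X Y Z W : Tilt t}

/-- The morphism of the tilted category given by a strict morphism. -/
def toHom (f : StrictHom X Y) : X ⟶ Y := f.toButterfly.toHom

lemma toHom_id (X : Tilt t) : (StrictHom.id X).toHom = 𝟙 X := rfl

lemma toHom_comp_eq_iff (f : StrictHom X Y) (P : Butterfly Y Z) (R : Butterfly X Z) :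
    f.toHom ≫ P.toHom = R.toHom ↔
      ∃ ψ : R.E ⟶ P.E, Butterfly.IsMapOver R P f (StrictHom.id Z) ψ := by
  rw [toHom, Butterfly.toHom_comp, Butterfly.toHom_eq_iff, Butterfly.strict_comp_equiv_iff]

lemma comp_toHom_eq_iff (P : Butterfly X Y) (g : StrictHom Y Z) (R : Butterfly X Z) :
    P.toHom ≫ g.toHom = R.toHom ↔
      ∃ ψ : P.E ⟶ R.E, Butterfly.IsMapOver P R (StrictHom.id X) g ψ := by
  rw [toHom, Butterfly.toHom_comp, Butterfly.toHom_eq_iff, Butterfly.comp_strict_equiv_iff]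

lemma toHom_comp (f : StrictHom X Y) (g : StrictHom Y Z) :
    f.toHom ≫ g.toHom = (f.comp g).toHom := by
  refine (comp_toHom_eq_iff f.toButterfly g (f.comp g).toButterfly).2
    ⟨f.toButterfly.σ ≫ (f.comp g).inl + f.snd ≫ g.f₁ ≫ (f.comp g).toButterfly.ι, ?_, ?_, ?_, ?_⟩
  · simp [(f.comp g).κ_eq, sub_eq_add_neg]
  · simp
  · simp
  · simp [f.ρ_eq]

/-- Two strict morphisms agree in the tilted category if and only if they are homotopic. -/
lemma toHom_eq_iff (f g : StrictHom X Y) :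
    f.toHom = g.toHom ↔ ∃ h : X.X₀ ⟶ Y.X₁, f.f₁ = g.f₁ + X.d ≫ h ∧ f.f₀ = g.f₀ + h ≫ Y.d := by
  rw [toHom, toHom, Butterfly.toHom_eq_iff]
  constructor
  · rintro ⟨e, he⟩
    have key : f.inl ≫ e.hom = g.inl + (f.inl ≫ e.hom ≫ g.snd) ≫ g.toButterfly.ι :=
      g.hom_ext_to (by simp [he.σ]) (by simp)
    refine ⟨f.inl ≫ e.hom ≫ g.snd, ?_, ?_⟩
    · have := he.κ =≫ g.snd
      rw [f.κ_eq] at this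
      simp only [Preadditive.sub_comp, Category.assoc, κ_snd, reassoc_of% he.ι, ι_snd,
        Category.comp_id] at this
      rw [sub_eq_iff_eq_add] at this
      rw [this]; abel
    · have := key =≫ g.toButterfly.ρ
      simpa [he.ρ] using this
  · rintro ⟨h, h1, h0⟩
    refine Butterfly.IsMap.equiv (f := f.toButterfly.σ ≫ (g.inl + h ≫ g.toButterfly.ι) +
      f.snd ≫ g.toButterfly.ι) ⟨?_, ?_, ?_, ?_⟩
    · simp [g.κ_eq, h1]; abel
    · simp
    · simp
    · simp [f.ρ_eq, h0]

end StrictHom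

section ZeroMorphisms

/-- The zero morphisms of the tilted category. They are those of the preadditive structure below,
through which they become an instance. -/
@[reducible]
def zeroMorphisms (t : TorsionPair A) : HasZeroMorphisms (Tilt t) where
  zero X Y := ⟨(StrictHom.zero X Y).toHom⟩
  comp_zero := by
    intro X Y f Z
    obtain ⟨P, rfl⟩ := Butterfly.exists_toHom f
    exact (StrictHom.comp_toHom_eq_iff P _ (StrictHom.zero X Z).toButterfly).2
      ⟨P.σ ≫ (StrictHom.zero X Z).inl, by simp [StrictHom.κ_eq], by simp, by simp, by simp⟩
  zero_comp := by
    intro X Y Z f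
    obtain ⟨P, rfl⟩ := Butterfly.exists_toHom f
    exact (StrictHom.toHom_comp_eq_iff _ P (StrictHom.zero X Z).toButterfly).2
      ⟨(StrictHom.zero X Z).snd ≫ P.ι, by simp, by simp, by simp, by simp [StrictHom.ρ_eq]⟩

attribute [local instance] zeroMorphisms

lemma zero_def (X Y : Tilt t) : (0 : X ⟶ Y) = (StrictHom.zero X Y).toHom := rfl

lemma StrictHom.toHom_eq_zero_iff {X Y : Tilt t} (f : StrictHom X Y) :
    f.toHom = 0 ↔ ∃ h : X.X₀ ⟶ Y.X₁, f.f₁ = X.d ≫ h ∧ f.f₀ = h ≫ Y.d := by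
  rw [zero_def, toHom_eq_iff]; simp

namespace Butterfly

variable {X Y Z W : Tilt t}

/-- The butterfly in the other direction, if the other diagonal is short exact as well. -/
def flip (P : Butterfly X Y) (h : (ShortComplex.mk P.κ P.ρ P.κρ).ShortExact) :
    Butterfly Y X where
  E := P.E
  κ := P.ι
  ι := P.κ
  σ := P.ρ
  ρ := P.σ
  κσ := P.ιρ
  ιρ := P.κσ
  κρ := P.ισ
  ισ := P.κρ
  shortExact := h

lemma toHom_comp_eq_id (P : Butterfly X Y) (h : (ShortComplex.mk P.κ P.ρ P.κρ).ShortExact)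
    (Q : Butterfly Y X) (f : Q.E ⟶ P.E) (h₁ : Q.ι ≫ f = P.κ) (h₂ : Q.κ ≫ f = P.ι)
    (h₃ : f ≫ P.σ = Q.ρ) (h₄ : f ≫ P.ρ = Q.σ) : P.toHom ≫ Q.toHom = 𝟙 X := by
  have h0 : (pullback.snd P.ρ Q.σ ≫ f - pullback.fst P.ρ Q.σ) ≫ P.ρ = 0 := by
    simp [pullback.condition, h₄]
  have hm : Mono P.κ := h.mono_f
  obtain ⟨l, hl⟩ : ∃ l : pullback P.ρ Q.σ ⟶ X.X₁,
      l ≫ P.κ = pullback.snd _ _ ≫ f - pullback.fst _ _ :=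
    ⟨_, h.fIsKernel.fac (KernelFork.ofι _ h0) WalkingParallelPair.zero⟩
  have e : ∀ {T : A} (a : T ⟶ pullback P.ρ Q.σ) (b : T ⟶ X.X₁), b ≫ P.κ =
      a ≫ (pullback.snd _ _ ≫ f - pullback.fst _ _) → a ≫ l = b := fun a b hab => by
    rw [← cancel_mono P.κ, Category.assoc, hl, hab]
  change _ = (StrictHom.id X).toButterfly.toHom
  rw [toHom_comp, toHom_eq_iff]
  refine IsComp.equiv (f := pullback.fst P.ρ Q.σ ≫ P.σ ≫ (StrictHom.id X).inl +
    l ≫ (StrictHom.id X).toButterfly.ι) ⟨?_, ?_, ?_, ?_, ?_⟩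
  · have := e (pullback.lift P.κ 0 (by simp)) (-𝟙 _) (by simp)
    simp [reassoc_of% this, StrictHom.κ_eq, sub_eq_add_neg]
  · have := e (pullback.lift 0 Q.ι (by simp)) (𝟙 _) (by simp [h₁])
    simp [reassoc_of% this]
  · have := e (pullback.lift P.ι Q.κ (by simp)) 0 (by simp [h₂])
    simp [reassoc_of% this]
  · simp
  · have := hl =≫ P.σ
    simp only [Category.assoc, κσ, Preadditive.sub_comp, h₃] at this
    simp [this]

/-- A butterfly both of whose diagonals are short exact is an isomorphism. -/
lemma isIso_toHom (P : Butterfly X Y) (h : (ShortComplex.mk P.κ P.ρ P.κρ).ShortExact) :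
    IsIso P.toHom :=
  ⟨(P.flip h).toHom,
    P.toHom_comp_eq_id h (P.flip h) (𝟙 P.E) (Category.comp_id _) (Category.comp_id _)
      (Category.id_comp _) (Category.id_comp _),
    (P.flip h).toHom_comp_eq_id P.shortExact P (𝟙 P.E) (Category.comp_id _) (Category.comp_id _)
      (Category.id_comp _) (Category.id_comp _)⟩

/-- Criterion for a strict morphism to be an isomorphism in the tilted category. -/
lemma _root_.HRS.StrictHom.isIso_toHom (s : StrictHom X Y)
    (hm : ∀ {T : A} (x : T ⟶ X.X₁), x ≫ X.d = 0 → x ≫ s.f₁ = 0 → x = 0)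
    (he : ∀ {T : A} (a : T ⟶ X.X₀) (b : T ⟶ Y.X₁), a ≫ s.f₀ + b ≫ Y.d = 0 →
      ∃ x : T ⟶ X.X₁, x ≫ X.d = a ∧ x ≫ s.f₁ = -b)
    (hp : Epi (biprod.desc s.f₀ Y.d)) : IsIso s.toHom := by
  refine Butterfly.isIso_toHom _ (ShortComplex.ShortExact.mk' ?_ ?_ ?_)
  · rw [ShortComplex.exact_iff_exact_up_to_refinements]
    intro T (x : T ⟶ s.toButterfly.E) (hx : x ≫ s.toButterfly.ρ = 0)
    rw [s.ρ_eq, Preadditive.comp_add, ← Category.assoc, ← Category.assoc] at hx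
    obtain ⟨y, h₁, h₂⟩ := he _ _ hx
    exact ⟨T, 𝟙 _, inferInstance, y, s.hom_ext_to (by simp [h₁]) (by simp [h₂])⟩
  · apply Preadditive.mono_of_cancel_zero
    intro T (x : T ⟶ X.X₁) (hx : x ≫ s.toButterfly.κ = 0)
    refine hm x ?_ ?_
    · simpa using hx =≫ s.toButterfly.σ
    · simpa using hx =≫ s.snd
  · exact hp

lemma torsion_aux {M N N' : A} {d : M ⟶ N} (h : t.torsion (cokernel d)) (p : N ⟶ N') [Epi p]
    (hp : d ≫ p = 0) : t.torsion N' := by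
  have : Epi (cokernel.desc d p hp) := epi_of_epi_fac (cokernel.π_desc d p hp)
  exact t.torsion_of_epi (cokernel.desc d p hp) h

lemma free_aux {M N N' : A} {d : M ⟶ N} (h : t.free (kernel d)) (i : N' ⟶ M) [Mono i]
    (hi : i ≫ d = 0) : t.free N' := by
  have : Mono (kernel.lift d i hi) := mono_of_mono_fac (kernel.lift_ι d i hi)
  exact t.free_of_mono (kernel.lift d i hi) h

/-- Every morphism becomes strict after composition with a strict isomorphism to its source. -/
lemma exists_strict_source (f : X ⟶ Y) : ∃ (X' : Tilt t) (s : StrictHom X' X) (g : StrictHom X' Y),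
    IsIso s.toHom ∧ s.toHom ≫ f = g.toHom := by
  obtain ⟨P, rfl⟩ := exists_toHom f
  obtain ⟨X', p₁, p₂, i₁, i₂, e, h₁₁, h₁₂, h₂₁, h₂₂, hp, hd⟩ : ∃ (X' : Tilt t)
      (p₁ : X'.X₁ ⟶ X.X₁) (p₂ : X'.X₁ ⟶ Y.X₁) (i₁ : X.X₁ ⟶ X'.X₁) (i₂ : Y.X₁ ⟶ X'.X₁)
      (e : X'.X₀ ≅ P.E), i₁ ≫ p₁ = 𝟙 _ ∧ i₁ ≫ p₂ = 0 ∧ i₂ ≫ p₁ = 0 ∧ i₂ ≫ p₂ = 𝟙 _ ∧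
        p₁ ≫ i₁ + p₂ ≫ i₂ = 𝟙 _ ∧ X'.d ≫ e.hom = p₁ ≫ P.κ + p₂ ≫ P.ι :=
    ⟨{  X₁ := X.X₁ ⊞ Y.X₁
        X₀ := P.E
        d := biprod.desc P.κ P.ι
        free_kernel := by
          let i := kernel.ι (biprod.desc P.κ P.ι) ≫ biprod.fst
          have h0 : kernel.ι (biprod.desc P.κ P.ι) ≫ biprod.fst ≫ P.κ +
              kernel.ι (biprod.desc P.κ P.ι) ≫ biprod.snd ≫ P.ι = 0 := by
            rw [← Preadditive.comp_add, ← biprod.desc_eq, kernel.condition]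
          have : Mono i := by
            apply Preadditive.mono_of_cancel_zero
            intro T g hg
            have h1 := g ≫= h0
            have hg' : g ≫ kernel.ι (biprod.desc P.κ P.ι) ≫ biprod.fst = 0 := hg
            simp only [Preadditive.comp_add, reassoc_of% hg', zero_comp, zero_add, comp_zero] at h1
            rw [← cancel_mono (kernel.ι (biprod.desc P.κ P.ι)), zero_comp]
            ext
            · simpa using hg'
            · rw [← cancel_mono P.ι]; simpa using h1
          refine free_aux X.free_kernel i ?_
          have := h0 =≫ P.σ
          simpa [i] using this
        torsion_cokernel := by
          have h0 : P.ι ≫ cokernel.π (biprod.desc P.κ P.ι) = 0 :=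
            (biprod.inr_desc_assoc P.κ P.ι _).symm.trans (by rw [cokernel.condition, comp_zero])
          have h1 : P.κ ≫ cokernel.π (biprod.desc P.κ P.ι) = 0 :=
            (biprod.inl_desc_assoc P.κ P.ι _).symm.trans (by rw [cokernel.condition, comp_zero])
          obtain ⟨p, hp⟩ : ∃ p : X.X₀ ⟶ cokernel (biprod.desc P.κ P.ι), P.σ ≫ p = cokernel.π _ :=
            ⟨_, P.shortExact.gIsCokernel.fac (CokernelCofork.ofπ _ h0) WalkingParallelPair.one⟩
          have : Epi p := epi_of_epi_fac hp
          refine torsion_aux X.torsion_cokernel p ?_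
          rw [← P.κσ, Category.assoc, hp, h1] },
      biprod.fst, biprod.snd, biprod.inl, biprod.inr, Iso.refl _, by simp, by simp, by simp,
      by simp, by simp, by simp [biprod.desc_eq]⟩
  have hd' : X'.d = (p₁ ≫ P.κ + p₂ ≫ P.ι) ≫ e.inv := by rw [← hd]; simp
  let s : StrictHom X' X := ⟨p₁, e.hom ≫ P.σ, by simp [hd']⟩
  let g : StrictHom X' Y := ⟨p₂, e.hom ≫ P.ρ, by simp [hd']⟩
  refine ⟨X', s, g, s.isIso_toHom ?_ ?_ ?_, ?_⟩
  · intro T x hx (hx' : x ≫ p₁ = 0)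
    have h2 : x ≫ p₂ = 0 := by
      rw [← cancel_mono P.ι, ← cancel_mono e.inv]
      simpa [hd', reassoc_of% hx'] using hx
    rw [← Category.comp_id x, ← hp, Preadditive.comp_add, reassoc_of% hx', reassoc_of% h2]
    simp
  · intro T a b (hab : a ≫ e.hom ≫ P.σ + b ≫ X.d = 0)
    have h1 : (a ≫ e.hom + b ≫ P.κ) ≫ P.σ = 0 := by simpa using hab
    obtain ⟨c, hc⟩ : ∃ c : T ⟶ Y.X₁, c ≫ P.ι = a ≫ e.hom + b ≫ P.κ :=
      ⟨_, P.shortExact.fIsKernel.fac (KernelFork.ofι _ h1) WalkingParallelPair.zero⟩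
    refine ⟨c ≫ i₂ - b ≫ i₁, ?_, ?_⟩
    · simp [hd', reassoc_of% h₁₁, reassoc_of% h₁₂, reassoc_of% h₂₁, reassoc_of% h₂₂,
        reassoc_of% hc]
    · simp [s, h₁₁, h₂₁]
  · have : Epi (biprod.inl ≫ biprod.desc s.f₀ X.d) := by
      rw [biprod.inl_desc]; dsimp [s]; infer_instance
    exact epi_of_epi biprod.inl _
  · refine (StrictHom.toHom_comp_eq_iff s P g.toButterfly).2
      ⟨g.toButterfly.σ ≫ e.hom + g.snd ≫ P.ι, ?_, ?_, ?_, ?_⟩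
    · simp [s, g, hd']
    · simp
    · simp [s]
    · simp [StrictHom.ρ_eq, g]

/-- Every morphism becomes strict after composition with a strict isomorphism from its target. -/
lemma exists_strict_target (f : X ⟶ Y) : ∃ (Y' : Tilt t) (s : StrictHom Y Y') (g : StrictHom X Y'),
    IsIso s.toHom ∧ f ≫ s.toHom = g.toHom := by
  obtain ⟨P, rfl⟩ := exists_toHom f
  obtain ⟨Y', p₁, p₂, i₁, i₂, e, h₁₁, h₁₂, h₂₁, h₂₂, hp, hd⟩ : ∃ (Y' : Tilt t)
      (p₁ : Y'.X₀ ⟶ X.X₀) (p₂ : Y'.X₀ ⟶ Y.X₀) (i₁ : X.X₀ ⟶ Y'.X₀) (i₂ : Y.X₀ ⟶ Y'.X₀)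
      (e : P.E ≅ Y'.X₁), i₁ ≫ p₁ = 𝟙 _ ∧ i₁ ≫ p₂ = 0 ∧ i₂ ≫ p₁ = 0 ∧ i₂ ≫ p₂ = 𝟙 _ ∧
        p₁ ≫ i₁ + p₂ ≫ i₂ = 𝟙 _ ∧ e.hom ≫ Y'.d = P.σ ≫ i₁ + P.ρ ≫ i₂ :=
    ⟨{  X₁ := P.E
        X₀ := X.X₀ ⊞ Y.X₀
        d := biprod.lift P.σ P.ρ
        free_kernel := by
          have h0 : kernel.ι (biprod.lift P.σ P.ρ) ≫ P.σ = 0 := by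
            have := kernel.condition (biprod.lift P.σ P.ρ) =≫ biprod.fst
            rwa [Category.assoc, biprod.lift_fst, zero_comp] at this
          have h1 : kernel.ι (biprod.lift P.σ P.ρ) ≫ P.ρ = 0 := by
            have := kernel.condition (biprod.lift P.σ P.ρ) =≫ biprod.snd
            rwa [Category.assoc, biprod.lift_snd, zero_comp] at this
          obtain ⟨p, hp⟩ : ∃ p : kernel (biprod.lift P.σ P.ρ) ⟶ Y.X₁, p ≫ P.ι = kernel.ι _ :=
            ⟨_, P.shortExact.fIsKernel.fac (KernelFork.ofι _ h0) WalkingParallelPair.zero⟩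
          have : Mono p := mono_of_mono_fac hp
          refine free_aux Y.free_kernel p ?_
          rw [← P.ιρ, reassoc_of% hp, h1]
        torsion_cokernel := by
          let i := biprod.inr ≫ cokernel.π (biprod.lift P.σ P.ρ)
          have h0 : P.σ ≫ biprod.inl ≫ cokernel.π (biprod.lift P.σ P.ρ) +
              P.ρ ≫ biprod.inr ≫ cokernel.π (biprod.lift P.σ P.ρ) = 0 := by
            rw [← Category.assoc, ← Category.assoc, ← Preadditive.add_comp, ← biprod.lift_eq,
              cokernel.condition]
          have : Epi i := by
            apply Preadditive.epi_of_cancel_zero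
            intro T g hg
            have h1 := h0 =≫ g
            have hg' : biprod.inr ≫ cokernel.π (biprod.lift P.σ P.ρ) ≫ g = 0 := by
              simpa [i] using hg
            simp only [Preadditive.add_comp, Category.assoc, hg', zero_comp, add_zero,
              comp_zero] at h1
            rw [← cancel_epi (cokernel.π (biprod.lift P.σ P.ρ)), comp_zero]
            ext
            · rw [← cancel_epi P.σ]; simpa using h1
            · simpa using hg'
          refine torsion_aux Y.torsion_cokernel i ?_
          have := P.ι ≫= h0
          simpa [i] using this },
      biprod.fst, biprod.snd, biprod.inl, biprod.inr, Iso.refl _, by simp, by simp, by simp,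
      by simp, by simp, by simp [biprod.lift_eq]⟩
  have hd' : Y'.d = e.inv ≫ (P.σ ≫ i₁ + P.ρ ≫ i₂) := by rw [← hd]; simp
  let s : StrictHom Y Y' := ⟨-P.ι ≫ e.hom, -i₂, by simp [hd']⟩
  let g : StrictHom X Y' := ⟨P.κ ≫ e.hom, i₁, by simp [hd']⟩
  refine ⟨Y', s, g, s.isIso_toHom ?_ ?_ ?_, ?_⟩
  · intro T x hx (hx' : x ≫ (-P.ι ≫ e.hom) = 0)
    rw [← cancel_mono P.ι, ← cancel_mono e.hom]
    simpa using hx'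
  · intro T a b (hab : a ≫ (-i₂) + b ≫ Y'.d = 0)
    have h1 : (b ≫ e.inv) ≫ P.σ = 0 := by
      have := hab =≫ p₁
      simpa [hd', h₁₁, h₂₁] using this
    have h2 : a = b ≫ e.inv ≫ P.ρ := by
      have := hab =≫ p₂
      simp [hd', h₁₂, h₂₂] at this
      exact (neg_add_eq_zero.1 this)
    obtain ⟨c, hc⟩ : ∃ c : T ⟶ Y.X₁, c ≫ P.ι = b ≫ e.inv :=
      ⟨_, P.shortExact.fIsKernel.fac (KernelFork.ofι _ h1) WalkingParallelPair.zero⟩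
    refine ⟨c, ?_, ?_⟩
    · rw [h2, ← reassoc_of% hc, P.ιρ]
    · simp [s, reassoc_of% hc]
  · apply Preadditive.epi_of_cancel_zero
    intro T x hx
    have h1 := biprod.inl ≫= hx
    have h2 := biprod.inr ≫= hx
    simp only [biprod.inl_desc_assoc, comp_zero, biprod.inr_desc_assoc, s] at h1 h2
    have h3 : i₂ ≫ x = 0 := by simpa using h1
    have h4 : i₁ ≫ x = 0 := by
      rw [← cancel_epi P.σ, ← cancel_epi e.inv]
      simpa [hd', h3] using h2
    rw [← Category.id_comp x, ← hp, Preadditive.add_comp, Category.assoc, Category.assoc, h3, h4]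
    simp
  · refine (StrictHom.comp_toHom_eq_iff P s g.toButterfly).2
      ⟨P.σ ≫ g.inl - e.hom ≫ g.toButterfly.ι, ?_, ?_, ?_, ?_⟩
    · simp [StrictHom.κ_eq, g]
    · simp [s]
    · simp
    · simp [g, s, hd]

end Butterfly

variable {X Y Z W : Tilt t}

/-- The kernel and cokernel of a butterfly `P` are obtained from the subobject `K⁰` of the middle
object lying between the image of `κ` and the kernel of `ρ` and inducing the torsion part of the
cohomology. -/
lemma Butterfly.exists_torsionPart (P : Butterfly X Y) : ∃ (K C : Tilt t) (e₁ : K.X₁ ≅ X.X₁)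
    (a : K.X₀ ⟶ P.E) (c : P.E ⟶ C.X₁) (e₀ : Y.X₀ ≅ C.X₀) (w : a ≫ c = 0),
    (ShortComplex.mk a c w).ShortExact ∧ K.d ≫ a = e₁.hom ≫ P.κ ∧ c ≫ C.d = P.ρ ≫ e₀.hom := by
  let k : X.X₁ ⟶ kernel P.ρ := kernel.lift P.ρ P.κ P.κρ
  obtain ⟨T, F, i, p, w, hT, hF, hS⟩ := t.exists_shortExact (cokernel k)
  have := hS.mono_f
  have := hS.epi_g
  let b : kernel (cokernel.π k ≫ p) ⟶ P.E := kernel.ι _ ≫ kernel.ι _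
  let d : X.X₁ ⟶ kernel (cokernel.π k ≫ p) := kernel.lift _ k (by simp)
  have hdb : d ≫ b = P.κ := by simp [d, b, k]
  have hbρ : b ≫ P.ρ = 0 := by simp [b]
  refine ⟨⟨X.X₁, kernel (cokernel.π k ≫ p), d, ?_, ?_⟩,
    ⟨cokernel b, Y.X₀, cokernel.desc b P.ρ hbρ, ?_, ?_⟩, Iso.refl _, b, cokernel.π b, Iso.refl _,
    cokernel.condition b, ?_, by simp [hdb], by simp⟩
  · refine Butterfly.free_aux X.free_kernel (kernel.ι d) ?_
    rw [← P.κσ, ← hdb]; simp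
  · obtain ⟨q, hq⟩ : ∃ q : kernel (cokernel.π k ≫ p) ⟶ T, q ≫ i = kernel.ι _ ≫ cokernel.π k :=
      ⟨_, hS.fIsKernel.fac (KernelFork.ofι (kernel.ι (cokernel.π k ≫ p) ≫ cokernel.π k)
        (by simp)) WalkingParallelPair.zero⟩
    have hqe : Epi q := by
      rw [epi_iff_surjective_up_to_refinements]
      intro S y
      obtain ⟨S', π, hπ, z, hz⟩ := surjective_up_to_refinements_of_epi (cokernel.π k) (y ≫ i)
      refine ⟨S', π, hπ, kernel.lift _ z (by rw [← reassoc_of% hz, w]; simp), ?_⟩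
      rw [← cancel_mono i, Category.assoc, Category.assoc, hq, kernel.lift_ι_assoc, hz]
    have h0 : kernel.ι q ≫ cokernel.π d = 0 := by
      have h1 : (kernel.ι q ≫ kernel.ι (cokernel.π k ≫ p)) ≫ cokernel.π k = 0 := by
        rw [Category.assoc, ← hq]; simp
      obtain ⟨S', π, hπ, z, hz⟩ :=
        (CokernelCofork.IsColimit.comp_π_eq_zero_iff_up_to_refinements (cokernelIsCokernel k) _).1 h1
      rw [← cancel_epi π]
      have : π ≫ kernel.ι q = z ≫ d := by
        rw [← cancel_mono (kernel.ι (cokernel.π k ≫ p))]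
        simpa [d] using hz
      rw [reassoc_of% this]; simp
    have h1 : Epi (Abelian.epiDesc q (cokernel.π d) h0) :=
      epi_of_epi_fac (Abelian.comp_epiDesc q _ h0)
    exact t.torsion_of_epi (Abelian.epiDesc q (cokernel.π d) h0) hT
  · refine t.free_of_forall fun T' hT' f => ?_
    obtain ⟨S, π, hπ, z, hz⟩ := surjective_up_to_refinements_of_epi (cokernel.π b)
      (f ≫ kernel.ι (cokernel.desc b P.ρ hbρ))
    have hzρ : z ≫ P.ρ = 0 := by
      have := hz =≫ cokernel.desc b P.ρ hbρ
      simpa using this.symm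
    let z' : S ⟶ kernel P.ρ := kernel.lift _ z hzρ
    have h0 : kernel.ι π ≫ z' ≫ cokernel.π k ≫ p = 0 := by
      have h1 : (kernel.ι π ≫ z) ≫ cokernel.π b = 0 := by
        rw [Category.assoc, ← hz]; simp
      have hb : Mono b := by dsimp [b]; infer_instance
      obtain ⟨S', π', hπ', y, hy⟩ :=
        (CokernelCofork.IsColimit.comp_π_eq_zero_iff_up_to_refinements (cokernelIsCokernel b) _).1 h1
      rw [← cancel_epi π']
      have : π' ≫ kernel.ι π ≫ z' = y ≫ kernel.ι (cokernel.π k ≫ p) := by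
        rw [← cancel_mono (kernel.ι P.ρ)]
        simpa [z', b] using hy
      rw [reassoc_of% this]; simp
    have h1 : z' ≫ cokernel.π k ≫ p = 0 := by
      rw [← Abelian.comp_epiDesc π _ h0, t.hom_eq_zero hT' hF (Abelian.epiDesc π _ h0), comp_zero]
    have h2 : z = kernel.lift (cokernel.π k ≫ p) z' h1 ≫ b := by simp [b, z']
    rw [← cancel_mono (kernel.ι (cokernel.desc b P.ρ hbρ)), ← cancel_epi π, hz, h2]
    simp
  · refine Butterfly.torsion_aux Y.torsion_cokernel (cokernel.π (cokernel.desc b P.ρ hbρ)) ?_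
    have h0 : P.ρ ≫ cokernel.π (cokernel.desc b P.ρ hbρ) = 0 :=
      (cokernel.π_desc_assoc b P.ρ hbρ _).symm.trans (by rw [cokernel.condition, comp_zero])
    rw [← P.ιρ, Category.assoc, h0, comp_zero]
  · have hb : Mono b := by dsimp [b]; infer_instance
    exact ShortComplex.ShortExact.mk' (ShortComplex.exact_cokernel b) hb
      (inferInstanceAs (Epi (cokernel.π b)))

/-- A lifting property against a morphism can be checked on strict morphisms. -/
lemma exists_lift_of_strict (k : X ⟶ Y) (c : Y ⟶ Z)
    (h : ∀ (V : Tilt t) (r : StrictHom V Y), r.toHom ≫ c = 0 → ∃ l : V ⟶ X, l ≫ k = r.toHom)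
    (r : W ⟶ Y) (hr : r ≫ c = 0) : ∃ l : W ⟶ X, l ≫ k = r := by
  obtain ⟨V, s, g, hs, hg⟩ := Butterfly.exists_strict_source r
  obtain ⟨l, hl⟩ := h V g (by rw [← hg, Category.assoc, hr, comp_zero])
  exact ⟨inv s.toHom ≫ l, by rw [Category.assoc, hl, ← hg, IsIso.inv_hom_id_assoc]⟩

lemma exists_desc_of_strict (k : X ⟶ Y) (c : Y ⟶ Z)
    (h : ∀ (V : Tilt t) (r : StrictHom Y V), k ≫ r.toHom = 0 → ∃ l : Z ⟶ V, c ≫ l = r.toHom)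
    (r : Y ⟶ W) (hr : k ≫ r = 0) : ∃ l : Z ⟶ W, c ≫ l = r := by
  obtain ⟨V, s, g, hs, hg⟩ := Butterfly.exists_strict_target r
  obtain ⟨l, hl⟩ := h V g (by rw [← hg, reassoc_of% hr, zero_comp])
  exact ⟨l ≫ inv s.toHom, by rw [← Category.assoc, hl, ← hg, Category.assoc, IsIso.hom_inv_id,
    Category.comp_id]⟩

/-- The difference of strict morphisms. -/
@[simps]
def StrictHom.sub (f g : StrictHom X Y) : StrictHom X Y where
  f₁ := f.f₁ - g.f₁
  f₀ := f.f₀ - g.f₀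
  comm := by simp

lemma StrictHom.toHom_sub_eq_zero_iff (f g : StrictHom X Y) :
    (f.sub g).toHom = 0 ↔ f.toHom = g.toHom := by
  rw [toHom_eq_zero_iff, toHom_eq_iff]
  simp [sub_eq_iff_eq_add']

lemma exists_strict_source₂ (f : X ⟶ Y) (f' : X ⟶ Z) : ∃ (X' : Tilt t) (s : StrictHom X' X)
    (g : StrictHom X' Y) (g' : StrictHom X' Z), IsIso s.toHom ∧ s.toHom ≫ f = g.toHom ∧
      s.toHom ≫ f' = g'.toHom := by
  obtain ⟨X₁, s₁, g₁, h₁, e₁⟩ := Butterfly.exists_strict_source f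
  obtain ⟨X₂, s₂, g₂, h₂, e₂⟩ := Butterfly.exists_strict_source (s₁.toHom ≫ f')
  refine ⟨X₂, s₂.comp s₁, s₂.comp g₁, g₂, ?_, ?_, ?_⟩
  · rw [← StrictHom.toHom_comp]; infer_instance
  · rw [← StrictHom.toHom_comp, ← StrictHom.toHom_comp, Category.assoc, e₁]
  · rw [← StrictHom.toHom_comp, Category.assoc, e₂]

lemma exists_strict_target₂ (f : X ⟶ Z) (f' : Y ⟶ Z) : ∃ (Z' : Tilt t) (s : StrictHom Z Z')
    (g : StrictHom X Z') (g' : StrictHom Y Z'), IsIso s.toHom ∧ f ≫ s.toHom = g.toHom ∧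
      f' ≫ s.toHom = g'.toHom := by
  obtain ⟨X₁, s₁, g₁, h₁, e₁⟩ := Butterfly.exists_strict_target f
  obtain ⟨X₂, s₂, g₂, h₂, e₂⟩ := Butterfly.exists_strict_target (f' ≫ s₁.toHom)
  refine ⟨X₂, s₁.comp s₂, g₁.comp s₂, g₂, ?_, ?_, ?_⟩
  · rw [← StrictHom.toHom_comp]; infer_instance
  · rw [← StrictHom.toHom_comp, ← StrictHom.toHom_comp, ← Category.assoc, e₁]
  · rw [← StrictHom.toHom_comp, ← Category.assoc, e₂]

lemma mono_of_strict (k : StrictHom X Y)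
    (h : ∀ (V : Tilt t) (q : StrictHom V X), q.toHom ≫ k.toHom = 0 → q.toHom = 0) :
    Mono k.toHom := by
  refine ⟨fun {W} q q' hq => ?_⟩
  obtain ⟨V, s, g, g', hs, hg, hg'⟩ := exists_strict_source₂ q q'
  rw [← cancel_epi s.toHom, hg, hg', ← StrictHom.toHom_sub_eq_zero_iff]
  apply h
  have h1 : (g.comp k).toHom = (g'.comp k).toHom := by
    rw [← StrictHom.toHom_comp, ← StrictHom.toHom_comp, ← hg, ← hg', Category.assoc, hq,
      Category.assoc]
  rw [← StrictHom.toHom_sub_eq_zero_iff] at h1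
  rw [StrictHom.toHom_comp, ← h1]
  congr 1
  ext <;> simp

lemma epi_of_strict (k : StrictHom X Y)
    (h : ∀ (V : Tilt t) (q : StrictHom Y V), k.toHom ≫ q.toHom = 0 → q.toHom = 0) :
    Epi k.toHom := by
  refine ⟨fun {W} q q' hq => ?_⟩
  obtain ⟨V, s, g, g', hs, hg, hg'⟩ := exists_strict_target₂ q q'
  rw [← cancel_mono s.toHom, hg, hg', ← StrictHom.toHom_sub_eq_zero_iff]
  apply h
  have h1 : (k.comp g).toHom = (k.comp g').toHom := by
    rw [← StrictHom.toHom_comp, ← StrictHom.toHom_comp, ← hg, ← hg', reassoc_of% hq]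
  rw [← StrictHom.toHom_sub_eq_zero_iff] at h1
  rw [StrictHom.toHom_comp, ← h1]
  congr 1
  ext <;> simp

lemma strict_analysis (g : StrictHom X Y) : ∃ (K C : Tilt t) (k : StrictHom K X)
    (c : StrictHom Y C), (∃ (w : k.toHom ≫ g.toHom = 0),
      Nonempty (IsLimit (KernelFork.ofι k.toHom w)) ∧
        (Epi g.toHom → Nonempty (IsColimit (CokernelCofork.ofπ g.toHom w)))) ∧
      (∃ (w : g.toHom ≫ c.toHom = 0),
      Nonempty (IsColimit (CokernelCofork.ofπ c.toHom w)) ∧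
        (Mono g.toHom → Nonempty (IsLimit (KernelFork.ofι g.toHom w)))) := by
  obtain ⟨K, C, e₁, a, c, e₀, w, hS, hK, hC⟩ := g.toButterfly.exists_torsionPart
  have : Mono a := hS.mono_f
  have : Epi c := hS.epi_g
  have haρ : a ≫ g.toButterfly.ρ = 0 := by
    rw [← cancel_mono e₀.hom, Category.assoc, ← hC, reassoc_of% w]; simp
  have hκ : g.toButterfly.κ = e₁.inv ≫ K.d ≫ a := by rw [hK]; simp
  have hκc : g.toButterfly.κ ≫ c = 0 := by rw [hκ]; simp [w]
  have hρ : g.toButterfly.ρ = c ≫ C.d ≫ e₀.inv := by rw [reassoc_of% hC]; simp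
  let kk : StrictHom K X := ⟨e₁.hom, a ≫ g.toButterfly.σ, by rw [reassoc_of% hK]; simp⟩
  let cc : StrictHom Y C := ⟨g.toButterfly.ι ≫ c, e₀.hom, by rw [Category.assoc, hC]; simp⟩
  have wk : kk.toHom ≫ g.toHom = 0 := by
    rw [StrictHom.toHom_comp, StrictHom.toHom_eq_zero_iff]
    refine ⟨-a ≫ g.snd, ?_, ?_⟩
    · simp [kk, reassoc_of% hK]
    · have := haρ
      rw [g.ρ_eq, Preadditive.comp_add, add_eq_zero_iff_eq_neg] at this
      simpa [kk] using this
  have wc : g.toHom ≫ cc.toHom = 0 := by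
    rw [StrictHom.toHom_comp, StrictHom.toHom_eq_zero_iff]
    refine ⟨g.inl ≫ c, ?_, ?_⟩
    · rw [g.κ_eq, Preadditive.sub_comp, sub_eq_zero] at hκc
      simpa [cc] using hκc.symm
    · simp [cc, hC]
  have hkm : Mono kk.toHom := by
    refine mono_of_strict _ fun V q hq => ?_
    rw [StrictHom.toHom_comp, StrictHom.toHom_eq_zero_iff] at hq
    obtain ⟨h, h₁, h₀⟩ := hq
    change q.f₁ ≫ e₁.hom = _ at h₁
    change q.f₀ ≫ a ≫ g.toButterfly.σ = _ at h₀
    have h₁' : q.f₁ = V.d ≫ h ≫ e₁.inv := by rw [← reassoc_of% h₁]; simp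
    rw [StrictHom.toHom_eq_zero_iff]
    refine ⟨h ≫ e₁.inv, h₁', ?_⟩
    have hv : ((q.f₀ - (h ≫ e₁.inv) ≫ K.d) ≫ a) ≫ g.toButterfly.σ = 0 := by
      simp [h₀, hK]
    obtain ⟨y, hy⟩ : ∃ y, y ≫ g.toButterfly.ι = (q.f₀ - (h ≫ e₁.inv) ≫ K.d) ≫ a :=
      ⟨_, g.toButterfly.shortExact.fIsKernel.fac (KernelFork.ofι _ hv) WalkingParallelPair.zero⟩
    have hy0 : y = 0 := by
      refine Tilt.eq_zero y ?_ ?_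
      · rw [← cancel_mono g.toButterfly.ι, Category.assoc, hy]
        simp [← reassoc_of% q.comm, h₁', hK]
      · rw [← g.toButterfly.ιρ, reassoc_of% hy, haρ, comp_zero]
    rw [hy0, zero_comp] at hy
    rw [← sub_eq_zero, ← cancel_mono a, ← hy, zero_comp]
  have hce : Epi cc.toHom := by
    refine epi_of_strict _ fun V q hq => ?_
    rw [StrictHom.toHom_comp, StrictHom.toHom_eq_zero_iff] at hq
    obtain ⟨h, h₁, h₀⟩ := hq
    change (g.toButterfly.ι ≫ c) ≫ q.f₁ = _ at h₁
    change e₀.hom ≫ q.f₀ = _ at h₀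
    have h₀' : q.f₀ = (e₀.inv ≫ h) ≫ V.d := by rw [Category.assoc, ← h₀]; simp
    rw [StrictHom.toHom_eq_zero_iff]
    refine ⟨e₀.inv ≫ h, ?_, h₀'⟩
    have hv : g.toButterfly.ι ≫ c ≫ (q.f₁ - C.d ≫ e₀.inv ≫ h) = 0 := by
      rw [Category.assoc] at h₁
      simp [h₁, reassoc_of% hC]
    obtain ⟨y, hy⟩ : ∃ y, g.toButterfly.σ ≫ y = c ≫ (q.f₁ - C.d ≫ e₀.inv ≫ h) :=
      ⟨_, g.toButterfly.shortExact.gIsCokernel.fac (CokernelCofork.ofπ _ hv)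
        WalkingParallelPair.one⟩
    have hy0 : y = 0 := by
      refine Tilt.eq_zero y ?_ ?_
      · rw [← g.toButterfly.κσ, Category.assoc, hy, reassoc_of% hκc, zero_comp]
      · rw [← cancel_epi g.toButterfly.σ, reassoc_of% hy]
        simp [h₀']
    rw [hy0, comp_zero] at hy
    rw [← sub_eq_zero, ← cancel_epi c, ← hy, comp_zero]
  refine ⟨K, C, kk, cc, ⟨wk, ⟨KernelFork.IsLimit.ofι' _ _ fun r hr =>
    Classical.indefiniteDescription _ (exists_lift_of_strict _ g.toHom (fun V r hr => ?_) r hr)⟩,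
    fun hge => ⟨CokernelCofork.IsColimit.ofπ' _ _ fun r hr => Classical.indefiniteDescription _
      (exists_desc_of_strict kk.toHom _ (fun V r hr => ?_) r hr)⟩⟩, ⟨wc,
    ⟨CokernelCofork.IsColimit.ofπ' _ _ fun r hr => Classical.indefiniteDescription _
      (exists_desc_of_strict g.toHom _ (fun V r hr => ?_) r hr)⟩, fun hgm =>
    ⟨KernelFork.IsLimit.ofι' _ _ fun r hr => Classical.indefiniteDescription _
    (exists_lift_of_strict _ cc.toHom (fun V r hr => ?_) r hr)⟩⟩⟩
  · rw [StrictHom.toHom_comp, StrictHom.toHom_eq_zero_iff] at hr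
    obtain ⟨h, h₁, h₀⟩ := hr
    change r.f₁ ≫ g.f₁ = _ at h₁
    change r.f₀ ≫ g.f₀ = _ at h₀
    let u := r.f₀ ≫ g.inl - h ≫ g.toButterfly.ι
    have hu₁ : V.d ≫ u = r.f₁ ≫ g.toButterfly.κ := by
      simp [u, g.κ_eq, reassoc_of% h₁]
    have huc : u ≫ c = 0 := by
      refine Tilt.eq_zero (u ≫ c) ?_ ?_
      · rw [reassoc_of% hu₁, hκc, comp_zero]
      · rw [Category.assoc, hC]; simp [u, reassoc_of% h₀]
    obtain ⟨u', hu'⟩ : ∃ u', u' ≫ a = u :=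
      ⟨_, hS.fIsKernel.fac (KernelFork.ofι _ huc) WalkingParallelPair.zero⟩
    let l : StrictHom V K := ⟨r.f₁ ≫ e₁.inv, u', by
      rw [← cancel_mono a, Category.assoc, Category.assoc, hK, Category.assoc, hu', hu₁]; simp⟩
    refine ⟨l.toHom, ?_⟩
    rw [StrictHom.toHom_comp]
    congr 1
    ext
    · simp [l, kk]
    · simp [l, kk, reassoc_of% hu', u]
  · have hc0 : cc.toHom = 0 := by rw [← cancel_epi g.toHom, wc, comp_zero]
    have hidC : 𝟙 C = 0 := by rw [← cancel_epi cc.toHom, Category.comp_id, comp_zero, hc0]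
    rw [← StrictHom.toHom_id, StrictHom.toHom_eq_zero_iff] at hidC
    obtain ⟨hh, hh₁, hh₀⟩ := hidC
    change 𝟙 _ = _ at hh₁
    change 𝟙 _ = _ at hh₀
    rw [StrictHom.toHom_comp, StrictHom.toHom_eq_zero_iff] at hr
    obtain ⟨h, h₁, h₀⟩ := hr
    change e₁.hom ≫ r.f₁ = _ at h₁
    change (a ≫ g.toButterfly.σ) ≫ r.f₀ = _ at h₀
    rw [Category.assoc] at h₀
    have h₁' : r.f₁ = e₁.inv ≫ K.d ≫ h := by rw [← h₁]; simp
    have hρe : Epi g.toButterfly.ρ := by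
      have : Epi C.d := ⟨fun x y hxy => by
        rw [← Category.id_comp x, hh₀, Category.assoc, hxy, ← Category.assoc, ← hh₀,
          Category.id_comp]⟩
      rw [hρ]; infer_instance
    obtain ⟨F, i, hF₁, hF₂, hF₃, hF₄⟩ : ∃ (F : Butterfly Y V) (i : g.toButterfly.E ⟶ F.E),
        F.κ = g.toButterfly.ι ≫ i ∧ a ≫ i = h ≫ F.ι ∧ i ≫ F.σ = g.toButterfly.ρ ∧
          i ≫ F.ρ = g.toButterfly.σ ≫ r.f₀ :=
      ⟨{  E := pushout a h
          κ := g.toButterfly.ι ≫ pushout.inl _ _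
          ι := pushout.inr _ _
          σ := pushout.desc g.toButterfly.ρ 0 (by simp [haρ])
          ρ := pushout.desc (g.toButterfly.σ ≫ r.f₀) V.d h₀
          κσ := by simp [pushout.inl_desc]
          ιρ := by simp [pushout.inr_desc]
          κρ := by simp [pushout.inl_desc]
          ισ := by simp [pushout.inr_desc]
          shortExact := by
            have hσ : Epi (pushout.desc g.toButterfly.ρ 0 (by simp [haρ]) :
                pushout a h ⟶ Y.X₀) := epi_of_epi_fac (pushout.inl_desc _ _ _)
            refine ShortComplex.ShortExact.mk' (ShortComplex.exact_of_g_is_cokernel _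
              (CokernelCofork.IsColimit.ofπ' _ _ fun x hx => ⟨e₀.hom ≫ hh ≫
                hS.gIsCokernel.desc (CokernelCofork.ofπ (pushout.inl a h ≫ x) ?_), ?_⟩))
              (by dsimp; infer_instance) hσ
            · dsimp at hx ⊢
              rw [pushout.condition_assoc, hx, comp_zero]
            · have hfac := hS.gIsCokernel.fac (CokernelCofork.ofπ (pushout.inl a h ≫ x) (by
                dsimp at hx ⊢
                rw [pushout.condition_assoc, hx, comp_zero])) WalkingParallelPair.one
              dsimp at hx hfac ⊢
              apply pushout.hom_ext
              · rw [pushout.inl_desc_assoc, ← reassoc_of% hC, ← reassoc_of% hh₁, hfac]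
              · rw [pushout.inr_desc_assoc, zero_comp, hx] },
        pushout.inl _ _, rfl, pushout.condition, pushout.inl_desc _ _ _, pushout.inl_desc _ _ _⟩
    refine ⟨F.toHom, (StrictHom.toHom_comp_eq_iff g F r.toButterfly).2
      ⟨r.toButterfly.σ ≫ g.inl ≫ i + r.snd ≫ F.ι, ?_, ?_, ?_, ?_⟩⟩
    · have : r.f₁ ≫ F.ι = g.toButterfly.κ ≫ i := by
        rw [h₁', hκ]; simp [hF₂]
      simp [this, hF₁, g.κ_eq]
    · simp
    · simp [hF₃]
    · simp [hF₄, r.ρ_eq]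
  · rw [StrictHom.toHom_comp, StrictHom.toHom_eq_zero_iff] at hr
    obtain ⟨h, h₁, h₀⟩ := hr
    change g.f₁ ≫ r.f₁ = _ at h₁
    change g.f₀ ≫ r.f₀ = _ at h₀
    let u := g.toButterfly.σ ≫ h + g.snd ≫ r.f₁
    have hu₀ : u ≫ V.d = g.toButterfly.ρ ≫ r.f₀ := by
      simp [u, g.ρ_eq, h₀]
    have huc : a ≫ u = 0 := by
      refine Tilt.eq_zero (a ≫ u) ?_ ?_
      · rw [reassoc_of% hK]; simp [u, h₁]
      · rw [Category.assoc, hu₀, reassoc_of% haρ, zero_comp]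
    obtain ⟨u', hu'⟩ : ∃ u', c ≫ u' = u :=
      ⟨_, hS.gIsCokernel.fac (CokernelCofork.ofπ _ huc) WalkingParallelPair.one⟩
    let l : StrictHom C V := ⟨u', e₀.inv ≫ r.f₀, by
      rw [← cancel_epi c, reassoc_of% hu', hu₀, reassoc_of% hC]; simp⟩
    refine ⟨l.toHom, ?_⟩
    rw [StrictHom.toHom_comp]
    congr 1
    ext
    · simp [l, cc, hu', u]
    · simp [l, cc]
  · have hk0 : kk.toHom = 0 := by rw [← cancel_mono g.toHom, wk, zero_comp]
    have hidK : 𝟙 K = 0 := by rw [← cancel_mono kk.toHom, Category.id_comp, zero_comp, hk0]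
    rw [← StrictHom.toHom_id, StrictHom.toHom_eq_zero_iff] at hidK
    obtain ⟨hh, hh₁, hh₀⟩ := hidK
    change 𝟙 _ = _ at hh₁
    change 𝟙 _ = _ at hh₀
    rw [StrictHom.toHom_comp, StrictHom.toHom_eq_zero_iff] at hr
    obtain ⟨h, h₁, h₀⟩ := hr
    change r.f₁ ≫ g.toButterfly.ι ≫ c = _ at h₁
    change r.f₀ ≫ e₀.hom = _ at h₀
    have hκm : Mono g.toButterfly.κ := by
      have : Mono K.d := ⟨fun x y hxy => by
        rw [← Category.comp_id x, hh₁, reassoc_of% hxy, ← hh₁, Category.comp_id]⟩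
      rw [hκ]; infer_instance
    have hcond : ∀ {T : A} (x : T ⟶ pullback h c), x ≫ pullback.fst h c = 0 →
        ∃ y : T ⟶ X.X₁, x ≫ pullback.snd h c = y ≫ g.toButterfly.κ := by
      intro T x hx
      have h0 : (x ≫ pullback.snd h c) ≫ c = 0 := by
        rw [Category.assoc, ← pullback.condition, reassoc_of% hx, zero_comp]
      obtain ⟨y, hy⟩ : ∃ y, y ≫ a = x ≫ pullback.snd h c :=
        ⟨_, hS.fIsKernel.fac (KernelFork.ofι _ h0) WalkingParallelPair.zero⟩
      refine ⟨y ≫ hh ≫ e₁.hom, ?_⟩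
      rw [Category.assoc, Category.assoc, ← hK, ← hy, ← reassoc_of% hh₀]
    obtain ⟨F, q, hF₁, hF₂, hF₃, hF₄⟩ : ∃ (F : Butterfly V X) (q : F.E ⟶ g.toButterfly.E),
        F.κ ≫ q = r.f₁ ≫ g.toButterfly.ι ∧ F.ι ≫ q = g.toButterfly.κ ∧ q ≫ c = F.σ ≫ h ∧
          F.ρ = q ≫ g.toButterfly.σ :=
      ⟨{  E := pullback h c
          κ := pullback.lift V.d (r.f₁ ≫ g.toButterfly.ι) (by rw [Category.assoc, h₁])
          ι := pullback.lift 0 g.toButterfly.κ (by simp [hκc])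
          σ := pullback.fst _ _
          ρ := pullback.snd _ _ ≫ g.toButterfly.σ
          κσ := by simp
          ιρ := by simp
          κρ := by simp
          ισ := by simp
          shortExact := by
            have hι : Mono (pullback.lift 0 g.toButterfly.κ (by simp [hκc]) :
                X.X₁ ⟶ pullback h c) := mono_of_mono_fac (pullback.lift_snd _ _ _)
            refine ShortComplex.ShortExact.mk' ?_ hι (by dsimp; infer_instance)
            rw [ShortComplex.exact_iff_exact_up_to_refinements]
            intro T (x : T ⟶ pullback h c) (hx : x ≫ pullback.fst h c = 0)
            obtain ⟨y, hy⟩ := hcond x hx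
            refine ⟨T, 𝟙 _, inferInstance, y, ?_⟩
            dsimp
            apply pullback.hom_ext
            · simp [hx]
            · simp [hy] },
        pullback.snd _ _, pullback.lift_snd _ _ _, pullback.lift_snd _ _ _,
        pullback.condition.symm, rfl⟩
    refine ⟨F.toHom, (StrictHom.comp_toHom_eq_iff F g r.toButterfly).2
      ⟨F.σ ≫ r.inl - q ≫ g.snd ≫ r.toButterfly.ι, ?_, ?_, ?_, ?_⟩⟩
    · simp [reassoc_of% hF₁, r.κ_eq]
    · simp [reassoc_of% hF₂]
    · simp
    · have h5 : F.σ ≫ r.f₀ = q ≫ g.toButterfly.ρ := by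
        rw [← cancel_mono e₀.hom, Category.assoc, h₀, ← reassoc_of% hF₃, hC, Category.assoc]
      simp [h5, hF₄, g.ρ_eq]

section Abelian

open ZeroObject

variable {X Y Z W : Tilt t}

variable (t) in
/-- The zero object of the tilted category. -/
lemma hasZeroObject : HasZeroObject (Tilt t) := by
  obtain ⟨Z, h₁, h₀⟩ : ∃ Z : Tilt t, 𝟙 Z.X₁ = 0 ∧ 𝟙 Z.X₀ = 0 :=
    ⟨{  X₁ := 0
        X₀ := 0
        d := 0
        free_kernel := t.free_of_forall fun T _ f => by
          rw [← cancel_mono (kernel.ι _)]; exact (isZero_zero A).eq_of_tgt _ _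
        torsion_cokernel := t.torsion_of_forall fun F _ f => by
          rw [← cancel_epi (cokernel.π _)]; exact (isZero_zero A).eq_of_src _ _ },
      (isZero_zero A).eq_of_src _ _, (isZero_zero A).eq_of_src _ _⟩
  refine ⟨Z, (IsZero.iff_id_eq_zero Z).2 ?_⟩
  rw [← StrictHom.toHom_id, StrictHom.toHom_eq_zero_iff]
  refine ⟨0, ?_, ?_⟩
  · simpa using h₁
  · simpa using h₀

lemma hasKernels : HasKernels (Tilt t) where
  has_limit {X Y} f := by
    obtain ⟨X', s, g, hs, hg⟩ := Butterfly.exists_strict_source f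
    obtain ⟨K, C, k, c, ⟨w, ⟨hK⟩, -⟩, -⟩ := strict_analysis g
    refine ⟨⟨⟨KernelFork.ofι (k.toHom ≫ s.toHom) (by rw [Category.assoc, hg, w]),
      KernelFork.IsLimit.ofι _ _
        (fun {W} a ha => hK.lift (KernelFork.ofι (a ≫ inv s.toHom) (by simp [← hg, ha]))) ?_ ?_⟩⟩⟩
    · intro W a ha
      have := hK.fac (KernelFork.ofι (a ≫ inv s.toHom) (by simp [← hg, ha]))
        WalkingParallelPair.zero
      dsimp at this
      rw [reassoc_of% this]; simp
    · intro W a ha b hb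
      apply Fork.IsLimit.hom_ext hK
      have := hK.fac (KernelFork.ofι (a ≫ inv s.toHom) (by simp [← hg, ha]))
        WalkingParallelPair.zero
      dsimp at this ⊢
      rw [this, ← hb]; simp

lemma hasCokernels : HasCokernels (Tilt t) where
  has_colimit {X Y} f := by
    obtain ⟨Y', s, g, hs, hg⟩ := Butterfly.exists_strict_target f
    obtain ⟨K, C, k, c, -, ⟨w, ⟨hC⟩, -⟩⟩ := strict_analysis g
    refine ⟨⟨⟨CokernelCofork.ofπ (s.toHom ≫ c.toHom) (by rw [← Category.assoc, hg, w]),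
      CokernelCofork.IsColimit.ofπ _ _
        (fun {W} a ha => hC.desc (CokernelCofork.ofπ (inv s.toHom ≫ a) (by simp [← hg, ha])))
        ?_ ?_⟩⟩⟩
    · intro W a ha
      have := hC.fac (CokernelCofork.ofπ (inv s.toHom ≫ a) (by simp [← hg, ha]))
        WalkingParallelPair.one
      dsimp at this
      rw [Category.assoc, this]; simp
    · intro W a ha b hb
      apply Cofork.IsColimit.hom_ext hC
      have := hC.fac (CokernelCofork.ofπ (inv s.toHom ≫ a) (by simp [← hg, ha]))
        WalkingParallelPair.one
      dsimp at this ⊢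
      rw [this, ← hb]; simp

lemma isNormalMonoCategory : IsNormalMonoCategory (Tilt t) where
  normalMonoOfMono {X Y} f hf := by
    obtain ⟨X', s, g, hs, hg⟩ := Butterfly.exists_strict_source f
    obtain ⟨K, C, k, c, -, ⟨w, -, h⟩⟩ := strict_analysis g
    obtain ⟨h⟩ := h (by rw [← hg]; infer_instance)
    have hf' : f = inv s.toHom ≫ g.toHom := by rw [← hg]; simp
    exact ⟨{
      Z := C
      g := c.toHom
      w := by rw [hf', Category.assoc, w, comp_zero]
      isLimit := IsLimit.ofIsoLimit h
        (Fork.ext (asIso s.toHom) (by simpa using hg)) }⟩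

lemma isNormalEpiCategory : IsNormalEpiCategory (Tilt t) where
  normalEpiOfEpi {X Y} f hf := by
    obtain ⟨Y', s, g, hs, hg⟩ := Butterfly.exists_strict_target f
    obtain ⟨K, C, k, c, ⟨w, -, h⟩, -⟩ := strict_analysis g
    obtain ⟨h⟩ := h (by rw [← hg]; infer_instance)
    have hf' : f = g.toHom ≫ inv s.toHom := by rw [← hg]; simp
    exact ⟨{
      W := K
      g := k.toHom
      w := by rw [hf', reassoc_of% w, zero_comp]
      isColimit := IsColimit.ofIsoColimit h
        (Cofork.ext (asIso s.toHom).symm (by simp [hf'])) }⟩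

lemma exists_biprod (X Y : Tilt t) : ∃ (Z : Tilt t) (p : StrictHom Z X) (q : StrictHom Z Y)
    (i : StrictHom X Z) (j : StrictHom Y Z), i.comp p = .id X ∧ j.comp q = .id Y ∧
      i.comp q = .zero X Y ∧ j.comp p = .zero Y X ∧
      p.f₁ ≫ i.f₁ + q.f₁ ≫ j.f₁ = 𝟙 _ ∧ p.f₀ ≫ i.f₀ + q.f₀ ≫ j.f₀ = 𝟙 _ :=
  ⟨{  X₁ := X.X₁ ⊞ Y.X₁
      X₀ := X.X₀ ⊞ Y.X₀
      d := biprod.map X.d Y.d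
      free_kernel := t.free_of_forall fun T hT f => by
        rw [← cancel_mono (kernel.ι _), zero_comp]
        ext
        · have h : (f ≫ kernel.ι (biprod.map X.d Y.d) ≫ biprod.fst) ≫ X.d = 0 := by
            rw [Category.assoc, Category.assoc, ← biprod.map_fst, kernel.condition_assoc]; simp
          have := t.hom_eq_zero hT X.free_kernel (kernel.lift _ _ h)
          simpa using this =≫ kernel.ι _
        · have h : (f ≫ kernel.ι (biprod.map X.d Y.d) ≫ biprod.snd) ≫ Y.d = 0 := by
            rw [Category.assoc, Category.assoc, ← biprod.map_snd, kernel.condition_assoc]; simp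
          have := t.hom_eq_zero hT Y.free_kernel (kernel.lift _ _ h)
          simpa using this =≫ kernel.ι _
      torsion_cokernel := t.torsion_of_forall fun F hF f => by
        rw [← cancel_epi (cokernel.π _), comp_zero]
        ext
        · have h : X.d ≫ biprod.inl ≫ cokernel.π (biprod.map X.d Y.d) ≫ f = 0 := by
            rw [← biprod.inl_map_assoc, cokernel.condition_assoc]; simp
          have := t.hom_eq_zero X.torsion_cokernel hF (cokernel.desc _ _ h)
          simpa using cokernel.π _ ≫= this
        · have h : Y.d ≫ biprod.inr ≫ cokernel.π (biprod.map X.d Y.d) ≫ f = 0 := by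
            rw [← biprod.inr_map_assoc, cokernel.condition_assoc]; simp
          have := t.hom_eq_zero Y.torsion_cokernel hF (cokernel.desc _ _ h)
          simpa using cokernel.π _ ≫= this },
    ⟨biprod.fst, biprod.fst, by simp⟩, ⟨biprod.snd, biprod.snd, by simp⟩,
    ⟨biprod.inl, biprod.inl, by simp⟩, ⟨biprod.inr, biprod.inr, by simp⟩,
    by ext <;> simp, by ext <;> simp, by ext <;> simp, by ext <;> simp, by simp, by simp⟩

lemma hasBinaryProducts : HasBinaryProducts (Tilt t) := by
  have : ∀ {X Y : Tilt t}, HasLimit (pair X Y) := fun {X Y} => by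
    obtain ⟨Z, p, q, i, j, hip, hjq, hiq, hjp, h₁, h₀⟩ := exists_biprod X Y
    simp only [StrictHom.ext_iff, StrictHom.comp_f₁, StrictHom.comp_f₀, StrictHom.id_f₁,
      StrictHom.id_f₀, StrictHom.zero_f₁, StrictHom.zero_f₀] at hip hjq hiq hjp
    have ex : ∀ (W : Tilt t) (f : W ⟶ X) (g : W ⟶ Y), ∃ l : W ⟶ Z, l ≫ p.toHom = f ∧
        l ≫ q.toHom = g := by
      intro W f g
      obtain ⟨W', s, f', g', hs, hf, hg⟩ := exists_strict_source₂ f g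
      let l : StrictHom W' Z := ⟨f'.f₁ ≫ i.f₁ + g'.f₁ ≫ j.f₁, f'.f₀ ≫ i.f₀ + g'.f₀ ≫ j.f₀,
        by simp⟩
      refine ⟨inv s.toHom ≫ l.toHom, ?_, ?_⟩
      · rw [Category.assoc, IsIso.inv_comp_eq, hf, StrictHom.toHom_comp]
        congr 1
        ext <;> simp [l, hip, hjp]
      · rw [Category.assoc, IsIso.inv_comp_eq, hg, StrictHom.toHom_comp]
        congr 1
        ext <;> simp [l, hiq, hjq]
    have un : ∀ (W : Tilt t) (m m' : W ⟶ Z), m ≫ p.toHom = m' ≫ p.toHom →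
        m ≫ q.toHom = m' ≫ q.toHom → m = m' := by
      intro W m m' hp hq
      obtain ⟨W', s, f, g, hs, hf, hg⟩ := exists_strict_source₂ m m'
      rw [← cancel_epi s.toHom, hf, hg]
      have hp' : (f.comp p).toHom = (g.comp p).toHom := by
        rw [← StrictHom.toHom_comp, ← StrictHom.toHom_comp, ← hf, ← hg, Category.assoc, hp,
          Category.assoc]
      have hq' : (f.comp q).toHom = (g.comp q).toHom := by
        rw [← StrictHom.toHom_comp, ← StrictHom.toHom_comp, ← hf, ← hg, Category.assoc, hq,
          Category.assoc]
      rw [StrictHom.toHom_eq_iff] at hp' hq' ⊢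
      obtain ⟨a, a₁, a₀⟩ := hp'
      obtain ⟨b, b₁, b₀⟩ := hq'
      simp only [StrictHom.comp_f₁, StrictHom.comp_f₀] at a₁ a₀ b₁ b₀
      refine ⟨a ≫ i.f₁ + b ≫ j.f₁, ?_, ?_⟩
      · have := congr($a₁ ≫ i.f₁ + $b₁ ≫ j.f₁)
        simp only [Category.assoc, Preadditive.add_comp] at this
        rw [← Category.comp_id f.f₁, ← Category.comp_id g.f₁, ← h₁, Preadditive.comp_add, this]
        simp only [Preadditive.comp_add]; abel
      · have := congr($a₀ ≫ i.f₀ + $b₀ ≫ j.f₀)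
        simp only [Category.assoc, Preadditive.add_comp] at this
        rw [← Category.comp_id f.f₀, ← Category.comp_id g.f₀, ← h₀, Preadditive.comp_add, this]
        simp only [Preadditive.comp_add, Preadditive.add_comp, Category.assoc, StrictHom.comm]; abel
    choose l hl using ex
    exact ⟨⟨⟨BinaryFan.mk p.toHom q.toHom, BinaryFan.isLimitMk (fun s => l _ s.fst s.snd)
      (fun s => (hl _ s.fst s.snd).1) (fun s => (hl _ s.fst s.snd).2)
      (fun s m hp hq => un _ _ _ (hp.trans (hl _ s.fst s.snd).1.symm)
        (hq.trans (hl _ s.fst s.snd).2.symm))⟩⟩⟩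
  exact hasBinaryProducts_of_hasLimit_pair _

lemma hasBinaryCoproducts : HasBinaryCoproducts (Tilt t) := by
  have : ∀ {X Y : Tilt t}, HasColimit (pair X Y) := fun {X Y} => by
    obtain ⟨Z, p, q, i, j, hip, hjq, hiq, hjp, h₁, h₀⟩ := exists_biprod X Y
    simp only [StrictHom.ext_iff, StrictHom.comp_f₁, StrictHom.comp_f₀, StrictHom.id_f₁,
      StrictHom.id_f₀, StrictHom.zero_f₁, StrictHom.zero_f₀] at hip hjq hiq hjp
    have ex : ∀ (W : Tilt t) (f : X ⟶ W) (g : Y ⟶ W), ∃ l : Z ⟶ W, i.toHom ≫ l = f ∧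
        j.toHom ≫ l = g := by
      intro W f g
      obtain ⟨W', s, f', g', hs, hf, hg⟩ := exists_strict_target₂ f g
      let l : StrictHom Z W' := ⟨p.f₁ ≫ f'.f₁ + q.f₁ ≫ g'.f₁, p.f₀ ≫ f'.f₀ + q.f₀ ≫ g'.f₀,
        by simp⟩
      refine ⟨l.toHom ≫ inv s.toHom, ?_, ?_⟩
      · rw [← Category.assoc, IsIso.comp_inv_eq, hf, StrictHom.toHom_comp]
        congr 1
        ext <;> simp [l, reassoc_of% hip.1, reassoc_of% hip.2, reassoc_of% hiq.1,
          reassoc_of% hiq.2]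
      · rw [← Category.assoc, IsIso.comp_inv_eq, hg, StrictHom.toHom_comp]
        congr 1
        ext <;> simp [l, reassoc_of% hjp.1, reassoc_of% hjp.2, reassoc_of% hjq.1,
          reassoc_of% hjq.2]
    have un : ∀ (W : Tilt t) (m m' : Z ⟶ W), i.toHom ≫ m = i.toHom ≫ m' →
        j.toHom ≫ m = j.toHom ≫ m' → m = m' := by
      intro W m m' hp hq
      obtain ⟨W', s, f, g, hs, hf, hg⟩ := exists_strict_target₂ m m'
      rw [← cancel_mono s.toHom, hf, hg]
      have hp' : (i.comp f).toHom = (i.comp g).toHom := by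
        rw [← StrictHom.toHom_comp, ← StrictHom.toHom_comp, ← hf, ← hg, reassoc_of% hp]
      have hq' : (j.comp f).toHom = (j.comp g).toHom := by
        rw [← StrictHom.toHom_comp, ← StrictHom.toHom_comp, ← hf, ← hg, reassoc_of% hq]
      rw [StrictHom.toHom_eq_iff] at hp' hq' ⊢
      obtain ⟨a, a₁, a₀⟩ := hp'
      obtain ⟨b, b₁, b₀⟩ := hq'
      simp only [StrictHom.comp_f₁, StrictHom.comp_f₀] at a₁ a₀ b₁ b₀
      refine ⟨p.f₀ ≫ a + q.f₀ ≫ b, ?_, ?_⟩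
      · have := congr(p.f₁ ≫ $a₁ + q.f₁ ≫ $b₁)
        rw [← Category.id_comp f.f₁, ← Category.id_comp g.f₁, ← h₁, Preadditive.add_comp,
          Category.assoc, Category.assoc, this]
        simp only [Preadditive.comp_add, Preadditive.add_comp, Category.assoc,
          StrictHom.comm_assoc]; abel
      · have := congr(p.f₀ ≫ $a₀ + q.f₀ ≫ $b₀)
        rw [← Category.id_comp f.f₀, ← Category.id_comp g.f₀, ← h₀, Preadditive.add_comp,
          Category.assoc, Category.assoc, this]
        simp only [Preadditive.comp_add, Preadditive.add_comp, Category.assoc]; abel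
    choose l hl using ex
    exact ⟨⟨⟨BinaryCofan.mk i.toHom j.toHom, BinaryCofan.isColimitMk (fun s => l _ s.inl s.inr)
      (fun s => (hl _ s.inl s.inr).1) (fun s => (hl _ s.inl s.inr).2)
      (fun s m hp hq => un _ _ _ (hp.trans (hl _ s.inl s.inr).1.symm)
        (hq.trans (hl _ s.inl s.inr).2.symm))⟩⟩⟩
  exact hasBinaryCoproducts_of_hasColimit_pair _

/-- The tilted category is abelian. The addition of morphisms is the only one for which
composition is bilinear; it is the one determined by the universal properties of kernels,
cokernels, products and coproducts. -/
@[reducible]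
def nonPreadditiveAbelian (t : TorsionPair A) : NonPreadditiveAbelian (Tilt t) := by
  have h₁ := hasZeroObject t
  have h₂ := hasBinaryProducts (t := t)
  have h₃ := hasBinaryCoproducts (t := t)
  have h₄ := isNormalMonoCategory (t := t)
  have h₅ := isNormalEpiCategory (t := t)
  have h₆ := hasKernels (t := t)
  have h₇ := hasCokernels (t := t)
  have h₈ : HasFiniteProducts (Tilt t) := hasFiniteProducts_of_has_binary_and_terminal
  have h₉ : HasFiniteCoproducts (Tilt t) := hasFiniteCoproducts_of_has_binary_and_initial
  exact { }

instance : Preadditive (Tilt t) :=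
  letI := nonPreadditiveAbelian t
  NonPreadditiveAbelian.preadditive

end Abelian

end ZeroMorphisms

/-- The zero morphisms of the preadditive structure are the strict zero morphisms. -/
lemma zero_eq (X Y : Tilt t) : (0 : X ⟶ Y) = (StrictHom.zero X Y).toHom := rfl

instance : Abelian (Tilt t) := by
  have h₁ := hasZeroObject t
  have h₂ := hasBinaryProducts (t := t)
  have h₄ := isNormalMonoCategory (t := t)
  have h₅ := isNormalEpiCategory (t := t)
  have h₆ := hasKernels (t := t)
  have h₇ := hasCokernels (t := t)
  have h₈ : HasFiniteProducts (Tilt t) := hasFiniteProducts_of_has_binary_and_terminal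
  exact { }

namespace Butterfly

variable {X Y Z W X' Y' : Tilt t}

lemma eq_zero (P : Butterfly X Y) (Q : Butterfly X' Y') (ε : P.E ⟶ Q.E) (hκ : P.κ ≫ ε = 0)
    (hι : P.ι ≫ ε = 0) (hσ : ε ≫ Q.σ = 0) (hρ : ε ≫ Q.ρ = 0) : ε = 0 := by
  obtain ⟨a, ha⟩ : ∃ a : X.X₀ ⟶ Q.E, P.σ ≫ a = ε :=
    ⟨_, P.shortExact.gIsCokernel.fac (CokernelCofork.ofπ _ hι) WalkingParallelPair.one⟩
  have ha' : a ≫ Q.σ = 0 := by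
    rw [← cancel_epi P.σ, reassoc_of% ha, hσ, comp_zero]
  obtain ⟨b, hb⟩ : ∃ b : X.X₀ ⟶ Y'.X₁, b ≫ Q.ι = a :=
    ⟨_, Q.shortExact.fIsKernel.fac (KernelFork.ofι _ ha') WalkingParallelPair.zero⟩
  have h0 : b = 0 := Tilt.eq_zero b
    (by rw [← cancel_mono Q.ι, Category.assoc, hb, ← P.κσ, Category.assoc, ha, hκ, zero_comp])
    (by rw [← Q.ιρ, reassoc_of% hb, ← cancel_epi P.σ, reassoc_of% ha, hρ, comp_zero])
  rw [← ha, ← hb, h0, zero_comp, comp_zero]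

/-- A link between the middle objects of two consecutive butterflies. -/
structure IsLink (P : Butterfly X Y) (Q : Butterfly Y Z) (δ : P.E ⟶ Q.E) : Prop where
  κ : P.κ ≫ δ = 0
  ι : P.ι ≫ δ = Q.κ
  σ : δ ≫ Q.σ = P.ρ
  ρ : δ ≫ Q.ρ = 0

lemma exists_isLink (P : Butterfly X Y) (Q : Butterfly Y Z) (h : P.toHom ≫ Q.toHom = 0) :
    ∃ δ : P.E ⟶ Q.E, IsLink P Q δ := by
  have hc := isComp_comp P Q
  rw [toHom_comp, zero_eq, StrictHom.toHom, toHom_eq_iff] at h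
  obtain ⟨e, he⟩ := h
  let r : pullback P.ρ Q.σ ⟶ Z.X₁ := P.compπ Q ≫ e.hom ≫ (StrictHom.zero X Z).snd
  have r₁ : pullback.lift P.κ 0 (by simp) ≫ r = 0 := by
    simp only [r, reassoc_of% hc.κ, reassoc_of% he.κ, StrictHom.κ_snd, StrictHom.zero_f₁, neg_zero]
  have r₂ : pullback.lift 0 Q.ι (by simp) ≫ r = 𝟙 _ := by
    simp only [r, reassoc_of% hc.ι, reassoc_of% he.ι, StrictHom.ι_snd]
  have r₃ : pullback.lift P.ι Q.κ (by simp) ≫ r = 0 := by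
    simp only [r, reassoc_of% hc.zero, zero_comp]
  have r₄ : r ≫ Z.d = pullback.snd P.ρ Q.σ ≫ Q.ρ := by
    have := (StrictHom.zero X Z).ρ_eq
    simp only [StrictHom.zero_f₀, comp_zero, zero_add] at this
    simp only [r, Category.assoc]
    rw [← this, he.ρ, hc.ρ]
  have hs : kernel.ι (pullback.fst P.ρ Q.σ) ≫ (pullback.snd P.ρ Q.σ - r ≫ Q.ι) = 0 := by
    have h0 : (kernel.ι (pullback.fst P.ρ Q.σ) ≫ pullback.snd P.ρ Q.σ) ≫ Q.σ = 0 := by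
      rw [Category.assoc, ← pullback.condition, kernel.condition_assoc, zero_comp]
    obtain ⟨l, hl⟩ : ∃ l, l ≫ Q.ι = kernel.ι (pullback.fst P.ρ Q.σ) ≫ pullback.snd P.ρ Q.σ :=
      ⟨_, Q.shortExact.fIsKernel.fac (KernelFork.ofι _ h0) WalkingParallelPair.zero⟩
    have h1 : kernel.ι (pullback.fst P.ρ Q.σ) = l ≫ pullback.lift 0 Q.ι (by simp) := by
      apply pullback.hom_ext
      · simp
      · simp [hl]
    rw [h1]
    simp [reassoc_of% r₂]
  let δ := (CokernelCofork.IsColimit.desc' (Abelian.epiIsCokernelOfKernel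
    (KernelFork.ofι _ (kernel.condition (pullback.fst P.ρ Q.σ))) (kernelIsKernel _)) _ hs).1
  have hδ : pullback.fst P.ρ Q.σ ≫ δ = pullback.snd P.ρ Q.σ - r ≫ Q.ι :=
    (CokernelCofork.IsColimit.desc' (Abelian.epiIsCokernelOfKernel
      (KernelFork.ofι _ (kernel.condition (pullback.fst P.ρ Q.σ))) (kernelIsKernel _)) _ hs).2
  refine ⟨δ, ?_, ?_, ?_, ?_⟩
  · have := pullback.lift P.κ 0 (by simp) ≫= hδ
    simpa [reassoc_of% r₁] using this
  · have := pullback.lift P.ι Q.κ (by simp) ≫= hδ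
    simpa [reassoc_of% r₃] using this
  · rw [← cancel_epi (pullback.fst P.ρ Q.σ), reassoc_of% hδ, pullback.condition]; simp
  · rw [← cancel_epi (pullback.fst P.ρ Q.σ), reassoc_of% hδ]; simp [r₄]

lemma IsLink.unique {P : Butterfly X Y} {Q : Butterfly Y Z} {δ δ' : P.E ⟶ Q.E}
    (h : IsLink P Q δ) (h' : IsLink P Q δ') : δ = δ' :=
  sub_eq_zero.1 (eq_zero P Q _ (by simp [h.κ, h'.κ]) (by simp [h.ι, h'.ι]) (by simp [h.σ, h'.σ])
    (by simp [h.ρ, h'.ρ]))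

lemma IsLink.comp {P : Butterfly X Y} {Q : Butterfly Y Z} {R : Butterfly Z W} {δ : P.E ⟶ Q.E}
    {δ' : Q.E ⟶ R.E} (h : IsLink P Q δ) (h' : IsLink Q R δ') : δ ≫ δ' = 0 :=
  eq_zero P R _ (by rw [reassoc_of% h.κ, zero_comp]) (by rw [reassoc_of% h.ι, h'.κ])
    (by rw [Category.assoc, h'.σ, h.ρ]) (by rw [Category.assoc, h'.ρ, comp_zero])

lemma IsLink.compatible_aux {P : Butterfly X Y} {Q : Butterfly Y Z} {δ : P.E ⟶ Q.E}
    (hl : IsLink P Q δ) {M M' : A} (m : M ⟶ P.E) (m' : M' ⟶ Q.E) (e : M ≅ Y.X₁)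
    (he : e.hom ≫ P.ι = m) (e' : M' ≅ Z.X₁) (he' : e'.hom ≫ Q.ι = m') :
    t.free (kernel (m ≫ δ ≫ cokernel.π m')) ∧ t.torsion (cokernel (m ≫ δ ≫ cokernel.π m')) := by
  obtain ⟨r, hr⟩ : ∃ r, r = m ≫ δ ≫ cokernel.π m' := ⟨_, rfl⟩
  rw [← hr]
  rw [← he, Category.assoc, reassoc_of% hl.ι] at hr
  have h0 : m' ≫ Q.σ = 0 := by rw [← he', Category.assoc, ισ, comp_zero]
  constructor
  · refine t.free_of_forall fun T hT f => ?_
    have h1 : (f ≫ kernel.ι r ≫ e.hom) ≫ Y.d = 0 := by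
      have h := kernel.condition r =≫ cokernel.desc _ _ h0
      have h' : r ≫ cokernel.desc _ _ h0 = e.hom ≫ Y.d := by
        rw [hr, Category.assoc, Category.assoc, cokernel.π_desc, κσ]
      rw [Category.assoc, h', zero_comp] at h
      rw [Category.assoc, Category.assoc, h, comp_zero]
    have := t.hom_eq_zero hT Y.free_kernel (kernel.lift _ _ h1) =≫ kernel.ι _
    rw [kernel.lift_ι, zero_comp, ← Category.assoc, ← cancel_mono e.inv, Category.assoc,
      e.hom_inv_id, Category.comp_id, zero_comp] at this
    rw [← cancel_mono (kernel.ι _), this, zero_comp]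
  · refine t.torsion_of_forall fun F hF f => ?_
    have h1 : Q.ι ≫ cokernel.π m' ≫ cokernel.π r ≫ f = 0 := by
      rw [← cancel_epi e'.hom, reassoc_of% he', cokernel.condition_assoc, zero_comp, comp_zero]
    obtain ⟨b, hb⟩ : ∃ b : Y.X₀ ⟶ F, Q.σ ≫ b = cokernel.π m' ≫ cokernel.π r ≫ f :=
      ⟨_, Q.shortExact.gIsCokernel.fac (CokernelCofork.ofπ _ h1) WalkingParallelPair.one⟩
    have h2 : Y.d ≫ b = 0 := by
      have h : e.hom ≫ Q.κ ≫ cokernel.π m' ≫ cokernel.π r = 0 := by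
        rw [← cokernel.condition r]
        exact (by rw [hr]; simp : ∀ {T : A} (x : cokernel m' ⟶ T),
          e.hom ≫ Q.κ ≫ cokernel.π m' ≫ x = r ≫ x) _
      rw [← Q.κσ, Category.assoc, hb, ← cancel_epi e.hom, comp_zero]
      simpa only [Category.assoc, zero_comp] using h =≫ f
    have := cokernel.π _ ≫= t.hom_eq_zero Y.torsion_cokernel hF (cokernel.desc _ _ h2)
    rw [cokernel.π_desc, comp_zero] at this
    rw [this, comp_zero] at hb
    rw [← cancel_epi (cokernel.π _), ← cancel_epi (cokernel.π _), ← hb, comp_zero, comp_zero]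

lemma exists_isMapOver (P : Butterfly X Y) (P' : Butterfly X' Y') (f : StrictHom X X')
    (g : StrictHom Y Y') (h : f.toHom ≫ P'.toHom = P.toHom ≫ g.toHom) :
    ∃ φ : P.E ⟶ P'.E, IsMapOver P P' f g φ := by
  obtain ⟨R, hR⟩ := exists_toHom (f.toHom ≫ P'.toHom)
  obtain ⟨ψ, hψ⟩ := (StrictHom.toHom_comp_eq_iff f P' R).1 hR.symm
  obtain ⟨ψ', hψ'⟩ := (StrictHom.comp_toHom_eq_iff P g R).1 (h.symm.trans hR.symm)
  refine ⟨ψ' ≫ ψ, ?_, ?_, ?_, ?_⟩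
  · rw [reassoc_of% hψ'.κ, hψ.κ]; simp
  · rw [reassoc_of% hψ'.ι, hψ.ι]; simp
  · rw [Category.assoc, hψ.σ, reassoc_of% hψ'.σ]; simp
  · rw [Category.assoc, hψ.ρ, reassoc_of% hψ'.ρ]; simp

lemma IsMapOver.unique {P : Butterfly X Y} {P' : Butterfly X' Y'} {f : StrictHom X X'}
    {g : StrictHom Y Y'} {φ φ' : P.E ⟶ P'.E} (h : IsMapOver P P' f g φ)
    (h' : IsMapOver P P' f g φ') : φ = φ' :=
  sub_eq_zero.1 (eq_zero P P' _ (by simp [h.κ, h'.κ]) (by simp [h.ι, h'.ι]) (by simp [h.σ, h'.σ])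
    (by simp [h.ρ, h'.ρ]))

/-- A representative of a morphism of the tilted category. -/
def rep (f : X ⟶ Y) : Butterfly X Y := (exists_toHom f).choose

@[simp]
lemma rep_toHom (f : X ⟶ Y) : (rep f).toHom = f := (exists_toHom f).choose_spec

end Butterfly

variable (t) in
/-- The category of complexes in the tilted category and strict morphisms between them: a
morphism is a family of strict morphisms whose classes commute with the differentials. -/
structure StrictComplex where
  K : CochainComplex (Tilt t) ℤ

namespace StrictComplex

/-- Strict morphisms of complexes. -/
@[ext]
structure Hom (X Y : StrictComplex t) where
  f (n : ℤ) : StrictHom (X.K.X n) (Y.K.X n)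
  comm (i j : ℤ) : (f i).toHom ≫ Y.K.d i j = X.K.d i j ≫ (f j).toHom

@[simps]
instance : Category (StrictComplex t) where
  Hom X Y := Hom X Y
  id X := ⟨fun n => StrictHom.id _, fun i j => by
    rw [StrictHom.toHom_id, StrictHom.toHom_id, Category.id_comp, Category.comp_id]⟩
  comp F G := ⟨fun n => (F.f n).comp (G.f n), fun i j => by
    rw [← StrictHom.toHom_comp, ← StrictHom.toHom_comp, Category.assoc, G.comm, ← Category.assoc,
      F.comm, Category.assoc]⟩
  id_comp F := by ext <;> simp
  comp_id F := by ext <;> simp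
  assoc F G H := by ext <;> simp

variable (t) in
/-- The functor to the category of complexes in the tilted category. -/
def incl : StrictComplex t ⥤ CochainComplex (Tilt t) ℤ where
  obj X := X.K
  map F := { f := fun n => (F.f n).toHom, comm' := fun i j _ => F.comm i j }
  map_id X := rfl
  map_comp F G := by
    ext n
    exact (StrictHom.toHom_comp _ _).symm

end StrictComplex

variable (A) in
/-- Decorated complexes: complexes in `A` with a subobject in each degree. -/
structure Decorated where
  E : CochainComplex A ℤ
  M (n : ℤ) : Subobject (E.X n)

namespace Decorated

/-- Morphisms of decorated complexes are the morphisms of complexes that respect the subobjects. -/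
@[ext]
structure Hom (X Y : Decorated A) where
  f : X.E ⟶ Y.E
  factors (n : ℤ) : (Y.M n).Factors ((X.M n).arrow ≫ f.f n)

@[simps]
instance : Category (Decorated A) where
  Hom X Y := Hom X Y
  id X := ⟨𝟙 _, fun n => by
    rw [HomologicalComplex.id_f, Category.comp_id]
    exact Subobject.factors_self _⟩
  comp {X Y Z} F G := ⟨F.f ≫ G.f, fun n => by
    rw [HomologicalComplex.comp_f, ← Category.assoc, ← Subobject.factorThru_arrow _ _ (F.factors n),
      Category.assoc]
    exact Subobject.factors_of_factors_right _ (G.factors n)⟩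

variable (A) in
/-- The functor that forgets the decoration. -/
def forget : Decorated A ⥤ CochainComplex A ℤ where
  obj X := X.E
  map F := F.f

/-- The map `M i ⟶ E j / M j` induced by the differential. -/
def ratio (X : Decorated A) (i j : ℤ) : (X.M i : A) ⟶ cokernel (X.M j).arrow :=
  (X.M i).arrow ≫ X.E.d i j ≫ cokernel.π (X.M j).arrow

/-- Compatibility of a decorated complex with a torsion pair. -/
def compatible (t : TorsionPair A) : ObjectProperty (Decorated A) := fun X =>
  ∀ n : ℤ, t.free (kernel (X.ratio n (n + 1))) ∧ t.torsion (cokernel (X.ratio n (n + 1)))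

end Decorated

/-- The category of decorated complexes that are compatible with a torsion pair. -/
abbrev CompatibleDecorated (t : TorsionPair A) := (Decorated.compatible t).FullSubcategory

namespace StrictComplex

/-- A butterfly that represents the differential of a complex in the tilted category. -/
def butterfly (X : StrictComplex t) (i j : ℤ) : Butterfly (X.K.X i) (X.K.X j) :=
  Butterfly.rep (X.K.d i j)

lemma exists_link (X : StrictComplex t) (i j k : ℤ) :
    ∃ δ : (X.butterfly i j).E ⟶ (X.butterfly j k).E,
      Butterfly.IsLink (X.butterfly i j) (X.butterfly j k) δ :=
  Butterfly.exists_isLink _ _ (by simp [butterfly])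

/-- The link between consecutive differentials. -/
def link (X : StrictComplex t) (i j k : ℤ) : (X.butterfly i j).E ⟶ (X.butterfly j k).E :=
  (X.exists_link i j k).choose

lemma isLink (X : StrictComplex t) (i j k : ℤ) :
    Butterfly.IsLink (X.butterfly i j) (X.butterfly j k) (X.link i j k) :=
  (X.exists_link i j k).choose_spec

/-- The differential of the total complex: the link from the differential with target `X i` to the
differential with target `X (i + 1)`. -/
def totD (X : StrictComplex t) (i j : ℤ) :
    (X.butterfly (i - 1) i).E ⟶ (X.butterfly (j - 1) j).E :=
  if h : i + 1 = j then
    X.link (i - 1) i j ≫ eqToHom (by obtain rfl : i = j - 1 := by lia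
                                     rfl)
  else 0

lemma totD_eq (X : StrictComplex t) (j : ℤ) :
    X.totD (j - 1) j = X.link (j - 1 - 1) (j - 1) j := by
  rw [totD, dif_pos (sub_add_cancel j 1), eqToHom_refl, Category.comp_id]

lemma isLink_totD (X : StrictComplex t) (j : ℤ) :
    Butterfly.IsLink (X.butterfly (j - 1 - 1) (j - 1)) (X.butterfly (j - 1) j)
      (X.totD (j - 1) j) := by
  rw [totD_eq]; exact X.isLink _ _ _

/-- The total complex: in degree `n`, the middle object of the butterfly of the differential with
target `X n`. -/
def totE (X : StrictComplex t) : CochainComplex A ℤ where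
  X n := (X.butterfly (n - 1) n).E
  d i j := X.totD i j
  shape i j h := dif_neg h
  d_comp_d' i j k hij hjk := by
    obtain rfl : i = j - 1 := eq_sub_of_add_eq hij
    obtain rfl : j = k - 1 := eq_sub_of_add_eq hjk
    exact (X.isLink_totD _).comp (X.isLink_totD _)

/-- The inclusion of `X n ⁻¹` in the total complex. -/
def totι (X : StrictComplex t) (n : ℤ) : (X.K.X n).X₁ ⟶ X.totE.X n := (X.butterfly (n - 1) n).ι

instance (X : StrictComplex t) (n : ℤ) : Mono (X.totι n) :=
  inferInstanceAs (Mono (X.butterfly (n - 1) n).ι)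

/-- The total complex with its decoration by the images of the maps `ι`. -/
def totDec (X : StrictComplex t) : Decorated A where
  E := X.totE
  M n := Subobject.mk (X.totι n)

lemma totDec_compatible (X : StrictComplex t) : Decorated.compatible t X.totDec := by
  suffices ∀ i j : ℤ, i = j - 1 →
      t.free (kernel (X.totDec.ratio i j)) ∧ t.torsion (cokernel (X.totDec.ratio i j)) from
    fun n => this n (n + 1) (by simp)
  rintro i j rfl
  have h := Subobject.underlyingIso_hom_comp_eq_mk (X.totι (j - 1))
  have h' := Subobject.underlyingIso_hom_comp_eq_mk (X.totι j)
  exact (X.isLink_totD j).compatible_aux _ _ _ h _ h'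

variable {X Y Z : StrictComplex t}

lemma exists_totMap (F : X ⟶ Y) (i j : ℤ) :
    ∃ φ : (X.butterfly i j).E ⟶ (Y.butterfly i j).E,
      Butterfly.IsMapOver (X.butterfly i j) (Y.butterfly i j) (F.f i) (F.f j) φ :=
  Butterfly.exists_isMapOver _ _ _ _ (by
    rw [butterfly, butterfly, Butterfly.rep_toHom, Butterfly.rep_toHom]; exact F.comm i j)

/-- The map of middle objects induced by a strict morphism of complexes. -/
def totMap (F : X ⟶ Y) (i j : ℤ) : (X.butterfly i j).E ⟶ (Y.butterfly i j).E :=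
  (exists_totMap F i j).choose

lemma isMapOver_totMap (F : X ⟶ Y) (i j : ℤ) :
    Butterfly.IsMapOver (X.butterfly i j) (Y.butterfly i j) (F.f i) (F.f j) (totMap F i j) :=
  (exists_totMap F i j).choose_spec

/-- The morphism of total complexes induced by a strict morphism of complexes. -/
def totEMap (F : X ⟶ Y) : X.totE ⟶ Y.totE where
  f n := totMap F (n - 1) n
  comm' i j hij := by
    obtain rfl : i = j - 1 := eq_sub_of_add_eq hij
    have h := isMapOver_totMap F (j - 1) j
    have h' := isMapOver_totMap F (j - 1 - 1) (j - 1)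
    have l := X.isLink_totD j
    have l' := Y.isLink_totD j
    refine sub_eq_zero.1 (Butterfly.eq_zero (X.butterfly _ _) (Y.butterfly _ _)
      (totMap F (j - 1 - 1) (j - 1) ≫ Y.totD (j - 1) j - X.totD (j - 1) j ≫ totMap F (j - 1) j)
      ?_ ?_ ?_ ?_)
    · rw [Preadditive.comp_sub, reassoc_of% h'.κ, reassoc_of% l.κ, l'.κ]; simp
    · rw [Preadditive.comp_sub, reassoc_of% h'.ι, reassoc_of% l.ι, l'.ι, h.κ]; simp
    · rw [Preadditive.sub_comp, Category.assoc, Category.assoc, l'.σ, h.σ, h'.ρ,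
        reassoc_of% l.σ]; simp
    · rw [Preadditive.sub_comp, Category.assoc, Category.assoc, l'.ρ, h.ρ,
        reassoc_of% l.ρ]; simp

lemma totι_map (F : X ⟶ Y) (n : ℤ) :
    X.totι n ≫ (totEMap F).f n = (F.f n).f₁ ≫ Y.totι n :=
  (isMapOver_totMap F (n - 1) n).ι

variable (t) in
/-- The functor `Tot`. -/
def tot : StrictComplex t ⥤ CompatibleDecorated t where
  obj X := ⟨X.totDec, X.totDec_compatible⟩
  map {X Y} F := ObjectProperty.homMk
    { f := totEMap F
      factors := fun n => by
        refine (Subobject.factors_iff _ _).2 ⟨(Subobject.underlyingIso (X.totι n)).hom ≫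
          (F.f n).f₁ ≫ (Subobject.underlyingIso (Y.totι n)).inv, ?_⟩
        change (_ ≫ _ ≫ _) ≫ (Subobject.mk (Y.totι n)).arrow =
          (Subobject.mk (X.totι n)).arrow ≫ (totEMap F).f n
        rw [Category.assoc, Category.assoc, Subobject.underlyingIso_arrow, ← totι_map,
          Subobject.underlyingIso_hom_comp_eq_mk_assoc] }
  map_id X := by
    apply ObjectProperty.hom_ext
    apply Decorated.Hom.ext
    ext n
    exact (isMapOver_totMap (𝟙 X) (n - 1) n).unique
      (φ' := 𝟙 (X.butterfly (n - 1) n).E) ⟨by simp, by simp, by simp, by simp⟩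
  map_comp F G := by
    apply ObjectProperty.hom_ext
    apply Decorated.Hom.ext
    ext n
    have h := isMapOver_totMap F (n - 1) n
    have h' := isMapOver_totMap G (n - 1) n
    refine (isMapOver_totMap (F ≫ G) (n - 1) n).unique
      (φ' := totMap F (n - 1) n ≫ totMap G (n - 1) n) ⟨?_, ?_, ?_, ?_⟩
    · rw [reassoc_of% h.κ, h'.κ]; simp
    · rw [reassoc_of% h.ι, h'.ι]; simp
    · rw [Category.assoc, h'.σ, reassoc_of% h.σ]; simp
    · rw [Category.assoc, h'.ρ, reassoc_of% h.ρ]; simp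

end StrictComplex

variable (t) in
/-- The underlying complex of a compatible decorated complex. -/
def forgetDecoration : CompatibleDecorated t ⥤ CochainComplex A ℤ :=
  (Decorated.compatible t).ι ⋙ Decorated.forget A

/-- `Ψ` is the functor induced by `Φ ∘ Tot`: on strict complexes it agrees, up to a natural
isomorphism, with the functor that sends a complex to its total complex without the decoration. -/
def IsPhiTot (t : TorsionPair A) [HasDerivedCategory.{w} A] [HasDerivedCategory.{w'} (Tilt t)]
    (Ψ : DerivedCategory (Tilt t) ⥤ DerivedCategory A) : Prop :=
  Nonempty (StrictComplex.incl t ⋙ DerivedCategory.Q ⋙ Ψ ≅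
    StrictComplex.tot t ⋙ forgetDecoration t ⋙ DerivedCategory.Q)

/-- A triangle equivalence: a triangulated functor that is an equivalence of categories. -/
structure IsTriangleEquivalence {C D : Type*} [Category* C] [Category* D] [HasShift C ℤ]
    [HasShift D ℤ] [HasZeroObject C] [HasZeroObject D] [Preadditive C] [Preadditive D]
    [∀ n : ℤ, (shiftFunctor C n).Additive] [∀ n : ℤ, (shiftFunctor D n).Additive]
    [Pretriangulated C] [Pretriangulated D] (F : C ⥤ D) [F.CommShift ℤ] : Prop where
  isTriangulated : F.IsTriangulated
  isEquivalence : F.IsEquivalence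

/-- The functor between full subcategories induced by a functor that preserves them. -/
abbrev restrict {C D : Type*} [Category* C] [Category* D] (F : C ⥤ D) (P : ObjectProperty C)
    (Q : ObjectProperty D) (h : ∀ X, P X → Q (F.obj X)) :
    P.FullSubcategory ⥤ Q.FullSubcategory :=
  Q.lift (P.ι ⋙ F) fun X => h X.obj X.property

end HRS

end

/-! A decoration of a complex `E` over `A` consists of short exact sequences `0 → X n ⁻¹ → E n → X
(n-1) ⁰ → 0` in which the differential of `E` induces the differentials of two-term complexes `X n`
of the tilted category. The arrows around `E n` then form a butterfly `X (n-1) ⟶ X n`, with `κ = ι ≫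
d` and `ρ = d ≫ σ`, and the differential of `E` links consecutive butterflies, which forces them to
compose to zero. Conversely, butterflies that compose to zero have a unique link. A complex `K` in
the tilted category is thus the same, up to isomorphism, as a decorated complex `E` over `A` (a
`Model K E`), and `Tot` is one such model. The whole proof works with arbitrary models, so that
shifts, cones and resolutions can be taken in `A` and decorated there.

Three facts carry the comparison. Rigidity: a map of middle objects that vanishes on all four arrows
is zero, because `Hom(T, F) = 0` kills any map `X⁰ ⟶ Y⁻¹` annihilated by both differentials. So
strict morphisms lift uniquely to models (`Model.exists_over`, `Model.Over.unique`), every coherence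
can be checked on decorations, and strict morphisms with equal classes lift to homotopic ones
(`Model.Over.nonempty_homotopy`). Exactness: `K` is acyclic if and only if `E` is
(`Model.acyclic_iff`). In a linked exact sequence of butterflies the link is an epimorphism onto the
torsion part of the next middle object, followed by its inclusion (`IsLink.exists_iso_of_exact`).
Cones: the cone of a morphism of models is a model of a complex isomorphic to the cone of the
induced morphism. Hence quasi-isomorphisms on the two sides correspond (`Model.Over.quasiIso_iff`).

Every morphism of complexes in the tilted category is a fraction of strict ones whose denominator is
an isomorphism (`StrictComplex.exists_fac`). This extends `Tot` to all morphisms, with values in the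
derived category of `A` (`totFunctor`), and it also gives uniqueness. The extension inverts
quasi-isomorphisms and so yields `phiTot`; it is triangulated because models of cones are cones.
Exactness of `K` and of `E` differ by at most one degree, so boundedness is preserved and reflected.

For the equivalence, take the cotilting case. Torsion-free objects are closed under subobjects, so
the kernel of an epimorphism from a complex of torsion-free terms again has such terms, and a single
cone resolves any complex, bounded or not (`TorsionPair.IsCotilting.exists_resolution`). A complex
of torsion-free terms can be decorated by itself, and every morphism between such complexes respects
these decorations. Pulling a decoration back along a resolution and then enlarging it to the full
one shows that every object of the derived category of the tilted category comes from such a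
complex. Fullness and essential surjectivity follow by resolving fractions and objects. Faithfulness
follows from fullness, since the functor is triangulated and detects zero objects. So `phiTot` is
already an equivalence on unbounded derived categories, and it restricts because boundedness is
preserved and reflected. The tilting case is dual, with torsion terms and the zero decoration. -/

noncomputable section

namespace HRS

attribute [local simp] pullback.lift_fst pullback.lift_fst_assoc pullback.lift_snd
  pullback.lift_snd_assoc

universe w w' v u

variable {A : Type u} [Category.{v} A] [Abelian A] {t : TorsionPair A}

/-! ### Addition of strict morphisms and of butterflies; relations between butterflies expressed by
maps of middle objects -/

namespace StrictHom

variable {X Y Z W : Tilt t}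

/-- The sum of strict morphisms. -/
@[simps]
def add (f g : StrictHom X Y) : StrictHom X Y where
  f₁ := f.f₁ + g.f₁
  f₀ := f.f₀ + g.f₀
  comm := by simp

/-- The negative of a strict morphism. -/
@[simps]
def neg (f : StrictHom X Y) : StrictHom X Y where
  f₁ := -f.f₁
  f₀ := -f.f₀
  comm := by simp

/-- The strict morphism between equal objects. -/
@[simps]
def ofEq (h : X = Y) : StrictHom X Y where
  f₁ := eqToHom (by rw [h])
  f₀ := eqToHom (by rw [h])
  comm := by subst h; simp

lemma toHom_ofEq (h : X = Y) : (ofEq h).toHom = eqToHom h := by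
  subst h
  exact toHom_id X

lemma toHom_zero : (zero X Y).toHom = 0 := rfl

lemma toHom_eq_zero_iff' (f : StrictHom X Y) :
    f.toHom = 0 ↔ ∃ h : X.X₀ ⟶ Y.X₁, f.f₁ = X.d ≫ h ∧ f.f₀ = h ≫ Y.d := by
  rw [zero_eq, toHom_eq_iff]; simp

/-- Strict morphisms `p`, `q`, `i`, `j` that exhibit `Z` as a biproduct of `X` and `Y`. -/
structure IsBiprod (p : StrictHom Z X) (q : StrictHom Z Y) (i : StrictHom X Z)
    (j : StrictHom Y Z) : Prop where
  ip : i.comp p = id X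
  jq : j.comp q = id Y
  iq : i.comp q = zero X Y
  jp : j.comp p = zero Y X
  total : (p.comp i).add (q.comp j) = id Z

namespace IsBiprod

variable {p : StrictHom Z X} {q : StrictHom Z Y} {i : StrictHom X Z} {j : StrictHom Y Z}

/-- The addition of the tilted category is known only abstractly, so the identity cannot be computed
on butterflies. The difference of the two sides is killed by both projections, and these are jointly
monic. -/
lemma toHom_total (h : IsBiprod p q i j) : p.toHom ≫ i.toHom + q.toHom ≫ j.toHom = 𝟙 Z := by
  have hip : i.toHom ≫ p.toHom = 𝟙 X := by rw [toHom_comp, h.ip, toHom_id]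
  have hjq : j.toHom ≫ q.toHom = 𝟙 Y := by rw [toHom_comp, h.jq, toHom_id]
  have hiq : i.toHom ≫ q.toHom = 0 := by rw [toHom_comp, h.iq, toHom_zero]
  have hjp : j.toHom ≫ p.toHom = 0 := by rw [toHom_comp, h.jp, toHom_zero]
  -- Joint monicity: after making `u` strict, null-homotopies `a` and `b` of its two components
  -- assemble to the null-homotopy `a ≫ i.f₁ + b ≫ j.f₁`.
  have key : ∀ (W : Tilt t) (u : W ⟶ Z), u ≫ p.toHom = 0 → u ≫ q.toHom = 0 → u = 0 := by
    intro W u hp hq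
    obtain ⟨W', s, g, hs, hg⟩ := Butterfly.exists_strict_source u
    have hp' : (g.comp p).toHom = 0 := by
      rw [← toHom_comp, ← hg, Category.assoc, hp, comp_zero]
    have hq' : (g.comp q).toHom = 0 := by
      rw [← toHom_comp, ← hg, Category.assoc, hq, comp_zero]
    rw [toHom_eq_zero_iff'] at hp' hq'
    obtain ⟨a, a₁, a₀⟩ := hp'
    obtain ⟨b, b₁, b₀⟩ := hq'
    have t₁ := congr_arg StrictHom.f₁ h.total
    have t₀ := congr_arg StrictHom.f₀ h.total
    simp only [comp_f₁, comp_f₀, add_f₁, add_f₀, id_f₁, id_f₀] at a₁ a₀ b₁ b₀ t₁ t₀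
    have : g.toHom = 0 := (toHom_eq_zero_iff' g).2 ⟨a ≫ i.f₁ + b ≫ j.f₁,
      by rw [← Category.comp_id g.f₁, ← t₁]; simp [reassoc_of% a₁, reassoc_of% b₁],
      by rw [← Category.comp_id g.f₀, ← t₀]; simp [reassoc_of% a₀, reassoc_of% b₀]⟩
    rw [← cancel_epi s.toHom, hg, this, comp_zero]
  rw [← sub_eq_zero]
  apply key
  · simp [hip, hjp]
  · simp [hiq, hjq]

end IsBiprod

/-- The sum factors as the diagonal `X ⟶ X ⊕ X` followed by the morphism with components `f` and
`g`. Bilinearity of composition reduces the claim to the diagonal, where it is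
`IsBiprod.toHom_total`. This identifies the abstract addition with the termwise one. -/
lemma toHom_add (f g : StrictHom X Y) : (f.add g).toHom = f.toHom + g.toHom := by
  obtain ⟨Z, p, q, i, j, hip, hjq, hiq, hjp, h₁, h₀⟩ := exists_biprod X X
  have h : IsBiprod p q i j := ⟨hip, hjq, hiq, hjp, by ext <;> simp [h₁, h₀]⟩
  have hip' : i.toHom ≫ p.toHom = 𝟙 X := by rw [toHom_comp, h.ip, toHom_id]
  have hjq' : j.toHom ≫ q.toHom = 𝟙 X := by rw [toHom_comp, h.jq, toHom_id]
  simp only [StrictHom.ext_iff, comp_f₁, comp_f₀, id_f₁, id_f₀, zero_f₁, zero_f₀] at hip hjq hiq hjp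
  let c : StrictHom Z Y := (p.comp f).add (q.comp g)
  have hic : i.toHom ≫ c.toHom = f.toHom := by
    rw [toHom_comp]; congr 1
    ext <;> simp [c, reassoc_of% hip.1, reassoc_of% hip.2, reassoc_of% hiq.1, reassoc_of% hiq.2]
  have hjc : j.toHom ≫ c.toHom = g.toHom := by
    rw [toHom_comp]; congr 1
    ext <;> simp [c, reassoc_of% hjp.1, reassoc_of% hjp.2, reassoc_of% hjq.1, reassoc_of% hjq.2]
  have hijp : (i.add j).toHom ≫ p.toHom = 𝟙 X := by
    rw [toHom_comp, ← toHom_id]; congr 1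
    ext <;> simp [hip, hjp]
  have hijq : (i.add j).toHom ≫ q.toHom = 𝟙 X := by
    rw [toHom_comp, ← toHom_id]; congr 1
    ext <;> simp [hiq, hjq]
  have hij : (i.add j).toHom = i.toHom + j.toHom := by
    rw [← Category.comp_id (i.add j).toHom, ← h.toHom_total, Preadditive.comp_add,
      reassoc_of% hijp, reassoc_of% hijq]
  have : f.add g = (i.add j).comp c := by
    ext <;> simp [c, reassoc_of% hip.1, reassoc_of% hip.2, reassoc_of% hiq.1, reassoc_of% hiq.2,
      reassoc_of% hjp.1, reassoc_of% hjp.2, reassoc_of% hjq.1, reassoc_of% hjq.2]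
  rw [this, ← toHom_comp, hij, Preadditive.add_comp, hic, hjc]

lemma toHom_neg (f : StrictHom X Y) : f.neg.toHom = -f.toHom := by
  rw [eq_neg_iff_add_eq_zero, ← toHom_add, ← toHom_zero]
  congr 1
  ext <;> simp

end StrictHom

namespace Butterfly

variable {X Y Z W X' Y' : Tilt t}

/-- The pullback of a butterfly along a strict morphism to its source. -/
def pull (s : StrictHom X X') (P : Butterfly X' Y) : Butterfly X Y where
  E := pullback P.σ s.f₀
  κ := pullback.lift (s.f₁ ≫ P.κ) X.d (by simp)
  ι := pullback.lift P.ι 0 (by simp)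
  σ := pullback.snd _ _
  ρ := pullback.fst _ _ ≫ P.ρ
  κσ := by simp
  ιρ := by simp
  κρ := by simp
  ισ := by simp
  shortExact := ShortComplex.ShortExact.mk' (by
      rw [ShortComplex.exact_iff_exact_up_to_refinements]
      intro T x (hx : x ≫ pullback.snd P.σ s.f₀ = 0)
      have h : (x ≫ pullback.fst P.σ s.f₀) ≫ P.σ = 0 := by
        rw [Category.assoc, pullback.condition, reassoc_of% hx, zero_comp]
      exact ⟨T, 𝟙 _, inferInstance, P.shortExact.fIsKernel.lift (KernelFork.ofι _ h), by
        apply pullback.hom_ext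
        · simpa using (P.shortExact.fIsKernel.fac (KernelFork.ofι _ h)
            WalkingParallelPair.zero).symm
        · simpa using hx⟩)
    (mono_of_mono_fac (pullback.lift_fst P.ι 0 (by simp))) (by dsimp; infer_instance)

/-- The projection from the middle object of a pullback. -/
def pullFst (s : StrictHom X X') (P : Butterfly X' Y) : (P.pull s).E ⟶ P.E := pullback.fst _ _

/-- The universal property of the middle object of a pullback. -/
def pullLift (s : StrictHom X X') (P : Butterfly X' Y) {T : A} (a : T ⟶ P.E) (b : T ⟶ X.X₀)
    (h : a ≫ P.σ = b ≫ s.f₀) : T ⟶ (P.pull s).E := pullback.lift a b h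

section

variable (s : StrictHom X X') (P : Butterfly X' Y)

@[simp]
lemma pullLift_fst {T : A} (a : T ⟶ P.E) (b : T ⟶ X.X₀) (h : a ≫ P.σ = b ≫ s.f₀) :
    P.pullLift s a b h ≫ P.pullFst s = a := pullback.lift_fst _ _ _

@[simp]
lemma pullLift_σ {T : A} (a : T ⟶ P.E) (b : T ⟶ X.X₀) (h : a ≫ P.σ = b ≫ s.f₀) :
    P.pullLift s a b h ≫ (P.pull s).σ = b := pullback.lift_snd _ _ _

@[simp]
lemma pullLift_fst_assoc {T Z : A} (a : T ⟶ P.E) (b : T ⟶ X.X₀) (h : a ≫ P.σ = b ≫ s.f₀)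
    (g : P.E ⟶ Z) : P.pullLift s a b h ≫ P.pullFst s ≫ g = a ≫ g := by
  rw [← Category.assoc, pullLift_fst]

@[simp]
lemma pullLift_σ_assoc {T Z : A} (a : T ⟶ P.E) (b : T ⟶ X.X₀) (h : a ≫ P.σ = b ≫ s.f₀)
    (g : X.X₀ ⟶ Z) : P.pullLift s a b h ≫ (P.pull s).σ ≫ g = b ≫ g := by
  rw [← Category.assoc, pullLift_σ]

lemma pull_hom_ext {T : A} {a b : T ⟶ (P.pull s).E}
    (h : a ≫ P.pullFst s = b ≫ P.pullFst s) (h' : a ≫ (P.pull s).σ = b ≫ (P.pull s).σ) : a = b :=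
  pullback.hom_ext h h'

lemma isMapOver_pullFst : IsMapOver (P.pull s) P s (StrictHom.id Y) (P.pullFst s) where
  κ := pullback.lift_fst _ _ _
  ι := (pullback.lift_fst _ _ _).trans (by simp)
  σ := pullback.condition
  ρ := (Category.comp_id _).symm

lemma toHom_pull : (P.pull s).toHom = s.toHom ≫ P.toHom :=
  ((StrictHom.toHom_comp_eq_iff s P _).2 ⟨_, P.isMapOver_pullFst s⟩).symm

end

/-- The sum of a butterfly and a strict morphism. -/
def addStrict (P : Butterfly X Y) (s : StrictHom X Y) : Butterfly X Y where
  E := P.E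
  κ := P.κ - s.f₁ ≫ P.ι
  ι := P.ι
  σ := P.σ
  ρ := P.ρ + P.σ ≫ s.f₀
  κσ := by simp
  ιρ := by simp
  κρ := by simp
  ισ := by simp
  shortExact := P.shortExact

/-- Precomposition with an isomorphism `u` that makes `P` strict reduces this to the addition of
strict morphisms. The same map `ψ` of middle objects serves before and after adding `s`, since only
`κ` and `ρ` change. -/
lemma toHom_addStrict (P : Butterfly X Y) (s : StrictHom X Y) :
    (P.addStrict s).toHom = P.toHom + s.toHom := by
  obtain ⟨X', u, g, hu, hg⟩ := exists_strict_source P.toHom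
  obtain ⟨ψ, hψ⟩ := (StrictHom.toHom_comp_eq_iff u P g.toButterfly).1 hg
  rw [← cancel_epi u.toHom, Preadditive.comp_add, hg, StrictHom.toHom_comp,
    ← StrictHom.toHom_add]
  have hκ := hψ.κ
  have hι := hψ.ι
  have hσ := hψ.σ
  have hρ := hψ.ρ
  simp only [StrictHom.id_f₁, Category.id_comp, StrictHom.id_f₀, Category.comp_id] at hι hρ
  refine (StrictHom.toHom_comp_eq_iff u (P.addStrict s) (g.add (u.comp s)).toButterfly).2
    ⟨ψ, ?_, ?_, ?_, ?_⟩
  · rw [StrictHom.κ_eq] at hκ ⊢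
    change (X'.d ≫ g.inl - (g.f₁ + u.f₁ ≫ s.f₁) ≫ g.toButterfly.ι) ≫ ψ =
      u.f₁ ≫ (P.κ - s.f₁ ≫ P.ι)
    rw [Preadditive.sub_comp] at hκ ⊢
    rw [Preadditive.add_comp, Preadditive.add_comp, ← sub_sub, hκ]
    simp [hι]
  · change g.toButterfly.ι ≫ ψ = _
    exact hι.trans (Category.id_comp _).symm
  · exact hσ
  · rw [StrictHom.ρ_eq] at hρ ⊢
    change ψ ≫ (P.ρ + P.σ ≫ s.f₀) = (g.toButterfly.σ ≫ (g.f₀ + u.f₀ ≫ s.f₀) + g.snd ≫ Y.d) ≫ 𝟙 _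
    rw [Preadditive.comp_add, hρ, reassoc_of% hσ]
    simp only [Preadditive.comp_add, Category.comp_id]
    abel

/-- A map of the middle objects over strict morphisms gives a commutative square. -/
lemma IsMapOver.comm {P : Butterfly X Y} {P' : Butterfly X' Y'} {f : StrictHom X X'}
    {g : StrictHom Y Y'} {φ : P.E ⟶ P'.E} (h : IsMapOver P P' f g φ) :
    f.toHom ≫ P'.toHom = P.toHom ≫ g.toHom := by
  have hp := P'.isMapOver_pullFst f
  rw [← toHom_pull, eq_comm, StrictHom.comp_toHom_eq_iff]
  refine ⟨P'.pullLift f φ P.σ h.σ, ?_, ?_, ?_, ?_⟩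
  · apply pull_hom_ext <;> simp [h.κ, hp.κ]
  · apply pull_hom_ext <;> simp [h.ι, hp.ι]
  · simp
  · have := hp.ρ
    simp only [StrictHom.id_f₀, Category.comp_id] at this
    rw [← this, pullLift_fst_assoc, h.ρ]

/-- A criterion for a strict morphism to be a null-homotopic combination of two butterflies. -/
lemma toHom_eq_of_homotopy {P : Butterfly X Y} {P' : Butterfly X' Y'} (s : StrictHom X X')
    (u : StrictHom Y Y') (f : StrictHom X Y') (S : P.E ⟶ P'.E)
    (hκ : P.κ ≫ S = s.f₁ ≫ P'.κ + f.f₁ ≫ P'.ι) (hι : P.ι ≫ S = -u.f₁ ≫ P'.ι)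
    (hσ : S ≫ P'.σ = P.σ ≫ s.f₀) (hρ : S ≫ P'.ρ = P.σ ≫ f.f₀ - P.ρ ≫ u.f₀) :
    f.toHom = s.toHom ≫ P'.toHom + P.toHom ≫ u.toHom := by
  have hp := P'.isMapOver_pullFst s
  -- The relation is rearranged as `P ≫ (-u) = s ≫ P' - f`. The right side has the middle object
  -- `P'.E ×_{X'⁰} X⁰`, to which `S` and `P.σ` together define a map.
  have h1 : P.toHom ≫ u.neg.toHom = ((P'.pull s).addStrict f.neg).toHom := by
    rw [StrictHom.comp_toHom_eq_iff]
    refine ⟨P'.pullLift s S P.σ hσ, ?_, ?_, ?_, ?_⟩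
    · change _ ≫ P'.pullLift s S P.σ hσ = 𝟙 _ ≫ ((P'.pull s).κ - (-f.f₁) ≫ (P'.pull s).ι)
      apply pull_hom_ext <;> simp [hκ, hp.κ, hp.ι]
    · change _ ≫ P'.pullLift s S P.σ hσ = (-u.f₁) ≫ (P'.pull s).ι
      apply pull_hom_ext <;> simp [hι, hp.ι]
    · change P'.pullLift s S P.σ hσ ≫ (P'.pull s).σ = P.σ ≫ 𝟙 _
      simp
    · change P'.pullLift s S P.σ hσ ≫ ((P'.pull s).ρ + (P'.pull s).σ ≫ (-f.f₀)) = P.ρ ≫ (-u.f₀)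
      have := hp.ρ
      simp only [StrictHom.id_f₀, Category.comp_id] at this
      rw [← this]
      simp [hρ, sub_eq_add_neg]
  rw [toHom_addStrict, toHom_pull, StrictHom.toHom_neg, StrictHom.toHom_neg,
    Preadditive.comp_neg] at h1
  have := congr_arg (fun x => x + f.toHom + P.toHom ≫ u.toHom) h1
  simpa using this

/-- Two butterflies joined by a link compose to zero. -/
lemma IsLink.toHom_comp_eq_zero {P : Butterfly X Y} {Q : Butterfly Y Z} {δ : P.E ⟶ Q.E}
    (h : IsLink P Q δ) : P.toHom ≫ Q.toHom = 0 := by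
  rw [toHom_comp, zero_eq, StrictHom.toHom, toHom_eq_iff]
  have h0 : (pullback.snd P.ρ Q.σ - pullback.fst P.ρ Q.σ ≫ δ) ≫ Q.σ = 0 := by
    rw [Preadditive.sub_comp, Category.assoc, h.σ, pullback.condition, sub_self]
  -- The link splits the composed butterfly: the defect between the second projection and the link
  -- applied to the first one lies in `Z⁻¹`, and `r` is the second component of an isomorphism onto
  -- the zero butterfly.
  obtain ⟨r, hr⟩ : ∃ r : pullback P.ρ Q.σ ⟶ Z.X₁, r ≫ Q.ι =
      pullback.snd P.ρ Q.σ - pullback.fst P.ρ Q.σ ≫ δ :=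
    ⟨_, Q.shortExact.fIsKernel.fac (KernelFork.ofι _ h0) WalkingParallelPair.zero⟩
  have e : ∀ {T : A} (a : T ⟶ pullback P.ρ Q.σ) (b : T ⟶ Z.X₁), b ≫ Q.ι =
      a ≫ (pullback.snd _ _ - pullback.fst _ _ ≫ δ) → a ≫ r = b := fun a b hab => by
    rw [← cancel_mono Q.ι, Category.assoc, hr, hab]
  have hs : (StrictHom.zero X Z).toButterfly.ρ = (StrictHom.zero X Z).snd ≫ Z.d := by
    simp [StrictHom.ρ_eq]
  refine IsComp.equiv (f := pullback.fst P.ρ Q.σ ≫ P.σ ≫ (StrictHom.zero X Z).inl +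
    r ≫ (StrictHom.zero X Z).toButterfly.ι) ⟨?_, ?_, ?_, ?_, ?_⟩
  · have := e (pullback.lift P.κ 0 (by simp)) 0
      (by simp [h.κ])
    simp [reassoc_of% this, StrictHom.κ_eq]
  · have := e (pullback.lift 0 Q.ι (by simp)) (𝟙 _)
      (by simp)
    simp [reassoc_of% this]
  · have := e (pullback.lift P.ι Q.κ (by simp)) 0
      (by simp [h.ι])
    simp [reassoc_of% this]
  · simp
  · have := hr =≫ Q.ρ
    simp only [Category.assoc, ιρ, Preadditive.sub_comp, h.ρ, comp_zero, sub_zero] at this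
    rw [hs]
    simp [this]

end Butterfly

end HRS

end

/-! ### Exactness of linked butterflies in the tilted category and in `A` -/

noncomputable section

namespace HRS

universe w w' v u

variable {A : Type u} [Category.{v} A] [Abelian A] {t : TorsionPair A}

namespace Butterfly

variable {X Y Z W V : Tilt t}

lemma exists_lift_ι (P : Butterfly X Y) {T : A} (x : T ⟶ P.E) (hx : x ≫ P.σ = 0) :
    ∃ b : T ⟶ Y.X₁, b ≫ P.ι = x :=
  ⟨_, P.shortExact.fIsKernel.fac (KernelFork.ofι _ hx) WalkingParallelPair.zero⟩

lemma exists_desc_σ (P : Butterfly X Y) {T : A} (x : P.E ⟶ T) (hx : P.ι ≫ x = 0) :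
    ∃ b : X.X₀ ⟶ T, P.σ ≫ b = x :=
  ⟨_, P.shortExact.gIsCokernel.fac (CokernelCofork.ofπ _ hx) WalkingParallelPair.one⟩

/-- A strict morphism is annihilated by a butterfly if and only if it lifts to the middle
object. -/
lemma exists_of_strict_comp_eq_zero (f : StrictHom W X) (P : Butterfly X Y) :
    f.toHom ≫ P.toHom = 0 ↔
      ∃ h : W.X₀ ⟶ P.E, W.d ≫ h = f.f₁ ≫ P.κ ∧ h ≫ P.σ = f.f₀ ∧ h ≫ P.ρ = 0 := by
  rw [zero_eq]
  refine (StrictHom.toHom_comp_eq_iff f P (StrictHom.zero W Y).toButterfly).trans ⟨?_, ?_⟩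
  · rintro ⟨ψ, hψ⟩
    refine ⟨(StrictHom.zero W Y).inl ≫ ψ, ?_, ?_, ?_⟩
    · rw [← hψ.κ, StrictHom.κ_eq]; simp
    · simp [hψ.σ]
    · simp [hψ.ρ]
  · rintro ⟨h, h₁, h₂, h₃⟩
    refine ⟨(StrictHom.zero W Y).toButterfly.σ ≫ h + (StrictHom.zero W Y).snd ≫ P.ι,
      ?_, ?_, ?_, ?_⟩
    · simp [h₁]
    · simp
    · simp [h₂]
    · rw [StrictHom.ρ_eq]; simp [h₃]

/-- A butterfly is annihilated by a strict morphism if and only if the latter extends to the middle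
object. -/
lemma exists_of_comp_strict_eq_zero (P : Butterfly X Y) (g : StrictHom Y V) :
    P.toHom ≫ g.toHom = 0 ↔
      ∃ l : P.E ⟶ V.X₁, P.ι ≫ l = g.f₁ ∧ P.κ ≫ l = 0 ∧ l ≫ V.d = P.ρ ≫ g.f₀ := by
  rw [zero_eq]
  refine (StrictHom.comp_toHom_eq_iff P g (StrictHom.zero X V).toButterfly).trans ⟨?_, ?_⟩
  · rintro ⟨ψ, hψ⟩
    refine ⟨ψ ≫ (StrictHom.zero X V).snd, ?_, ?_, ?_⟩
    · simp [reassoc_of% hψ.ι]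
    · simp [reassoc_of% hψ.κ]
    · rw [← hψ.ρ, StrictHom.ρ_eq]; simp
  · rintro ⟨l, h₁, h₂, h₃⟩
    refine ⟨P.σ ≫ (StrictHom.zero X V).inl + l ≫ (StrictHom.zero X V).toButterfly.ι,
      ?_, ?_, ?_, ?_⟩
    · rw [StrictHom.κ_eq]; simp [reassoc_of% h₂]
    · simp [reassoc_of% h₁]
    · simp
    · simp [h₃]

/-- A short exact sequence `K⁰ ⟶ E ⟶ C⁻¹` that describes the kernel and the cokernel of a butterfly
(see `exists_torsionPart`). -/
structure TorsionPart (P : Butterfly X Y) where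
  K : Tilt t
  C : Tilt t
  e₁ : K.X₁ ≅ X.X₁
  a : K.X₀ ⟶ P.E
  c : P.E ⟶ C.X₁
  e₀ : Y.X₀ ≅ C.X₀
  w : a ≫ c = 0
  shortExact : (ShortComplex.mk a c w).ShortExact
  d_a : K.d ≫ a = e₁.hom ≫ P.κ
  c_d : c ≫ C.d = P.ρ ≫ e₀.hom

lemma nonempty_torsionPart (P : Butterfly X Y) : Nonempty P.TorsionPart := by
  obtain ⟨K, C, e₁, a, c, e₀, w, h, h₁, h₂⟩ := P.exists_torsionPart
  exact ⟨⟨K, C, e₁, a, c, e₀, w, h, h₁, h₂⟩⟩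

namespace TorsionPart

variable {P : Butterfly X Y} (p : P.TorsionPart)

instance : Mono p.a := p.shortExact.mono_f
instance : Epi p.c := p.shortExact.epi_g

lemma a_ρ : p.a ≫ P.ρ = 0 := by
  rw [← cancel_mono p.e₀.hom, Category.assoc, ← p.c_d, reassoc_of% p.w, zero_comp, zero_comp]

lemma κ_c : P.κ ≫ p.c = 0 := by
  rw [← cancel_epi p.e₁.hom, ← reassoc_of% p.d_a, p.w, comp_zero, comp_zero]

end TorsionPart

/-- If two linked butterflies form an exact sequence in the tilted category, then the link induces
an isomorphism from the quotient of the first middle object by its torsion part to the torsion part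
of the second middle object. -/
lemma IsLink.exists_iso_of_exact {P : Butterfly X Y} {Q : Butterfly Y Z} {δ : P.E ⟶ Q.E}
    (l : IsLink P Q δ)
    (hex : (ShortComplex.mk P.toHom Q.toHom l.toHom_comp_eq_zero).Exact)
    (p : P.TorsionPart) (q : Q.TorsionPart) :
    ∃ e : p.C.X₁ ≅ q.K.X₀, p.c ≫ e.hom ≫ q.a = δ := by
  -- The strict morphisms `k` into `Y` and `c` out of `Y` play the roles of the kernel of `Q` and
  -- the cokernel of `P`. Only `k ≫ Q = 0` and `P ≫ c = 0` are needed: exactness then gives `k ≫ c =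
  -- 0`, that is, a null-homotopy `h`.
  let k : StrictHom q.K Y := ⟨q.e₁.hom, q.a ≫ Q.σ, by rw [← Category.assoc, q.d_a]; simp⟩
  let c : StrictHom Y p.C := ⟨P.ι ≫ p.c, p.e₀.hom, by rw [Category.assoc, p.c_d]; simp⟩
  have hk : k.toHom ≫ Q.toHom = 0 :=
    (exists_of_strict_comp_eq_zero k Q).2 ⟨q.a, q.d_a, rfl, q.a_ρ⟩
  have hc : P.toHom ≫ c.toHom = 0 :=
    (exists_of_comp_strict_eq_zero P c).2 ⟨p.c, rfl, p.κ_c, p.c_d⟩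
  have hkc : k.toHom ≫ c.toHom = 0 := hex.comp_eq_zero hk hc
  rw [StrictHom.toHom_comp, StrictHom.toHom_eq_zero_iff'] at hkc
  obtain ⟨h, h₁, h₀⟩ := hkc
  simp only [StrictHom.comp_f₁, StrictHom.comp_f₀, k, c, Category.assoc] at h₁ h₀
  -- The composite comes from a map `p.K.X₀ ⟶ Z.X₁` that both differentials annihilate, so
  -- orthogonality makes it zero. Dually, the map induced by `δ ≫ q.c` vanishes, and `δ` factors as
  -- `p.c ≫ δ' ≫ q.a`.
  have haδ : p.a ≫ δ = 0 := by
    obtain ⟨b, hb⟩ := Q.exists_lift_ι (p.a ≫ δ) (by rw [Category.assoc, l.σ, p.a_ρ])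
    have : b = 0 := Tilt.eq_zero b
      (by rw [← cancel_mono Q.ι, Category.assoc, hb, reassoc_of% p.d_a, l.κ, comp_zero, zero_comp])
      (by rw [← Q.ιρ, reassoc_of% hb, l.ρ, comp_zero])
    rw [← hb, this, zero_comp]
  obtain ⟨δ₁, hδ₁⟩ : ∃ δ₁, p.c ≫ δ₁ = δ :=
    ⟨_, p.shortExact.gIsCokernel.fac (CokernelCofork.ofπ _ haδ) WalkingParallelPair.one⟩
  have hδc : δ₁ ≫ q.c = 0 := by
    obtain ⟨g, hg⟩ := P.exists_desc_σ (δ ≫ q.c) (by rw [reassoc_of% l.ι, q.κ_c])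
    have : g = 0 := Tilt.eq_zero g
      (by rw [← P.κσ, Category.assoc, hg, reassoc_of% l.κ, zero_comp])
      (by rw [← cancel_epi P.σ, reassoc_of% hg, q.c_d, reassoc_of% l.ρ, zero_comp, comp_zero])
    rw [← cancel_epi p.c, reassoc_of% hδ₁, ← hg, this, comp_zero, comp_zero]
  obtain ⟨δ', hδ'⟩ : ∃ δ', δ' ≫ q.a = δ₁ :=
    ⟨_, q.shortExact.fIsKernel.fac (KernelFork.ofι _ hδc) WalkingParallelPair.zero⟩
  have hδ : p.c ≫ δ' ≫ q.a = δ := by rw [hδ', hδ₁]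
  have hδσ : δ' ≫ q.a ≫ Q.σ ≫ p.e₀.hom = p.C.d := by
    rw [← cancel_epi p.c, reassoc_of% hδ, reassoc_of% l.σ, p.c_d]
  have hιδ : P.ι ≫ p.c ≫ δ' = q.e₁.inv ≫ q.K.d := by
    rw [← cancel_mono q.a, Category.assoc, Category.assoc, hδ, l.ι, Category.assoc, q.d_a,
      Iso.inv_hom_id_assoc]
  -- The null-homotopy of `k ≫ c` is the inverse of `δ'`: the two homotopy equations say that the
  -- composites are identities after `P.ι` and before `Q.σ`, and orthogonality disposes of what
  -- remains.
  refine ⟨⟨δ', h, ?_, ?_⟩, hδ⟩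
  · obtain ⟨g, hg⟩ := P.exists_desc_σ (p.c ≫ (δ' ≫ h - 𝟙 _)) (by
      rw [Preadditive.comp_sub, Preadditive.comp_sub, reassoc_of% hιδ, ← h₁]; simp)
    have : g = 0 := Tilt.eq_zero g
      (by rw [← P.κσ, Category.assoc, hg, reassoc_of% p.κ_c, zero_comp])
      (by rw [← cancel_epi P.σ, reassoc_of% hg, Preadditive.sub_comp, Category.assoc, ← h₀, hδσ]
          simp)
    rw [← sub_eq_zero, ← cancel_epi p.c, ← hg, this, comp_zero, comp_zero]
  · obtain ⟨b, hb⟩ := Q.exists_lift_ι ((h ≫ δ' - 𝟙 _) ≫ q.a) (by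
      rw [← cancel_mono p.e₀.hom]
      simp only [Preadditive.sub_comp, Category.assoc, Category.id_comp, zero_comp]
      rw [hδσ, h₀, sub_self])
    have : b = 0 := Tilt.eq_zero b
      (by
        rw [← cancel_mono Q.ι, Category.assoc, hb, Preadditive.sub_comp, Preadditive.comp_sub,
          Category.assoc, ← reassoc_of% h₁, hδ, l.ι, Category.id_comp, q.d_a, sub_self, zero_comp])
      (by rw [← Q.ιρ, reassoc_of% hb, q.a_ρ, comp_zero])
    rw [← sub_eq_zero, ← cancel_mono q.a, ← hb, this, zero_comp, zero_comp]

/-- Exactness of the complex of middle objects, from exactness in the tilted category. -/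
lemma IsLink.exact_of_exact {P : Butterfly X Y} {Q : Butterfly Y Z} {R : Butterfly Z W}
    {δ : P.E ⟶ Q.E} {δ' : Q.E ⟶ R.E} (l : IsLink P Q δ) (l' : IsLink Q R δ')
    (h : (ShortComplex.mk P.toHom Q.toHom l.toHom_comp_eq_zero).Exact)
    (h' : (ShortComplex.mk Q.toHom R.toHom l'.toHom_comp_eq_zero).Exact) :
    (ShortComplex.mk δ δ' (l.comp l')).Exact := by
  obtain ⟨p⟩ := P.nonempty_torsionPart
  obtain ⟨q⟩ := Q.nonempty_torsionPart
  obtain ⟨r⟩ := R.nonempty_torsionPart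
  obtain ⟨e, he⟩ := l.exists_iso_of_exact h p q
  obtain ⟨e', he'⟩ := l'.exists_iso_of_exact h' q r
  rw [ShortComplex.exact_iff_exact_up_to_refinements]
  intro T x hx
  dsimp at x hx
  -- Since `δ'` is `q.c` followed by a monomorphism, its kernel is the torsion part `q.a`, which is
  -- also the image of `δ`.
  have h1 : x ≫ q.c = 0 := by
    rw [← cancel_mono e'.hom, ← cancel_mono r.a, Category.assoc, Category.assoc, he', hx,
      zero_comp, zero_comp]
  obtain ⟨y, hy⟩ : ∃ y, y ≫ q.a = x :=
    ⟨_, q.shortExact.fIsKernel.fac (KernelFork.ofι _ h1) WalkingParallelPair.zero⟩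
  obtain ⟨T', π, hπ, z, hz⟩ := surjective_up_to_refinements_of_epi p.c (y ≫ e.inv)
  refine ⟨T', π, hπ, z, ?_⟩
  dsimp
  rw [← he, ← reassoc_of% hz, Iso.inv_hom_id_assoc, hy]

/-- Exactness in the tilted category, from exactness of the complex of middle objects. -/
lemma IsLink.exact_of_exact_links {O : Butterfly V X} {P : Butterfly X Y} {Q : Butterfly Y Z}
    {R : Butterfly Z W} {δ₀ : O.E ⟶ P.E} {δ : P.E ⟶ Q.E} {δ' : Q.E ⟶ R.E}
    (l₀ : IsLink O P δ₀) (l : IsLink P Q δ) (l' : IsLink Q R δ')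
    (h : (ShortComplex.mk δ₀ δ (l₀.comp l)).Exact)
    (h' : (ShortComplex.mk δ δ' (l.comp l')).Exact) :
    (ShortComplex.mk P.toHom Q.toHom l.toHom_comp_eq_zero).Exact := by
  rw [ShortComplex.exact_iff_kernel_ι_comp_cokernel_π_zero]
  dsimp
  obtain ⟨S, s, f, hs, hf⟩ := exists_strict_source (kernel.ι Q.toHom)
  obtain ⟨U, u, g, hu, hg⟩ := exists_strict_target (cokernel.π P.toHom)
  have hf0 : f.toHom ≫ Q.toHom = 0 := by rw [← hf, Category.assoc, kernel.condition, comp_zero]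
  have hg0 : P.toHom ≫ g.toHom = 0 := by rw [← hg, cokernel.condition_assoc, zero_comp]
  rw [← cancel_epi s.toHom, ← cancel_mono u.toHom, comp_zero, zero_comp, ← Category.assoc, hf,
    Category.assoc, hg, StrictHom.toHom_comp, StrictHom.toHom_eq_zero_iff']
  -- With strict representatives `f` of the kernel of `Q` and `g` of the cokernel of `P`, the
  -- vanishing composites give `a` into `Q.E` and `b` out of `P.E`. Orthogonality gives `a ≫ δ' = 0`
  -- and `δ₀ ≫ b = 0`.
  obtain ⟨a, ha₁, ha₂, ha₃⟩ := (exists_of_strict_comp_eq_zero f Q).1 hf0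
  obtain ⟨b, hb₁, hb₂, hb₃⟩ := (exists_of_comp_strict_eq_zero P g).1 hg0
  have haδ : a ≫ δ' = 0 := by
    obtain ⟨c, hc⟩ := R.exists_lift_ι (a ≫ δ') (by rw [Category.assoc, l'.σ, ha₃])
    have : c = 0 := Tilt.eq_zero c
      (by rw [← cancel_mono R.ι, Category.assoc, hc, reassoc_of% ha₁, l'.κ, comp_zero, zero_comp])
      (by rw [← R.ιρ, reassoc_of% hc, l'.ρ, comp_zero])
    rw [← hc, this, zero_comp]
  have hbδ : δ₀ ≫ b = 0 := by
    obtain ⟨c, hc⟩ := O.exists_desc_σ (δ₀ ≫ b) (by rw [reassoc_of% l₀.ι, hb₂])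
    have : c = 0 := Tilt.eq_zero c
      (by rw [← O.κσ, Category.assoc, hc, reassoc_of% l₀.κ, zero_comp])
      (by rw [← cancel_epi O.σ, reassoc_of% hc, hb₃, reassoc_of% l₀.ρ, zero_comp, comp_zero])
    rw [← hc, this, comp_zero]
  let e : P.E ⟶ kernel δ' := kernel.lift δ' δ (l.comp l')
  have heι : e ≫ kernel.ι δ' = δ := kernel.lift_ι _ _ _
  have he : Epi e := (ShortComplex.exact_iff_epi_kernel_lift _).1 h'
  have hk : kernel.ι e ≫ b = 0 :=
    h.comp_eq_zero (show kernel.ι e ≫ δ = 0 by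
      rw [← heι, kernel.condition_assoc, zero_comp]) hbδ
  have hb' : e ≫ Abelian.epiDesc e b hk = b := Abelian.comp_epiDesc e b hk
  have hb'' : Abelian.epiDesc e b hk ≫ U.d = kernel.ι δ' ≫ Q.σ ≫ g.f₀ := by
    rw [← cancel_epi e, reassoc_of% hb', hb₃, reassoc_of% heι, reassoc_of% l.σ]
  -- By exactness at `Q.E` the map `e` to the kernel of `δ'` is epi, and by exactness at `P.E` the
  -- map `b` descends along it. Passing through this kernel gives the required null-homotopy of `f ≫
  -- g`.
  refine ⟨kernel.lift δ' a haδ ≫ Abelian.epiDesc e b hk, ?_, ?_⟩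
  · have : S.d ≫ kernel.lift δ' a haδ = f.f₁ ≫ P.ι ≫ e := by
      rw [← cancel_mono (kernel.ι δ')]
      simp [heι, ha₁, l.ι]
    rw [reassoc_of% this, hb', hb₁, StrictHom.comp_f₁]
  · rw [Category.assoc, hb'', kernel.lift_ι_assoc, reassoc_of% ha₂, StrictHom.comp_f₀]

end Butterfly

end HRS

end

/-! ### Decorated complexes as models of complexes in the tilted category -/

noncomputable section

namespace HRS

universe w w' v u

variable {A : Type u} [Category.{v} A] [Abelian A] {t : TorsionPair A}

/-- A complex `E` in `A` with a decoration: each object is an extension of `(X i)⁰` by `(X j)⁻¹`, so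
that the differentials of `E` induce the differentials of the two-term complexes `X n`. -/
structure Decoration (X : ℤ → Tilt t) (E : CochainComplex A ℤ) where
  ι (n : ℤ) : (X n).X₁ ⟶ E.X n
  σ (i j : ℤ) (h : i + 1 = j) : E.X j ⟶ (X i).X₀
  ισ (i j : ℤ) (h : i + 1 = j) : ι j ≫ σ i j h = 0
  shortExact (i j : ℤ) (h : i + 1 = j) : (ShortComplex.mk (ι j) (σ i j h) (ισ i j h)).ShortExact
  ιdσ (i j : ℤ) (h : i + 1 = j) : ι i ≫ E.d i j ≫ σ i j h = (X i).d

namespace Decoration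

variable {X : ℤ → Tilt t} {E : CochainComplex A ℤ} (D : Decoration X E)

/-- The butterfly of a decoration. -/
abbrev butterfly (i j k : ℤ) (h : i + 1 = j) (h' : j + 1 = k) : Butterfly (X i) (X j) where
  E := E.X j
  κ := D.ι i ≫ E.d i j
  ι := D.ι j
  σ := D.σ i j h
  ρ := E.d j k ≫ D.σ j k h'
  κσ := by rw [Category.assoc, D.ιdσ]
  ιρ := D.ιdσ j k h'
  κρ := by simp
  ισ := D.ισ i j h
  shortExact := D.shortExact i j h

lemma isLink (i j k l : ℤ) (hij : i + 1 = j) (hjk : j + 1 = k) (hkl : k + 1 = l) :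
    Butterfly.IsLink (D.butterfly i j k hij hjk) (D.butterfly j k l hjk hkl) (E.d j k) where
  κ := by
    change (D.ι i ≫ E.d i j) ≫ E.d j k = 0
    simp
  ι := rfl
  σ := rfl
  ρ := by
    change E.d j k ≫ E.d k l ≫ D.σ k l hkl = 0
    simp

/-- The complex in the tilted category that is defined by a decoration. -/
abbrev complex : CochainComplex (Tilt t) ℤ where
  X := X
  d i j := if h : i + 1 = j then (D.butterfly i j (j + 1) h rfl).toHom else 0
  shape i j h := dif_neg h
  d_comp_d' i j k (hij : i + 1 = j) (hjk : j + 1 = k) := by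
    rw [dif_pos hij, dif_pos hjk]
    subst hjk
    exact (D.isLink i j (j + 1) (j + 1 + 1) hij rfl rfl).toHom_comp_eq_zero

lemma complex_d (i j : ℤ) (h : i + 1 = j) :
    D.complex.d i j = (D.butterfly i j (j + 1) h rfl).toHom := dif_pos h

end Decoration

/-- A decorated complex in `A` whose butterflies represent the differentials of the complex `K` in
the tilted category. -/
structure Model (K : CochainComplex (Tilt t) ℤ) (E : CochainComplex A ℤ) extends
    Decoration K.X E where
  toHom_eq (i j k : ℤ) (h : i + 1 = j) (h' : j + 1 = k) :
    (toDecoration.butterfly i j k h h').toHom = K.d i j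

namespace Decoration

variable {X : ℤ → Tilt t} {E : CochainComplex A ℤ}

/-- A decorated complex is a model. -/
abbrev model (D : Decoration X E) : Model D.complex E where
  toDecoration := D
  toHom_eq i j k h h' := by
    subst h'
    exact (D.complex_d i j h).symm

end Decoration

namespace Model

variable {K L N : CochainComplex (Tilt t) ℤ} {E F G : CochainComplex A ℤ}

section

variable (m : Model K E)

lemma butterfly_toHom (i j k : ℤ) (h : i + 1 = j) (h' : j + 1 = k) :
    (m.butterfly i j k h h').toHom = K.d i j := m.toHom_eq i j k h h'

instance (n : ℤ) : Mono (m.ι n) := (m.shortExact (n - 1) n (by lia)).mono_f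

lemma epi_σ (i j : ℤ) (h : i + 1 = j) : Epi (m.σ i j h) := (m.shortExact i j h).epi_g

/-- A map between models that vanishes on the decorations is zero. -/
lemma eq_zero (m' : Model L F) {n n' : ℤ} (ε : E.X n ⟶ F.X n')
    (i i' j j' : ℤ) (hi : i + 1 = n) (hi' : i' + 1 = n') (hj : n + 1 = j) (hj' : n' + 1 = j')
    (hκ : m.ι i ≫ E.d i n ≫ ε = 0)
    (hι : m.ι n ≫ ε = 0) (hσ : ε ≫ m'.σ i' n' hi' = 0) (hρ : ε ≫ F.d n' j' ≫ m'.σ n' j' hj' = 0) :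
    ε = 0 :=
  Butterfly.eq_zero (m.butterfly i n j hi hj) (m'.butterfly i' n' j' hi' hj') ε
    ((Category.assoc _ _ _).trans hκ) hι hσ hρ

/-- The complex of a model is exact in a degree if the complex in the tilted category is exact in
this degree and in the preceding one. -/
lemma exactAt (m : Model K E) (i j : ℤ) (hij : i + 1 = j) (hi : K.ExactAt i) (hj : K.ExactAt j) :
    E.ExactAt j := by
  rw [HomologicalComplex.exactAt_iff' _ i j (j + 1) (by simp [← hij]) (by simp)]
  rw [HomologicalComplex.exactAt_iff' _ i j (j + 1) (by simp [← hij]) (by simp)] at hj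
  rw [HomologicalComplex.exactAt_iff' _ (i - 1) i j (by simp) (by simp [← hij])] at hi
  refine (m.isLink (i - 1) i j (j + 1) (by lia) hij rfl).exact_of_exact
    (m.isLink i j (j + 1) (j + 2) hij rfl (by lia)) ?_ ?_
  · convert hi using 1
    simp only [HomologicalComplex.sc', HomologicalComplex.shortComplexFunctor', butterfly_toHom]
  · convert hj using 1
    simp only [HomologicalComplex.sc', HomologicalComplex.shortComplexFunctor', butterfly_toHom]

/-- The complex in the tilted category is exact in a degree if the complex of a model is exact in
this degree and in the next one. -/
lemma exactAt_of_model (m : Model K E) (i j : ℤ) (hij : i + 1 = j) (hi : E.ExactAt i)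
    (hj : E.ExactAt j) :
    K.ExactAt i := by
  rw [HomologicalComplex.exactAt_iff' _ (i - 1) i j (by simp) (by simp [← hij])]
  rw [HomologicalComplex.exactAt_iff' _ (i - 1) i j (by simp) (by simp [← hij])] at hi
  rw [HomologicalComplex.exactAt_iff' _ i j (j + 1) (by simp [← hij]) (by simp)] at hj
  have := (m.isLink (i - 2) (i - 1) i j (by lia) (by lia) hij).exact_of_exact_links
    (m.isLink (i - 1) i j (j + 1) (by lia) hij rfl)
    (m.isLink i j (j + 1) (j + 2) hij rfl (by lia)) hi hj
  convert this using 1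
  simp only [HomologicalComplex.sc', HomologicalComplex.shortComplexFunctor', butterfly_toHom]

/-- A single degree on one side needs two neighbouring degrees on the other; with exactness in all
degrees this discrepancy disappears. -/
lemma acyclic_iff (m : Model K E) : E.Acyclic ↔ K.Acyclic :=
  ⟨fun h i => m.exactAt_of_model i (i + 1) rfl (h _) (h _),
    fun h i => m.exactAt (i - 1) i (by lia) (h _) (h _)⟩

end

/-- A morphism of complexes that respects the decorations of two models and induces the strict
morphisms `f`. -/
structure Over (m : Model K E) (m' : Model L F) (f : ∀ n, StrictHom (K.X n) (L.X n))
    (φ : E ⟶ F) : Prop where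
  ι (n : ℤ) : m.ι n ≫ φ.f n = (f n).f₁ ≫ m'.ι n
  σ (i j : ℤ) (h : i + 1 = j) : φ.f j ≫ m'.σ i j h = m.σ i j h ≫ (f i).f₀

namespace Over

variable {m : Model K E} {m' : Model L F} {m'' : Model N G} {f : ∀ n, StrictHom (K.X n) (L.X n)}
  {g : ∀ n, StrictHom (L.X n) (N.X n)} {φ φ' : E ⟶ F} {ψ : F ⟶ G}

lemma refl (m : Model K E) : Over m m (fun _ => StrictHom.id _) (𝟙 E) := ⟨by simp, by simp⟩

lemma comp (h : Over m m' f φ) (h' : Over m' m'' g ψ) :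
    Over m m'' (fun n => (f n).comp (g n)) (φ ≫ ψ) where
  ι n := by simp [reassoc_of% h.ι, h'.ι]
  σ i j hij := by simp [h'.σ, reassoc_of% h.σ]

lemma isMapOver (h : Over m m' f φ) (i j k : ℤ) (hij : i + 1 = j) (hjk : j + 1 = k) :
    Butterfly.IsMapOver (m.butterfly i j k hij hjk) (m'.butterfly i j k hij hjk) (f i) (f j)
      (φ.f j) where
  κ := by simp [Decoration.butterfly, ← reassoc_of% h.ι]
  ι := h.ι j
  σ := h.σ i j hij
  ρ := by simp [Decoration.butterfly, h.σ]

/-- Rigidity of middle objects, degree by degree. This is the tool for every later coherence: two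
composites agree as soon as they lie over the same strict morphisms. -/
lemma unique (h : Over m m' f φ) (h' : Over m m' f φ') : φ = φ' := by
  ext n
  exact (h.isMapOver (n - 1) n (n + 1) (by lia) rfl).unique
    (h'.isMapOver (n - 1) n (n + 1) (by lia) rfl)

/-- A morphism in `A` that respects decorations therefore induces a morphism of complexes in the
tilted category. This is how morphisms are lifted from `A`. -/
lemma comm (h : Over m m' f φ) (i j : ℤ) : (f i).toHom ≫ L.d i j = K.d i j ≫ (f j).toHom := by
  by_cases hij : i + 1 = j
  · rw [← m.butterfly_toHom i j (j + 1) hij rfl, ← m'.butterfly_toHom i j (j + 1) hij rfl]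
    exact (h.isMapOver i j (j + 1) hij rfl).comm
  · rw [K.shape i j hij, L.shape i j hij, zero_comp, comp_zero]

/-- The strict morphism of complexes that is induced by a morphism of models. -/
def toHom (h : Over m m' f φ) : StrictComplex.mk K ⟶ StrictComplex.mk L := ⟨f, h.comm⟩

/-- Morphisms of models over homotopic strict morphisms are homotopic. -/
lemma nonempty_homotopy {f' : ∀ n, StrictHom (K.X n) (L.X n)} (h : Over m m' f φ)
    (h' : Over m m' f' φ') (hf : ∀ n, (f n).toHom = (f' n).toHom) :
    Nonempty (Homotopy φ φ') := by
  simp only [StrictHom.toHom_eq_iff] at hf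
  choose s hs₁ hs₀ using hf
  -- The homotopy goes through the decorations: `E (j+1) ⟶ (K j)⁰`, then the homotopy `s j` of
  -- strict morphisms to `(L j)⁻¹`, then `F j`.
  let S : ∀ i j, E.X i ⟶ F.X j := fun i j =>
    if hij : j + 1 = i then m.σ j i hij ≫ s j ≫ m'.ι j else 0
  have hS : ∀ i j (hij : j + 1 = i), S i j = m.σ j i hij ≫ s j ≫ m'.ι j := fun i j hij =>
    dif_pos hij
  refine ⟨⟨S, fun i j hij => dif_neg hij, fun n => ?_⟩⟩
  obtain ⟨k, hk⟩ : ∃ k, n + 1 = k := ⟨_, rfl⟩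
  obtain ⟨l, hl⟩ : ∃ l, l + 1 = n := ⟨n - 1, by lia⟩
  rw [dNext_eq S (show (ComplexShape.up ℤ).Rel n k from hk),
    prevD_eq S (show (ComplexShape.up ℤ).Rel l n from hl), hS _ _ hk, hS _ _ hl, ← sub_eq_zero]
  have aι := m.ιdσ n k hk
  have aι' := m.ιdσ l n hl
  have bι := m'.ιdσ n k hk
  have bι' := m'.ιdσ l n hl
  have cι := m'.ισ l n hl
  have cι' := m.ισ l n hl
  -- By rigidity the homotopy relation only has to be checked after `κ` and `ι` and before `σ` and
  -- `ρ`, where it reduces to the equations for `s`.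
  refine m.eq_zero m' _ l l k k hl hl hk hk ?_ ?_ ?_ ?_
  · simp only [Preadditive.comp_sub, Preadditive.comp_add,
      HomologicalComplex.d_comp_d_assoc, zero_comp, zero_add, Category.assoc,
      ← HomologicalComplex.Hom.comm, reassoc_of% h.ι, reassoc_of% h'.ι, hs₁, reassoc_of% aι',
      Preadditive.add_comp]
    abel
  · simp only [Preadditive.comp_sub, Preadditive.comp_add, h.ι, h'.ι, hs₁,
      reassoc_of% aι, reassoc_of% cι', zero_comp, Preadditive.add_comp, Category.assoc]
    abel
  · simp only [Preadditive.sub_comp, Preadditive.add_comp, Category.assoc, h.σ, h'.σ, hs₀, cι,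
      bι', comp_zero, Preadditive.comp_add]
    abel
  · simp only [Preadditive.sub_comp, Preadditive.add_comp, Category.assoc,
      HomologicalComplex.Hom.comm_assoc, h.σ, h'.σ, hs₀, bι,
      HomologicalComplex.d_comp_d_assoc, zero_comp, comp_zero, Preadditive.comp_add]
    abel

end Over

/-- The components exist because the squares commute in the tilted category. They commute with the
differentials because the difference vanishes on the decorations. -/
lemma exists_over (m : Model K E) (m' : Model L F) (f : ∀ n, StrictHom (K.X n) (L.X n))
    (hf : ∀ i j, (f i).toHom ≫ L.d i j = K.d i j ≫ (f j).toHom) : ∃ φ, Over m m' f φ := by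
  have h : ∀ i j k (hij : i + 1 = j) (hjk : j + 1 = k), ∃ φ : E.X j ⟶ F.X j,
      Butterfly.IsMapOver (m.butterfly i j k hij hjk) (m'.butterfly i j k hij hjk) (f i) (f j) φ :=
    fun i j k hij hjk => Butterfly.exists_isMapOver (m.butterfly i j k hij hjk)
      (m'.butterfly i j k hij hjk) (f i) (f j) (by rw [butterfly_toHom, butterfly_toHom, hf])
  choose φ hφ using fun j : ℤ => h (j - 1) j (j + 1) (by lia) rfl
  have hι (n : ℤ) : m.ι n ≫ φ n = (f n).f₁ ≫ m'.ι n := (hφ n).ι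
  have hσ (i j : ℤ) (hij : i + 1 = j) : φ j ≫ m'.σ i j hij = m.σ i j hij ≫ (f i).f₀ := by
    obtain rfl : i = j - 1 := by lia
    exact (hφ j).σ
  have hκ (i j : ℤ) (hij : i + 1 = j) :
      m.ι i ≫ E.d i j ≫ φ j = (f i).f₁ ≫ m'.ι i ≫ F.d i j := by
    obtain rfl : i = j - 1 := by lia
    exact (Category.assoc _ _ _).symm.trans (hφ j).κ
  have hρ (j k : ℤ) (hjk : j + 1 = k) :
      φ j ≫ F.d j k ≫ m'.σ j k hjk = E.d j k ≫ m.σ j k hjk ≫ (f j).f₀ := by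
    subst hjk
    exact (hφ j).ρ.trans (Category.assoc _ _ _)
  refine ⟨⟨φ, fun i j (hij : i + 1 = j) => ?_⟩, hι, hσ⟩
  rw [← sub_eq_zero]
  refine m.eq_zero m' _ (i - 1) i j (j + 1) (by lia) hij hij rfl ?_ ?_ ?_ ?_
  · rw [Preadditive.comp_sub, Preadditive.comp_sub, reassoc_of% hκ (i - 1) i (by lia)]; simp
  · rw [Preadditive.comp_sub, reassoc_of% hι, hκ i j hij, sub_self]
  · rw [Preadditive.sub_comp, Category.assoc, hρ, Category.assoc, hσ, sub_self]
  · rw [Preadditive.sub_comp, Category.assoc, Category.assoc, hρ]; simp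

end Model

namespace StrictComplex

/-- The projection of the total complex to `X i ⁰`. -/
def totσ (X : StrictComplex t) (i j : ℤ) (h : i + 1 = j) : X.totE.X j ⟶ (X.K.X i).X₀ :=
  -- The total complex uses the index `j - 1`, whereas decorations allow any `i` with `i + 1 = j`;
  -- the transport is the identity when `i` is literally `j - 1`.
  (X.butterfly (j - 1) j).σ ≫ eqToHom (by rw [← h, add_sub_cancel_right])

lemma totσ_eq (X : StrictComplex t) (j : ℤ) (h : j - 1 + 1 = j) :
    X.totσ (j - 1) j h = (X.butterfly (j - 1) j).σ :=
  Category.comp_id (X.butterfly (j - 1) j).σ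

/-- The total complex is a model. -/
def totModel (X : StrictComplex t) : Model X.K X.totE where
  ι n := X.totι n
  σ i j h := X.totσ i j h
  ισ i j h := by
    obtain rfl : i = j - 1 := by lia
    rw [totσ_eq]
    exact (X.butterfly (j - 1) j).ισ
  shortExact i j h := by
    obtain rfl : i = j - 1 := by lia
    simp only [totσ_eq]
    exact (X.butterfly (j - 1) j).shortExact
  ιdσ i j h := by
    obtain rfl : i = j - 1 := by lia
    rw [totσ_eq]
    refine (X.butterfly (j - 1) j).κσ.symm.trans ?_ |>.symm
    rw [← (X.isLink_totD j).ι, Category.assoc]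
    rfl
  toHom_eq i j k h h' := by
    obtain rfl : j = k - 1 := by lia
    obtain rfl : i = k - 1 - 1 := by lia
    refine Eq.trans ?_ (Butterfly.rep_toHom (X.K.d (k - 1 - 1) (k - 1)))
    refine (Butterfly.toHom_eq_iff _ _).2 (Butterfly.IsMap.equiv
      (f := 𝟙 (X.butterfly (k - 1 - 1) (k - 1)).E) ⟨?_, Category.comp_id _, ?_, ?_⟩)
    · exact (Category.comp_id _).trans (X.isLink_totD (k - 1)).ι
    · exact (Category.id_comp _).trans (X.totσ_eq (k - 1) h).symm
    · refine (Category.id_comp _).trans ((X.isLink_totD k).σ.symm.trans ?_)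
      exact congr_arg (fun x => X.totE.d (k - 1) k ≫ x) (X.totσ_eq k h').symm

lemma over_totEMap {X Y : StrictComplex t} (F : X ⟶ Y) :
    Model.Over X.totModel Y.totModel F.f (totEMap F) where
  ι n := totι_map F n
  σ i j h := by
    obtain rfl : i = j - 1 := by lia
    change _ ≫ Y.totσ _ _ h = X.totσ _ _ h ≫ _
    rw [totσ_eq, totσ_eq]
    exact (isMapOver_totMap F (j - 1) j).σ

end StrictComplex

end HRS

end

/-! ### Signs and shifts of models -/

noncomputable section

namespace HRS

universe w w' v u

variable {A : Type u} [Category.{v} A] [Abelian A] {t : TorsionPair A}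

lemma shortExact_units_smul_f {X₁ X₂ X₃ : A} {f : X₁ ⟶ X₂} {g : X₂ ⟶ X₃} {w : f ≫ g = 0}
    (h : (ShortComplex.mk f g w).ShortExact) (ε : ℤˣ) (w' : (ε • f) ≫ g = 0) :
    (ShortComplex.mk (ε • f) g w').ShortExact := by
  refine ShortComplex.shortExact_of_iso (ShortComplex.isoMk
    (S₁ := ShortComplex.mk f g w) (S₂ := ShortComplex.mk (ε • f) g w')
    ⟨ε • 𝟙 X₁, ε • 𝟙 X₁, by simp [smul_smul], by simp [smul_smul]⟩ (Iso.refl _)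
    (Iso.refl _) ?_ ?_) h
  · simp [smul_smul]
  · simp

namespace Butterfly

variable {X Y : Tilt t}

/-- The butterfly that represents the multiple of a morphism by a sign. -/
def signed (ε : ℤˣ) (P : Butterfly X Y) : Butterfly X Y where
  E := P.E
  κ := P.κ
  ι := ε • P.ι
  σ := P.σ
  ρ := ε • P.ρ
  κσ := P.κσ
  ιρ := by simp [smul_smul]
  κρ := by simp
  ισ := by simp
  shortExact := shortExact_units_smul_f P.shortExact _ _

/-- For `ε = -1` the identity of the middle object exhibits the signed butterfly as the composite of
`P` with `-𝟙`. -/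
lemma toHom_signed (ε : ℤˣ) (P : Butterfly X Y) : (P.signed ε).toHom = ε • P.toHom := by
  obtain rfl | rfl := Int.units_eq_one_or ε
  · rw [one_smul, toHom_eq_iff]
    exact IsMap.equiv (f := 𝟙 P.E) ⟨Category.comp_id _,
      (Category.comp_id _).trans (one_smul _ _), Category.id_comp _,
      (Category.id_comp _).trans (one_smul _ _).symm⟩
  · have : P.toHom ≫ (StrictHom.id Y).neg.toHom = (P.signed (-1)).toHom :=
      (StrictHom.comp_toHom_eq_iff _ _ _).2 ⟨𝟙 P.E, (Category.comp_id _).trans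
        (Category.id_comp _).symm, by simp [signed], by simp [signed], by simp [signed]⟩
    rw [← this, StrictHom.toHom_neg, StrictHom.toHom_id, Preadditive.comp_neg, Category.comp_id,
      Units.neg_smul, one_smul]

end Butterfly

namespace Model

variable {K L : CochainComplex (Tilt t) ℤ} {E F : CochainComplex A ℤ}

/-- The shift of a model. -/
def shift (m : Model K E) (n : ℤ) : Model (K⟦n⟧) (E⟦n⟧) where
  -- The sign cancels the one in the differential of `E⟦n⟧`, so that `ι ≫ d ≫ σ` stays the
  -- differential of the two-term complex. The butterfly acquires the sign in `ι` and `ρ` only and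
  -- represents the signed differential of `K⟦n⟧`.
  ι p := n.negOnePow • m.ι (p + n)
  σ i j h := m.σ (i + n) (j + n) (by lia)
  ισ i j h := by
    change (n.negOnePow • m.ι (j + n)) ≫ m.σ (i + n) (j + n) (by lia) = 0
    rw [Linear.units_smul_comp, m.ισ, smul_zero]
  shortExact i j h := shortExact_units_smul_f (m.shortExact (i + n) (j + n) (by lia)) _ _
  ιdσ i j h := by
    change (n.negOnePow • m.ι (i + n)) ≫ (n.negOnePow • E.d (i + n) (j + n)) ≫
      m.σ (i + n) (j + n) (by lia) = (K.X (i + n)).d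
    rw [Linear.units_smul_comp, Linear.units_smul_comp, Linear.comp_units_smul, smul_smul, m.ιdσ,
      Int.units_mul_self, one_smul]
  toHom_eq i j k h h' := by
    have e := (m.butterfly (i + n) (j + n) (k + n) (by lia) (by lia)).toHom_signed n.negOnePow
    rw [m.butterfly_toHom] at e
    refine Eq.trans ?_ e
    refine (Butterfly.toHom_eq_iff _ _).2 (Butterfly.IsMap.equiv (f := 𝟙 (E.X (j + n)))
      ⟨?_, Category.comp_id _, Category.id_comp _, ?_⟩)
    · refine (Category.comp_id _).trans ?_
      change (n.negOnePow • m.ι (i + n)) ≫ (n.negOnePow • E.d (i + n) (j + n)) =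
        m.ι (i + n) ≫ E.d (i + n) (j + n)
      simp [smul_smul]
    · refine (Category.id_comp _).trans ?_
      change n.negOnePow • (E.d (j + n) (k + n) ≫ m.σ _ _ _) =
        (n.negOnePow • E.d (j + n) (k + n)) ≫ m.σ _ _ _
      simp

lemma Over.shift {m : Model K E} {m' : Model L F} {f : ∀ n, StrictHom (K.X n) (L.X n)} {φ : E ⟶ F}
    (h : Over m m' f φ) (n : ℤ) : Over (m.shift n) (m'.shift n) (fun p => f (p + n)) (φ⟦n⟧') where
  ι p := by
    change (n.negOnePow • m.ι (p + n)) ≫ φ.f (p + n) = (f (p + n)).f₁ ≫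
      (n.negOnePow • m'.ι (p + n))
    simp [h.ι]
  σ i j hij := h.σ (i + n) (j + n) (by lia)

end Model

end HRS

end

/-! ### Mapping cones of models and the comparison of quasi-isomorphisms -/

noncomputable section

namespace HRS

universe w w' v u

variable {A : Type u} [Category.{v} A] [Abelian A] {t : TorsionPair A}

section

open CochainComplex

variable {C : Type*} [Category* C] [Preadditive C] [HasBinaryBiproducts C]
  {K L : CochainComplex C ℤ} (φ : K ⟶ L)

/-- This formula fixes the sign of the connecting morphism, which has to match the sign in the
decoration of a shift. -/
lemma mappingCone_mor₃_f (n : ℤ) :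
    (mappingCone.triangle φ).mor₃.f n = -(mappingCone.fst φ).1.v n (n + 1) rfl := by
  apply mappingCone.ext_from φ (n + 1) n rfl
  · refine (mappingCone.inl_v_triangle_mor₃_f φ (n + 1) n (by lia)).trans ?_
    change -𝟙 (K.X (n + 1)) = (mappingCone.inl φ).v (n + 1) n (by lia) ≫
      (-(mappingCone.fst φ).1.v n (n + 1) rfl)
    rw [Preadditive.comp_neg, mappingCone.inl_v_fst_v]
  · refine (mappingCone.inr_f_triangle_mor₃_f φ n).trans ?_
    change 0 = (mappingCone.inr φ).f n ≫ (-(mappingCone.fst φ).1.v n (n + 1) rfl)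
    rw [Preadditive.comp_neg, mappingCone.inr_f_fst_v, neg_zero]

end

namespace Tilt

/-- The strict biproduct. -/
def sum (X Y : Tilt t) : Tilt t := (exists_biprod X Y).choose

variable {X Y : Tilt t}

/-- The first projection of the strict biproduct. -/
def fst (X Y : Tilt t) : StrictHom (sum X Y) X := (exists_biprod X Y).choose_spec.choose

/-- The second projection of the strict biproduct. -/
def snd (X Y : Tilt t) : StrictHom (sum X Y) Y := (exists_biprod X Y).choose_spec.choose_spec.choose

/-- The first inclusion in the strict biproduct. -/
def inl (X Y : Tilt t) : StrictHom X (sum X Y) :=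
  (exists_biprod X Y).choose_spec.choose_spec.choose_spec.choose

/-- The second inclusion in the strict biproduct. -/
def inr (X Y : Tilt t) : StrictHom Y (sum X Y) :=
  (exists_biprod X Y).choose_spec.choose_spec.choose_spec.choose_spec.choose

lemma isBiprod (X Y : Tilt t) : StrictHom.IsBiprod (fst X Y) (snd X Y) (inl X Y) (inr X Y) := by
  obtain ⟨h₁, h₂, h₃, h₄, h₅, h₆⟩ :=
    (exists_biprod X Y).choose_spec.choose_spec.choose_spec.choose_spec.choose_spec
  exact ⟨h₁, h₂, h₃, h₄, by ext; exacts [h₅, h₆]⟩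

section

variable (X Y : Tilt t)

@[simp]
lemma inl_fst₁ : (inl X Y).f₁ ≫ (fst X Y).f₁ = 𝟙 _ := congr_arg StrictHom.f₁ (isBiprod X Y).ip
@[simp]
lemma inl_fst₁_assoc {Z : A} (g : X.X₁ ⟶ Z) : (inl X Y).f₁ ≫ (fst X Y).f₁ ≫ g = g := by
  rw [← Category.assoc, inl_fst₁, Category.id_comp]
@[simp]
lemma inl_fst₀ : (inl X Y).f₀ ≫ (fst X Y).f₀ = 𝟙 _ := congr_arg StrictHom.f₀ (isBiprod X Y).ip
@[simp]
lemma inr_snd₁ : (inr X Y).f₁ ≫ (snd X Y).f₁ = 𝟙 _ := congr_arg StrictHom.f₁ (isBiprod X Y).jq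
@[simp]
lemma inr_snd₁_assoc {Z : A} (g : Y.X₁ ⟶ Z) : (inr X Y).f₁ ≫ (snd X Y).f₁ ≫ g = g := by
  rw [← Category.assoc, inr_snd₁, Category.id_comp]
@[simp]
lemma inr_snd₀ : (inr X Y).f₀ ≫ (snd X Y).f₀ = 𝟙 _ := congr_arg StrictHom.f₀ (isBiprod X Y).jq
@[simp]
lemma inl_snd₁ : (inl X Y).f₁ ≫ (snd X Y).f₁ = 0 := congr_arg StrictHom.f₁ (isBiprod X Y).iq
@[simp]
lemma inl_snd₁_assoc {Z : A} (g : Y.X₁ ⟶ Z) : (inl X Y).f₁ ≫ (snd X Y).f₁ ≫ g = 0 := by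
  rw [← Category.assoc, inl_snd₁, zero_comp]
@[simp]
lemma inl_snd₀ : (inl X Y).f₀ ≫ (snd X Y).f₀ = 0 := congr_arg StrictHom.f₀ (isBiprod X Y).iq
@[simp]
lemma inr_fst₁ : (inr X Y).f₁ ≫ (fst X Y).f₁ = 0 := congr_arg StrictHom.f₁ (isBiprod X Y).jp
@[simp]
lemma inr_fst₁_assoc {Z : A} (g : X.X₁ ⟶ Z) : (inr X Y).f₁ ≫ (fst X Y).f₁ ≫ g = 0 := by
  rw [← Category.assoc, inr_fst₁, zero_comp]
@[simp]
lemma inr_fst₀ : (inr X Y).f₀ ≫ (fst X Y).f₀ = 0 := congr_arg StrictHom.f₀ (isBiprod X Y).jp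
lemma total₁ : (fst X Y).f₁ ≫ (inl X Y).f₁ + (snd X Y).f₁ ≫ (inr X Y).f₁ = 𝟙 _ :=
  congr_arg StrictHom.f₁ (isBiprod X Y).total
lemma total₀ : (fst X Y).f₀ ≫ (inl X Y).f₀ + (snd X Y).f₀ ≫ (inr X Y).f₀ = 𝟙 _ :=
  congr_arg StrictHom.f₀ (isBiprod X Y).total

variable {X Y} in
lemma eq_zero_of_comp₁ {T : A} (x : T ⟶ (sum X Y).X₁) (h : x ≫ (fst X Y).f₁ = 0)
    (h' : x ≫ (snd X Y).f₁ = 0) : x = 0 := by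
  rw [← Category.comp_id x, ← total₁, Preadditive.comp_add, reassoc_of% h, reassoc_of% h',
    zero_comp, zero_comp, add_zero]

variable {X Y} in
lemma eq_zero_of_comp₀ {T : A} (x : (sum X Y).X₀ ⟶ T) (h : (inl X Y).f₀ ≫ x = 0)
    (h' : (inr X Y).f₀ ≫ x = 0) : x = 0 := by
  rw [← Category.id_comp x, ← total₀, Preadditive.add_comp, Category.assoc, Category.assoc, h, h',
    comp_zero, comp_zero, add_zero]

@[simp]
lemma inl_fst : (inl X Y).toHom ≫ (fst X Y).toHom = 𝟙 _ := by
  rw [StrictHom.toHom_comp, (isBiprod X Y).ip, StrictHom.toHom_id]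
@[simp]
lemma inl_fst_assoc {Z : Tilt t} (g : X ⟶ Z) : (inl X Y).toHom ≫ (fst X Y).toHom ≫ g = g := by
  rw [← Category.assoc, inl_fst, Category.id_comp]
@[simp]
lemma inr_snd : (inr X Y).toHom ≫ (snd X Y).toHom = 𝟙 _ := by
  rw [StrictHom.toHom_comp, (isBiprod X Y).jq, StrictHom.toHom_id]
@[simp]
lemma inr_snd_assoc {Z : Tilt t} (g : Y ⟶ Z) : (inr X Y).toHom ≫ (snd X Y).toHom ≫ g = g := by
  rw [← Category.assoc, inr_snd, Category.id_comp]
@[simp]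
lemma inl_snd : (inl X Y).toHom ≫ (snd X Y).toHom = 0 := by
  rw [StrictHom.toHom_comp, (isBiprod X Y).iq, StrictHom.toHom_zero]
@[simp]
lemma inl_snd_assoc {Z : Tilt t} (g : Y ⟶ Z) : (inl X Y).toHom ≫ (snd X Y).toHom ≫ g = 0 := by
  rw [← Category.assoc, inl_snd, zero_comp]
@[simp]
lemma inr_fst : (inr X Y).toHom ≫ (fst X Y).toHom = 0 := by
  rw [StrictHom.toHom_comp, (isBiprod X Y).jp, StrictHom.toHom_zero]
@[simp]
lemma inr_fst_assoc {Z : Tilt t} (g : X ⟶ Z) : (inr X Y).toHom ≫ (fst X Y).toHom ≫ g = 0 := by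
  rw [← Category.assoc, inr_fst, zero_comp]

end

end Tilt

namespace Model.Over

open CochainComplex

variable {K L : CochainComplex (Tilt t) ℤ} {E F : CochainComplex A ℤ} {m : Model K E}
  {m' : Model L F} {f : ∀ n, StrictHom (K.X n) (L.X n)} {φ : E ⟶ F}

/-- The morphism of complexes in the tilted category that is induced by a morphism of models. -/
def hom (h : Over m m' f φ) : K ⟶ L := (StrictComplex.incl t).map h.toHom

@[simp]
lemma hom_f (h : Over m m' f φ) (n : ℤ) : h.hom.f n = (f n).toHom := rfl

/-- The decoration of the mapping cone of a morphism of models. -/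
def coneDecoration (h : Over m m' f φ) :
    Decoration (fun n => Tilt.sum (K.X (n + 1)) (L.X n)) (mappingCone φ) where
  -- The cone contains `E⟦1⟧`, so the decoration of the first summand carries the sign of the shift.
  -- The off-diagonal part of the differential does not contribute to `ι ≫ d ≫ σ`, since `φ`
  -- respects the decorations.
  ι n := -((Tilt.fst _ _).f₁ ≫ m.ι (n + 1) ≫ (mappingCone.inl φ).v (n + 1) n (by lia)) +
    (Tilt.snd _ _).f₁ ≫ m'.ι n ≫ (mappingCone.inr φ).f n
  σ i j hij :=
    (mappingCone.fst φ).1.v j (j + 1) rfl ≫ m.σ (i + 1) (j + 1) (by lia) ≫ (Tilt.inl _ _).f₀ +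
      (mappingCone.snd φ).v j j (add_zero j) ≫ m'.σ i j hij ≫ (Tilt.inr _ _).f₀
  ισ i j hij := by
    have h₁ := m.ισ (i + 1) (j + 1) (by lia)
    have h₂ := m'.ισ i j hij
    simp [reassoc_of% h₁, reassoc_of% h₂]
  shortExact i j hij := by
    have h₁ := m.shortExact (i + 1) (j + 1) (by lia)
    have h₂ := m'.shortExact i j hij
    have e₁ := m.epi_σ (i + 1) (j + 1) (by lia)
    have e₂ := m'.epi_σ i j hij
    refine ShortComplex.ShortExact.mk' ?_ ?_ ?_
    · rw [ShortComplex.exact_iff_exact_up_to_refinements]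
      intro T x hx
      dsimp at x hx
      have hx₁ : (x ≫ (mappingCone.fst φ).1.v j (j + 1) rfl) ≫
          m.σ (i + 1) (j + 1) (by lia) = 0 := by
        simpa using hx =≫ (Tilt.fst _ _).f₀
      have hx₂ : (x ≫ (mappingCone.snd φ).v j j (add_zero j)) ≫ m'.σ i j hij = 0 := by
        simpa using hx =≫ (Tilt.snd _ _).f₀
      obtain ⟨a, ha⟩ : ∃ a, a ≫ m.ι (j + 1) = x ≫ (mappingCone.fst φ).1.v j (j + 1) rfl :=
        ⟨_, h₁.fIsKernel.fac (KernelFork.ofι _ hx₁) WalkingParallelPair.zero⟩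
      obtain ⟨b, hb⟩ : ∃ b, b ≫ m'.ι j = x ≫ (mappingCone.snd φ).v j j (add_zero j) :=
        ⟨_, h₂.fIsKernel.fac (KernelFork.ofι _ hx₂) WalkingParallelPair.zero⟩
      refine ⟨T, 𝟙 _, inferInstance, -(a ≫ (Tilt.inl _ _).f₁) + b ≫ (Tilt.inr _ _).f₁, ?_⟩
      dsimp
      rw [mappingCone.ext_to_iff φ j (j + 1) rfl]
      constructor
      · simp [ha]
      · simp [hb]
    · apply Preadditive.mono_of_cancel_zero
      intro T x hx
      dsimp at x hx
      have hx₁ : x ≫ (Tilt.fst _ _).f₁ = 0 := by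
        rw [← cancel_mono (m.ι (j + 1))]
        simpa using hx =≫ (mappingCone.fst φ).1.v j (j + 1) rfl
      have hx₂ : x ≫ (Tilt.snd _ _).f₁ = 0 := by
        rw [← cancel_mono (m'.ι j)]
        simpa using hx =≫ (mappingCone.snd φ).v j j (add_zero j)
      exact Tilt.eq_zero_of_comp₁ x hx₁ hx₂
    · apply Preadditive.epi_of_cancel_zero
      intro T x hx
      dsimp at x hx
      have hx₁ : (Tilt.inl _ _).f₀ ≫ x = 0 := by
        rw [← cancel_epi (m.σ (i + 1) (j + 1) _)]
        simpa using (mappingCone.inl φ).v (j + 1) j (by lia) ≫= hx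
      have hx₂ : (Tilt.inr _ _).f₀ ≫ x = 0 := by
        rw [← cancel_epi (m'.σ i j hij)]
        simpa using (mappingCone.inr φ).f j ≫= hx
      exact Tilt.eq_zero_of_comp₀ x hx₁ hx₂
  ιdσ i j hij := by
    subst hij
    have h₁ := m.ιdσ (i + 1) (i + 1 + 1) rfl
    have h₂ := m'.ιdσ i (i + 1) rfl
    have h₃ := m'.ισ i (i + 1) rfl
    simp only [Preadditive.add_comp, Preadditive.neg_comp, Category.assoc,
      mappingCone.inl_v_d_assoc φ (i + 1) i (i + 1 + 1) (by lia) (by lia),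
      mappingCone.inr_f_d_assoc, Preadditive.comp_add, Preadditive.sub_comp,
      mappingCone.inl_v_fst_v_assoc, mappingCone.inl_v_snd_v_assoc, mappingCone.inr_f_fst_v_assoc,
      mappingCone.inr_f_snd_v_assoc, zero_comp, comp_zero, reassoc_of% h₁, reassoc_of% h₂,
      reassoc_of% h.ι, reassoc_of% h₃, StrictHom.comm_assoc, add_zero, zero_add, sub_zero,
      zero_sub, neg_neg, neg_zero, Preadditive.comp_neg]
    rw [← Preadditive.comp_add, Tilt.total₀, Category.comp_id]

/-- The cone, in the tilted category, of a morphism of models. -/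
abbrev cone (h : Over m m' f φ) : CochainComplex (Tilt t) ℤ := h.coneDecoration.complex

/-- The model of the cone. -/
abbrev coneModel (h : Over m m' f φ) : Model h.cone (mappingCone φ) := h.coneDecoration.model

section

variable (h : Over m m' f φ)

lemma inl_coneι (n : ℤ) : (Tilt.inl (K.X (n + 1)) (L.X n)).f₁ ≫ h.coneDecoration.ι n =
    -(m.ι (n + 1) ≫ (mappingCone.inl φ).v (n + 1) n (by lia)) := by
  simp [coneDecoration]

lemma inr_coneι (n : ℤ) : (Tilt.inr (K.X (n + 1)) (L.X n)).f₁ ≫ h.coneDecoration.ι n =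
    m'.ι n ≫ (mappingCone.inr φ).f n := by
  simp [coneDecoration]

lemma inl_coneσ (i j : ℤ) (hij : i + 1 = j) :
    (mappingCone.inl φ).v (j + 1) j (by lia) ≫ h.coneDecoration.σ i j hij =
      m.σ (i + 1) (j + 1) (by lia) ≫ (Tilt.inl (K.X (i + 1)) (L.X i)).f₀ := by
  simp [coneDecoration]

lemma inr_coneσ (i j : ℤ) (hij : i + 1 = j) :
    (mappingCone.inr φ).f j ≫ h.coneDecoration.σ i j hij =
      m'.σ i j hij ≫ (Tilt.inr (K.X (i + 1)) (L.X i)).f₀ := by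
  simp [coneDecoration]

end

lemma over_inr (h : Over m m' f φ) :
    Over m' h.coneModel (fun n => Tilt.inr (K.X (n + 1)) (L.X n)) (mappingCone.inr φ) where
  ι n := (h.inr_coneι n).symm
  σ i j hij := h.inr_coneσ i j hij

/-- The connecting morphism is the negative of the first projection both in `A` and on the strict
level; the signs in the two decorations by `ι` agree. -/
lemma over_mor₃ (h : Over m m' f φ) :
    Over h.coneModel (m.shift 1) (fun n => (Tilt.fst (K.X (n + 1)) (L.X n)).neg)
      (mappingCone.triangle φ).mor₃ where
  ι n := by
    rw [mappingCone_mor₃_f]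
    change (-((Tilt.fst _ _).f₁ ≫ m.ι (n + 1) ≫ (mappingCone.inl φ).v (n + 1) n (by lia)) +
      (Tilt.snd _ _).f₁ ≫ m'.ι n ≫ (mappingCone.inr φ).f n) ≫
        (-(mappingCone.fst φ).1.v n (n + 1) rfl) = (-(Tilt.fst _ _).f₁) ≫
          (Int.negOnePow 1 • m.ι (n + 1))
    simp
  σ i j hij := by
    rw [mappingCone_mor₃_f]
    change (-(mappingCone.fst φ).1.v j (j + 1) rfl) ≫ m.σ (i + 1) (j + 1) (by lia) =
      ((mappingCone.fst φ).1.v j (j + 1) rfl ≫ m.σ (i + 1) (j + 1) (by lia) ≫ (Tilt.inl _ _).f₀ +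
      (mappingCone.snd φ).v j j (add_zero j) ≫ m'.σ i j hij ≫ (Tilt.inr _ _).f₀) ≫
        (-(Tilt.fst _ _).f₀)
    simp

/-- The inclusion of the source in the cone, as a cochain of degree `-1`. -/
def coneInl (h : Over m m' f φ) : HomComplex.Cochain K h.cone (-1) :=
  HomComplex.Cochain.mk fun p q hpq =>
    (K.XIsoOfEq (show p = q + 1 by lia)).hom ≫ (Tilt.inl (K.X (q + 1)) (L.X q)).toHom

lemma coneInl_v (h : Over m m' f φ) (q : ℤ) :
    h.coneInl.v (q + 1) q (by lia) = (Tilt.inl (K.X (q + 1)) (L.X q)).toHom := by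
  exact Category.id_comp (Tilt.inl (K.X (q + 1)) (L.X q)).toHom

/-- The strict inclusions form a null-homotopy of `h.hom` followed by the inclusion of its target in
the cone. Some of the terms are not strict, so the identity is read off from a map of middle
objects, namely the inclusion of `E` in its cone. -/
lemma hom_comp_inr_f (h : Over m m' f φ) (n : ℤ) :
    (f n).toHom ≫ (Tilt.inr (K.X (n + 1)) (L.X n)).toHom =
      h.coneInl.v n (n - 1) (by lia) ≫ h.cone.d (n - 1) n +
        K.d n (n + 1) ≫ h.coneInl.v (n + 1) n (by lia) := by
  obtain ⟨k, rfl⟩ : ∃ k, n = k + 1 := ⟨n - 1, by lia⟩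
  -- The index `k + 1 - 1` is not syntactically `k`; with a free `l` it can be replaced by `k`
  -- inside the dependent types.
  have key : ∀ l (hl : k = l),
      (f (k + 1)).toHom ≫ (Tilt.inr (K.X (k + 1 + 1)) (L.X (k + 1))).toHom =
      h.coneInl.v (k + 1) l (by lia) ≫ h.cone.d l (k + 1) +
        K.d (k + 1) (k + 1 + 1) ≫ h.coneInl.v (k + 1 + 1) (k + 1) (by lia) := by
    rintro _ rfl
    rw [coneInl_v, coneInl_v, StrictHom.toHom_comp,
      ← m.butterfly_toHom (k + 1) (k + 1 + 1) (k + 1 + 1 + 1) rfl rfl,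
      ← h.coneModel.butterfly_toHom k (k + 1) (k + 1 + 1) rfl rfl]
    have e := mappingCone.inl_v_d φ (k + 1) k (k + 1 + 1) (by lia) (by lia)
    have e' := mappingCone.inl_v_d φ (k + 1 + 1) (k + 1) (k + 1 + 1 + 1) (by lia) (by lia)
    -- The four conditions follow from the formula for `inl ≫ d` in a mapping cone and from the way
    -- `ι` and `σ` of the cone restrict to the summands.
    refine Butterfly.toHom_eq_of_homotopy _ _ _ ((mappingCone.inl φ).v (k + 1 + 1) (k + 1) (by lia))
      ?_ ?_ ?_ ?_
    · have e₁ := h.inl_coneι k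
      have e₂ := h.inr_coneι (k + 1)
      simp [e, e₂, reassoc_of% e₁, ← reassoc_of% h.ι]
    · simp [h.inl_coneι]
    · simp [h.inl_coneσ]
    · have e₁ := h.inl_coneσ (k + 1) (k + 1 + 1) rfl
      have e₂ := h.inr_coneσ (k + 1) (k + 1 + 1) rfl
      simp [reassoc_of% e', e₁, e₂, reassoc_of% h.σ]
  exact key (k + 1 - 1) (by lia)

/-- The comparison of the mapping cone with the cone of a morphism of models. -/
def coneDesc (h : Over m m' f φ) : mappingCone h.hom ⟶ h.cone :=
  mappingCone.desc h.hom h.coneInl h.over_inr.hom (by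
    ext n
    rw [HomComplex.δ_v (-1) 0 (by lia) _ n n (by lia) (n - 1) (n + 1) (by lia) (by lia)]
    simpa using (h.hom_comp_inr_f n).symm)

lemma inr_coneDesc (h : Over m m' f φ) : mappingCone.inr h.hom ≫ h.coneDesc = h.over_inr.hom :=
  mappingCone.inr_desc _ _ _ _

/-- Together with `inr_coneDesc` this makes the comparison of cones one of triangles. -/
lemma coneDesc_mor₃ (h : Over m m' f φ) :
    h.coneDesc ≫ h.over_mor₃.hom = (mappingCone.triangle h.hom).mor₃ := by
  ext n
  rw [mappingCone_mor₃_f]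
  apply mappingCone.ext_from h.hom (n + 1) n rfl
  · rw [HomologicalComplex.comp_f, coneDesc, mappingCone.inl_v_desc_f_assoc, coneInl_v]
    change (Tilt.inl (K.X (n + 1)) (L.X n)).toHom ≫ (Tilt.fst (K.X (n + 1)) (L.X n)).neg.toHom =
      (mappingCone.inl h.hom).v (n + 1) n (by lia) ≫
        (-(mappingCone.fst h.hom).1.v n (n + 1) rfl : _ ⟶ K.X (n + 1))
    rw [StrictHom.toHom_neg, Preadditive.comp_neg, Preadditive.comp_neg, mappingCone.inl_v_fst_v,
      Tilt.inl_fst]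
  · rw [HomologicalComplex.comp_f, coneDesc, mappingCone.inr_f_desc_f_assoc]
    change (Tilt.inr (K.X (n + 1)) (L.X n)).toHom ≫ (Tilt.fst (K.X (n + 1)) (L.X n)).neg.toHom =
      (mappingCone.inr h.hom).f n ≫ (-(mappingCone.fst h.hom).1.v n (n + 1) rfl : _ ⟶ K.X (n + 1))
    rw [StrictHom.toHom_neg, Preadditive.comp_neg, Preadditive.comp_neg, mappingCone.inr_f_fst_v,
      Tilt.inr_fst]

/-- In each degree it compares two biproducts of the same objects, and the strict biproduct is a
biproduct in the tilted category by `IsBiprod.toHom_total`. -/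
instance (h : Over m m' f φ) : IsIso h.coneDesc := by
  have : ∀ n, IsIso (h.coneDesc.f n) := fun n => by
    refine ⟨(Tilt.fst _ _).toHom ≫ (mappingCone.inl h.hom).v (n + 1) n (by lia) +
      (Tilt.snd _ _).toHom ≫ (mappingCone.inr h.hom).f n, ?_, ?_⟩
    · apply mappingCone.ext_from h.hom (n + 1) n rfl
      · rw [coneDesc, mappingCone.inl_v_desc_f_assoc, coneInl_v]
        simp
      · rw [coneDesc, mappingCone.inr_f_desc_f_assoc, hom_f]
        simp
    · rw [coneDesc, Preadditive.add_comp, Category.assoc, Category.assoc,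
        mappingCone.inl_v_desc_f, mappingCone.inr_f_desc_f, coneInl_v]
      exact (Tilt.isBiprod _ _).toHom_total
  exact HomologicalComplex.Hom.isIso_of_components _

end Model.Over

section

variable {C : Type*} [Category* C] [Abelian C]

lemma quasiIso_iff_acyclic_mappingCone {K L : CochainComplex C ℤ} (φ : K ⟶ L) :
    QuasiIso φ ↔ (CochainComplex.mappingCone φ).Acyclic := by
  rw [← HomotopyCategory.quotient_obj_mem_subcategoryAcyclic_iff_acyclic,
    ← HomologicalComplex.mem_quasiIso_iff, ← HomotopyCategory.quotient_map_mem_quasiIso_iff,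
    HomotopyCategory.quasiIso_eq_trW_subcategoryAcyclic]
  exact ObjectProperty.trW_iff_of_distinguished _ _
    (HomotopyCategory.mappingCone_triangleh_distinguished φ)

lemma acyclic_iff_of_iso {K L : CochainComplex C ℤ} (e : K ≅ L) : K.Acyclic ↔ L.Acyclic :=
  forall_congr' fun n => exactAt_iff_of_quasiIsoAt e.hom n

end

/-- Both conditions say that a cone is acyclic, and the cone of `φ` is a model of a complex
isomorphic to the cone of `h.hom`. The functor to derived categories, its detection of zero objects
and the change of decorations all rest on this comparison of acyclicity. -/
lemma Model.Over.quasiIso_iff {K L : CochainComplex (Tilt t) ℤ} {E F : CochainComplex A ℤ}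
    {m : Model K E} {m' : Model L F} {f : ∀ n, StrictHom (K.X n) (L.X n)} {φ : E ⟶ F}
    (h : Over m m' f φ) : QuasiIso φ ↔ QuasiIso h.hom := by
  rw [quasiIso_iff_acyclic_mappingCone, quasiIso_iff_acyclic_mappingCone,
    acyclic_iff_of_iso (asIso h.coneDesc), h.coneModel.acyclic_iff]

end HRS

end

/-! ### Extension of `Tot` to all morphisms of complexes and descent to derived categories -/

noncomputable section

namespace HRS

universe w w' v u

variable {A : Type u} [Category.{v} A] [Abelian A] {t : TorsionPair A}

namespace StrictComplex

/-- Every morphism of complexes in the tilted category is a fraction of strict morphisms. -/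
lemma exists_fac {X Y : StrictComplex t} (f : (incl t).obj X ⟶ (incl t).obj Y) :
    ∃ (X' : StrictComplex t) (s : X' ⟶ X) (g : X' ⟶ Y),
      IsIso ((incl t).map s) ∧ (incl t).map s ≫ f = (incl t).map g := by
  obtain ⟨φ, hφ, e⟩ : ∃ φ : ∀ n, X.K.X n ⟶ Y.K.X n, (∀ n, f.f n = φ n) ∧
      ∀ i j, φ i ≫ Y.K.d i j = X.K.d i j ≫ φ j := ⟨f.f, fun _ => rfl, fun i j => f.comm i j⟩
  choose Z s g hs hg using fun n => Butterfly.exists_strict_source (φ n)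
  -- The sources are made strict one degree at a time, and the differential is transported along the
  -- isomorphisms `s n`. These then form a strict morphism by construction.
  let K' : CochainComplex (Tilt t) ℤ :=
    { X := Z
      d := fun i j => (s i).toHom ≫ X.K.d i j ≫ inv (s j).toHom
      shape := fun i j hij => by rw [X.K.shape i j hij, zero_comp, comp_zero]
      d_comp_d' := fun i j k _ _ => by simp }
  let S : mk K' ⟶ X := ⟨s, fun i j => by simp [K']⟩
  refine ⟨mk K', S, ⟨g, fun i j => ?_⟩, ?_, ?_⟩
  · change (g i).toHom ≫ _ = ((s i).toHom ≫ X.K.d i j ≫ inv (s j).toHom) ≫ (g j).toHom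
    simp only [← hg, e, Category.assoc, IsIso.inv_hom_id_assoc]
  · have : ∀ n, IsIso (((incl t).map S).f n) := hs
    exact HomologicalComplex.Hom.isIso_of_components _
  · ext n
    exact (congr_arg (fun x => (s n).toHom ≫ x) (hφ n)).trans (hg n)

lemma quasiIso_totEMap_iff {X Y : StrictComplex t} (F : X ⟶ Y) :
    QuasiIso (totEMap F) ↔ QuasiIso ((incl t).map F) := (over_totEMap F).quasiIso_iff

variable {X Y Z : StrictComplex t}

/-- Write `f` as a fraction of strict morphisms. Naturality holds for numerator and denominator, and
the denominator is invertible. -/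
lemma naturality_of_incl {D : Type*} [Category* D] {G G' : CochainComplex (Tilt t) ℤ ⥤ D}
    (e : incl t ⋙ G ⟶ incl t ⋙ G') (f : (incl t).obj X ⟶ (incl t).obj Y) :
    G.map f ≫ e.app Y = e.app X ≫ G'.map f := by
  obtain ⟨X', s, g, _, h⟩ := exists_fac f
  have e₁ : G.map ((incl t).map s) ≫ e.app X = e.app X' ≫ G'.map ((incl t).map s) := e.naturality s
  have e₂ : G.map ((incl t).map g) ≫ e.app Y = e.app X' ≫ G'.map ((incl t).map g) := e.naturality g
  rw [← cancel_epi (G.map ((incl t).map s)), ← G.map_comp_assoc, h, e₂, reassoc_of% e₁,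
    ← G'.map_comp, h]

/-- Isomorphisms between functors on complexes in the tilted category can be defined on strict
complexes. -/
def natIsoOfIncl {D : Type*} [Category* D] {G G' : CochainComplex (Tilt t) ℤ ⥤ D}
    (e : incl t ⋙ G ≅ incl t ⋙ G') : G ≅ G' :=
  NatIso.ofComponents (fun K => e.app (mk K))
    (fun {K L} f => naturality_of_incl (X := mk K) (Y := mk L) e.hom f)

variable [HasDerivedCategory.{w} A]

variable (t) in
/-- The functor from strict complexes to the derived category that forgets the decoration of the
total complex. -/
def totQ : StrictComplex t ⥤ DerivedCategory A :=
  tot t ⋙ forgetDecoration t ⋙ DerivedCategory.Q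

lemma isIso_totQ_map_iff {X Y : StrictComplex t} (F : X ⟶ Y) :
    IsIso ((totQ t).map F) ↔ QuasiIso ((incl t).map F) := by
  exact (DerivedCategory.isIso_Q_map_iff_quasiIso _ _).trans (quasiIso_totEMap_iff F)

lemma isIso_totQ_map {X Y : StrictComplex t} (F : X ⟶ Y) [IsIso ((incl t).map F)] :
    IsIso ((totQ t).map F) := by
  rw [isIso_totQ_map_iff]; infer_instance

/-- Strict morphisms with the same class are homotopic in each degree, and these homotopies assemble
to a homotopy of total complexes, which the derived category does not see. -/
lemma totQ_map_eq {X Y : StrictComplex t} {F G : X ⟶ Y} (h : (incl t).map F = (incl t).map G) :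
    (totQ t).map F = (totQ t).map G := by
  obtain ⟨H⟩ := (over_totEMap F).nonempty_homotopy (over_totEMap G)
    (fun n => congr_arg (fun φ => φ.f n) h)
  exact DerivedCategory.Q_map_eq_of_homotopy _ H

/-- The value on `f` must be the image of any fraction that represents it; the content is
independence of the fraction. -/
lemma exists_totQ_fac (f : (incl t).obj X ⟶ (incl t).obj Y) :
    ∃ r : (totQ t).obj X ⟶ (totQ t).obj Y,
    ∀ (X' : StrictComplex t) (s : X' ⟶ X) (g : X' ⟶ Y), IsIso ((incl t).map s) →
      (incl t).map s ≫ f = (incl t).map g → (totQ t).map s ≫ r = (totQ t).map g := by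
  obtain ⟨X₀, s₀, g₀, _, h₀⟩ := exists_fac f
  have := isIso_totQ_map s₀
  refine ⟨inv ((totQ t).map s₀) ≫ (totQ t).map g₀, fun X' s g _ h => ?_⟩
  -- A common denominator: `u ≫ s` and `v ≫ s₀` agree in the tilted category but perhaps not
  -- strictly, which is enough by `totQ_map_eq`. The same holds for the numerators.
  obtain ⟨X₂, u, v, _, h₂⟩ := exists_fac ((incl t).map s ≫ inv ((incl t).map s₀))
  have := isIso_totQ_map u
  have e₁ : (incl t).map (u ≫ s) = (incl t).map (v ≫ s₀) := by simp [← h₂]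
  have e₂ : (incl t).map (u ≫ g) = (incl t).map (v ≫ g₀) := by simp [← h₂, ← h₀, ← h]
  have eq₁ := totQ_map_eq e₁
  have eq₂ := totQ_map_eq e₂
  rw [(totQ t).map_comp, (totQ t).map_comp] at eq₁ eq₂
  rw [← cancel_epi ((totQ t).map u), reassoc_of% eq₁, IsIso.hom_inv_id_assoc, eq₂]

/-- The morphism in the derived category that is induced by a morphism of complexes in the tilted
category. -/
def totMapQ (f : (incl t).obj X ⟶ (incl t).obj Y) : (totQ t).obj X ⟶ (totQ t).obj Y :=
  (exists_totQ_fac f).choose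

lemma totQ_comp_totMapQ {f : (incl t).obj X ⟶ (incl t).obj Y} {X' : StrictComplex t} (s : X' ⟶ X)
    (g : X' ⟶ Y) [IsIso ((incl t).map s)] (h : (incl t).map s ≫ f = (incl t).map g) :
    (totQ t).map s ≫ totMapQ f = (totQ t).map g :=
  (exists_totQ_fac f).choose_spec X' s g inferInstance h

lemma totMapQ_incl (F : X ⟶ Y) : totMapQ ((incl t).map F) = (totQ t).map F := by
  have := totQ_comp_totMapQ (f := (incl t).map F) (𝟙 _) F (by simp)
  rwa [(totQ t).map_id, Category.id_comp] at this

lemma totMapQ_comp (f : (incl t).obj X ⟶ (incl t).obj Y) (g : (incl t).obj Y ⟶ (incl t).obj Z) :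
    totMapQ (f ≫ g) = totMapQ f ≫ totMapQ g := by
  obtain ⟨X₁, s₁, g₁, _, h₁⟩ := exists_fac f
  obtain ⟨Y₁, s₂, g₂, _, h₂⟩ := exists_fac g
  -- The calculus of fractions: the numerator of `f` is moved past the denominator of `g`, which
  -- gives a fraction for the composite.
  obtain ⟨X₂, u, v, _, h₃⟩ := exists_fac ((incl t).map g₁ ≫ inv ((incl t).map s₂))
  have e : (incl t).map (v ≫ s₂) = (incl t).map (u ≫ g₁) := by simp [← h₃]
  have e' := totQ_map_eq e
  rw [(totQ t).map_comp, (totQ t).map_comp] at e'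
  have : IsIso ((incl t).map (u ≫ s₁)) := by rw [(incl t).map_comp]; infer_instance
  have := isIso_totQ_map s₁
  have := isIso_totQ_map u
  have e₁ := totQ_comp_totMapQ (u ≫ s₁) (v ≫ g₂) (f := f ≫ g) (by
    simp [← h₂, ← h₃, reassoc_of% h₁])
  rw [(totQ t).map_comp, (totQ t).map_comp, Category.assoc] at e₁
  rw [← cancel_epi ((totQ t).map s₁), ← cancel_epi ((totQ t).map u), e₁,
    ← Category.assoc ((totQ t).map s₁), totQ_comp_totMapQ s₁ g₁ h₁,
    ← Category.assoc, ← e', Category.assoc, totQ_comp_totMapQ s₂ g₂ h₂]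

variable (t) in
/-- The functor from complexes in the tilted category to the derived category that is induced by the
total complex. -/
def totFunctor : CochainComplex (Tilt t) ℤ ⥤ DerivedCategory A where
  obj K := (totQ t).obj (mk K)
  map {K L} f := totMapQ (X := mk K) (Y := mk L) f
  map_id K := (totMapQ_incl (𝟙 (mk K))).trans ((totQ t).map_id _)
  map_comp {K L M} f g := totMapQ_comp (X := mk K) (Y := mk L) (Z := mk M) f g

variable (t) in
/-- On strict complexes, the functor `totFunctor` is the total complex. -/
def inclCompTotFunctor : incl t ⋙ totFunctor t ≅ totQ t :=
  NatIso.ofComponents (fun _ => Iso.refl _) (fun F => by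
    refine (Category.comp_id _).trans ((totMapQ_incl F).trans (Category.id_comp _).symm))

lemma totFunctor_map_incl (F : X ⟶ Y) :
    (totFunctor t).map ((incl t).map F) = DerivedCategory.Q.map (totEMap F) := totMapQ_incl F

-- If `f` is a quasi-isomorphism and `f = g / s` with `s` invertible, then the strict morphism `g`
-- is a quasi-isomorphism, so its total complex is inverted by `isIso_totQ_map_iff`.
variable (t) in
lemma totFunctor_inverts :
    (HomologicalComplex.quasiIso (Tilt t) (ComplexShape.up ℤ)).IsInvertedBy (totFunctor t) := by
  intro K L f (hf : QuasiIso f)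
  obtain ⟨K', s, g, _, h⟩ := exists_fac (X := mk K) (Y := mk L) f
  have := isIso_totQ_map s
  have : IsIso ((totQ t).map g) := by
    rw [isIso_totQ_map_iff, ← h]
    have : QuasiIso (show (incl t).obj (mk K) ⟶ (incl t).obj (mk L) from f) := hf
    exact quasiIso_comp _ _
  have e := totQ_comp_totMapQ s g h
  rw [← e] at this
  exact IsIso.of_isIso_comp_left ((totQ t).map s) (totMapQ (X := mk K) (Y := mk L) f)

end StrictComplex

section

variable [HasDerivedCategory.{w} A] [HasDerivedCategory.{w'} (Tilt t)]

variable (t) in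
/-- The functor induced by `Φ ∘ Tot` on derived categories. -/
def phiTot : DerivedCategory (Tilt t) ⥤ DerivedCategory A :=
  Localization.lift (StrictComplex.totFunctor t) (StrictComplex.totFunctor_inverts t)
    DerivedCategory.Q

variable (t) in
/-- The functor `phiTot` is induced by `totFunctor`. -/
def phiTotFac : DerivedCategory.Q ⋙ phiTot t ≅ StrictComplex.totFunctor t :=
  Localization.fac _ _ _

lemma isPhiTot_phiTot : IsPhiTot t (phiTot t) :=
  ⟨Functor.isoWhiskerLeft (StrictComplex.incl t) (phiTotFac t) ≪≫
    StrictComplex.inclCompTotFunctor t⟩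

/-- Strict complexes have the same objects as all complexes, so the components of the isomorphism
are already given. They are natural for all morphisms because these are fractions of strict ones,
and the isomorphism descends by the universal property of the localization. -/
lemma IsPhiTot.nonempty_iso {Ψ Ψ' : DerivedCategory (Tilt t) ⥤ DerivedCategory A}
    (h : IsPhiTot t Ψ) (h' : IsPhiTot t Ψ') : Nonempty (Ψ ≅ Ψ') := by
  obtain ⟨e⟩ := h
  obtain ⟨e'⟩ := h'
  let e₂ : DerivedCategory.Q ⋙ Ψ ≅ DerivedCategory.Q ⋙ Ψ' :=
    StrictComplex.natIsoOfIncl (e ≪≫ e'.symm)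
  exact ⟨Localization.liftNatIso DerivedCategory.Q
    (HomologicalComplex.quasiIso (Tilt t) (ComplexShape.up ℤ)) _ _ _ _ e₂⟩

end

end HRS

end

/-! ### Comparison of models and compatibility with shifts -/

noncomputable section

namespace HRS

universe w w' v u

variable {A : Type u} [Category.{v} A] [Abelian A] {t : TorsionPair A}

namespace Model

variable {K L : CochainComplex (Tilt t) ℤ} {E F : CochainComplex A ℤ}

lemma ι_comp_XIsoOfEq (m : Model K E) {p q : ℤ} (h : p = q) :
    m.ι p ≫ (E.XIsoOfEq h).hom = eqToHom (by rw [h]) ≫ m.ι q := by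
  subst h; simp

lemma XIsoOfEq_comp_σ (m : Model K E) {i i' j j' : ℤ} (h : i = i') (h' : j = j') (hij : i + 1 = j)
    (hij' : i' + 1 = j') :
    (E.XIsoOfEq h').hom ≫ m.σ i' j' hij' = m.σ i j hij ≫ eqToHom (by rw [h]) := by
  subst h h'; simp

lemma over_shiftZero (m : Model K E) :
    Over (m.shift 0) m (fun p => StrictHom.ofEq (congr_arg K.X (add_zero p)))
      ((shiftFunctorZero (CochainComplex A ℤ) ℤ).hom.app E) where
  ι p := by
    rw [CochainComplex.shiftFunctorZero_hom_app_f]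
    change (Int.negOnePow 0 • m.ι (p + 0)) ≫ (E.XIsoOfEq (add_zero p)).hom =
      eqToHom (by rw [add_zero]) ≫ m.ι p
    rw [Int.negOnePow_zero, one_smul, ι_comp_XIsoOfEq]
  σ i j h := by
    rw [CochainComplex.shiftFunctorZero_hom_app_f]
    exact m.XIsoOfEq_comp_σ (add_zero i) (add_zero j) _ _

/-- The coherence isomorphism of shifts is only a transport of indices, and the signs of the
decorations match because `negOnePow` is multiplicative. On the strict level it is given by the
identifications `ofEq`. -/
lemma over_shiftAdd (m : Model K E) (a b : ℤ) :
    Over (m.shift (a + b)) ((m.shift a).shift b)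
      (fun p => StrictHom.ofEq (congr_arg K.X (show p + (a + b) = p + b + a by lia)))
      ((shiftFunctorAdd (CochainComplex A ℤ) a b).hom.app E) where
  ι p := by
    rw [CochainComplex.shiftFunctorAdd_hom_app_f]
    change ((a + b).negOnePow • m.ι (p + (a + b))) ≫
      (E.XIsoOfEq (show p + (a + b) = p + b + a by lia)).hom =
        eqToHom (by rw [show p + (a + b) = p + b + a by lia]) ≫
          (b.negOnePow • a.negOnePow • m.ι (p + b + a))
    rw [Linear.units_smul_comp, ι_comp_XIsoOfEq, smul_smul, Linear.comp_units_smul, mul_comm,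
      ← Int.negOnePow_add]
  σ i j h := by
    rw [CochainComplex.shiftFunctorAdd_hom_app_f]
    exact m.XIsoOfEq_comp_σ (by lia) (by lia) _ _

lemma over_shiftZero_hom (m : Model K E) :
    m.over_shiftZero.hom = (shiftFunctorZero (CochainComplex (Tilt t) ℤ) ℤ).hom.app K := by
  ext n
  rw [CochainComplex.shiftFunctorZero_hom_app_f]
  exact StrictHom.toHom_ofEq (congr_arg K.X (add_zero n))

lemma over_shiftAdd_hom (m : Model K E) (a b : ℤ) :
    (m.over_shiftAdd a b).hom = (shiftFunctorAdd (CochainComplex (Tilt t) ℤ) a b).hom.app K := by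
  ext n
  rw [CochainComplex.shiftFunctorAdd_hom_app_f]
  exact StrictHom.toHom_ofEq (congr_arg K.X (show n + (a + b) = n + b + a by lia))

lemma exists_compare (m : Model K E) :
    ∃ φ, Over (StrictComplex.mk K).totModel m (fun _ => StrictHom.id _) φ :=
  exists_over _ _ _ (fun i j => by
    rw [StrictHom.toHom_id, StrictHom.toHom_id]
    exact (Category.id_comp _).trans (Category.comp_id _).symm)

/-- The comparison of the total complex with a model. -/
def compare (m : Model K E) : (StrictComplex.mk K).totE ⟶ E := m.exists_compare.choose

lemma over_compare (m : Model K E) :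
    Over (StrictComplex.mk K).totModel m (fun _ => StrictHom.id _) m.compare :=
  m.exists_compare.choose_spec

/-- Identity strict morphisms lift in both directions, and both composites are identities by
uniqueness. Hence any model may replace the total complex. -/
instance (m : Model K E) : IsIso m.compare := by
  obtain ⟨φ, hφ⟩ : ∃ φ, Over m (StrictComplex.mk K).totModel (fun _ => StrictHom.id _) φ :=
    exists_over _ _ _ (fun i j => by
      rw [StrictHom.toHom_id, StrictHom.toHom_id]
      exact (Category.id_comp _).trans (Category.comp_id _).symm)
  refine ⟨φ, (m.over_compare.comp hφ).unique ?_, (hφ.comp m.over_compare).unique ?_⟩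
  · convert Over.refl _
    ext <;> simp
  · convert Over.refl _
    ext <;> simp

variable {m : Model K E} {m' : Model L F} {f : ∀ n, StrictHom (K.X n) (L.X n)} {φ : E ⟶ F}

/-- Both sides lie over the same strict morphisms. The equality `e` is needed because composing with
the identity on the left and on the right gives different expressions. -/
lemma Over.totEMap_comp_compare (h : Over m m' f φ) :
    StrictComplex.totEMap h.toHom ≫ m'.compare = m.compare ≫ φ := by
  have h₁ := (StrictComplex.over_totEMap h.toHom).comp m'.over_compare
  have h₂ := m.over_compare.comp h
  have e : (fun n => (h.toHom.f n).comp (StrictHom.id (L.X n))) =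
      fun n => (StrictHom.id (K.X n)).comp (f n) := by
    ext n
    · exact (Category.comp_id _).trans (Category.id_comp _).symm
    · exact (Category.comp_id _).trans (Category.id_comp _).symm
  exact (e ▸ h₁).unique h₂

end Model

namespace StrictComplex

/-- The shift of a strict morphism. -/
def shiftMap {X Y : StrictComplex t} (F : X ⟶ Y) (n : ℤ) : mk (X.K⟦n⟧) ⟶ mk (Y.K⟦n⟧) :=
  ((over_totEMap F).shift n).toHom

/-- The total complex commutes with the shift. -/
def totShift (X : StrictComplex t) (n : ℤ) : (mk (X.K⟦n⟧)).totE ⟶ X.totE⟦n⟧ :=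
  (X.totModel.shift n).compare

instance (X : StrictComplex t) (n : ℤ) : IsIso (X.totShift n) :=
  inferInstanceAs (IsIso (X.totModel.shift n).compare)

lemma totEMap_shiftMap {X Y : StrictComplex t} (F : X ⟶ Y) (n : ℤ) :
    totEMap (shiftMap F n) ≫ Y.totShift n = X.totShift n ≫ (totEMap F)⟦n⟧' :=
  ((over_totEMap F).shift n).totEMap_comp_compare

lemma compare_totModel (X : StrictComplex t) : X.totModel.compare = 𝟙 _ :=
  X.totModel.over_compare.unique (Model.Over.refl _)

lemma totShift_zero (X : StrictComplex t) :
    X.totShift 0 ≫ (shiftFunctorZero _ ℤ).hom.app X.totE =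
      totEMap X.totModel.over_shiftZero.toHom :=
  X.totModel.over_shiftZero.totEMap_comp_compare.symm.trans
    ((congr_arg (fun x => totEMap X.totModel.over_shiftZero.toHom ≫ x) X.compare_totModel).trans
      (Category.comp_id _))

/-- After naturality of the comparison it remains to identify two comparisons with the iterated
shift of the model, and both lie over the identities. -/
lemma totShift_add (X : StrictComplex t) (a b : ℤ) :
    X.totShift (a + b) ≫ (shiftFunctorAdd _ a b).hom.app X.totE =
      totEMap (X.totModel.over_shiftAdd a b).toHom ≫ (mk (X.K⟦a⟧)).totShift b ≫
        (X.totShift a)⟦b⟧' := by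
  refine ((X.totModel.over_shiftAdd a b).totEMap_comp_compare).symm.trans
    (congr_arg (fun x => totEMap (X.totModel.over_shiftAdd a b).toHom ≫ x) ?_)
  have h := ((mk (X.K⟦a⟧)).totModel.shift b).over_compare.comp
    (((X.totModel.shift a).over_compare).shift b)
  have e : (fun n => (StrictHom.id (((X.K⟦a⟧)⟦b⟧).X n)).comp
      (StrictHom.id (((X.K⟦a⟧)⟦b⟧).X n))) = fun n => StrictHom.id _ := by
    ext n
    · exact Category.id_comp _
    · exact Category.id_comp _
  exact ((X.totModel.shift a).shift b).over_compare.unique (e ▸ h)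

variable [HasDerivedCategory.{w} A]

lemma totFunctor_map_hom {K L : CochainComplex (Tilt t) ℤ} {E F : CochainComplex A ℤ}
    {m : Model K E} {m' : Model L F} {f : ∀ n, StrictHom (K.X n) (L.X n)} {φ : E ⟶ F}
    (h : Model.Over m m' f φ) :
    (totFunctor t).map h.hom = DerivedCategory.Q.map (totEMap h.toHom) :=
  totFunctor_map_incl h.toHom

/-- The commutation of the total complex with the shift, in the derived category. -/
def totShiftIso (X : StrictComplex t) (n : ℤ) :
    DerivedCategory.Q.obj (mk (X.K⟦n⟧)).totE ≅ (DerivedCategory.Q.obj X.totE)⟦n⟧ :=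
  DerivedCategory.Q.mapIso (asIso (X.totShift n)) ≪≫
    (DerivedCategory.Q.commShiftIso n).app X.totE

lemma totShiftIso_hom (X : StrictComplex t) (n : ℤ) :
    (X.totShiftIso n).hom = DerivedCategory.Q.map (X.totShift n) ≫
      (DerivedCategory.Q.commShiftIso n).hom.app X.totE := rfl

lemma totShiftIso_hom_naturality {X Y : StrictComplex t} (F : X ⟶ Y) (n : ℤ) :
    DerivedCategory.Q.map (totEMap (shiftMap F n)) ≫ (Y.totShiftIso n).hom =
      (X.totShiftIso n).hom ≫ (DerivedCategory.Q.map (totEMap F))⟦n⟧' := by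
  rw [totShiftIso_hom, totShiftIso_hom, ← Functor.map_comp_assoc, totEMap_shiftMap, Category.assoc,
    ← Functor.commShiftIso_hom_naturality, Functor.map_comp_assoc]

variable (t) in
/-- The commutation of the total complex with the shift. -/
def totFunctorShiftIso (n : ℤ) :
    shiftFunctor (CochainComplex (Tilt t) ℤ) n ⋙ totFunctor t ≅
      totFunctor t ⋙ shiftFunctor (DerivedCategory A) n :=
  natIsoOfIncl (NatIso.ofComponents (fun X => X.totShiftIso n) (fun {X Y} F =>
    (congr_arg (fun x => x ≫ (Y.totShiftIso n).hom) (totFunctor_map_incl (shiftMap F n))).trans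
      ((totShiftIso_hom_naturality F n).trans (congr_arg (fun x => (X.totShiftIso n).hom ≫ x⟦n⟧')
        (totFunctor_map_incl F).symm))))

lemma totShiftIso_zero (X : StrictComplex t) : (X.totShiftIso 0).hom =
    DerivedCategory.Q.map (totEMap X.totModel.over_shiftZero.toHom) ≫
      (shiftFunctorZero _ ℤ).inv.app (DerivedCategory.Q.obj X.totE) := by
  rw [totShiftIso_hom, Functor.commShiftIso_zero, Functor.CommShift.isoZero_hom_app,
    ← Functor.map_comp_assoc]
  exact congr_arg (fun x => DerivedCategory.Q.map x ≫
    (shiftFunctorZero _ ℤ).inv.app (DerivedCategory.Q.obj X.totE)) X.totShift_zero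

lemma Q_map_comp_commShiftIso_add {E E₁ E₂ E₃ : CochainComplex A ℤ} {a b : ℤ}
    (τ : E₃ ⟶ E⟦a + b⟧) (s : E₃ ⟶ E₂) (τ₂ : E₂ ⟶ E₁⟦b⟧) (τ₁ : E₁ ⟶ E⟦a⟧)
    (h : τ ≫ (shiftFunctorAdd _ a b).hom.app E = s ≫ τ₂ ≫ τ₁⟦b⟧') :
    DerivedCategory.Q.map τ ≫ (DerivedCategory.Q.commShiftIso (a + b)).hom.app E =
      DerivedCategory.Q.map s ≫
        (DerivedCategory.Q.map τ₂ ≫ (DerivedCategory.Q.commShiftIso b).hom.app E₁) ≫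
        (DerivedCategory.Q.map τ₁ ≫ (DerivedCategory.Q.commShiftIso a).hom.app E)⟦b⟧' ≫
        (shiftFunctorAdd _ a b).inv.app (DerivedCategory.Q.obj E) := by
  rw [Functor.commShiftIso_add, Functor.CommShift.isoAdd_hom_app, ← Functor.map_comp_assoc, h,
    Functor.map_comp, Functor.map_comp, Functor.map_comp, Category.assoc, Category.assoc,
    Category.assoc, Category.assoc, Functor.commShiftIso_hom_naturality_assoc]

lemma totShiftIso_add (X : StrictComplex t) (a b : ℤ) : (X.totShiftIso (a + b)).hom =
    DerivedCategory.Q.map (totEMap (X.totModel.over_shiftAdd a b).toHom) ≫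
      ((mk (X.K⟦a⟧)).totShiftIso b).hom ≫ ((X.totShiftIso a).hom)⟦b⟧' ≫
        (shiftFunctorAdd _ a b).inv.app (DerivedCategory.Q.obj X.totE) :=
  Q_map_comp_commShiftIso_add _ _ _ _ (X.totShift_add a b)

/-- The coherence isomorphisms in the tilted category are themselves induced by morphisms of models,
which turns the axioms into `totShiftIso_zero` and `totShiftIso_add`. -/
instance : (totFunctor t).CommShift ℤ where
  commShiftIso n := totFunctorShiftIso t n
  commShiftIso_zero := by
    ext K
    rw [Functor.CommShift.isoZero_hom_app, ← (mk K).totModel.over_shiftZero_hom]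
    exact (totShiftIso_zero (mk K)).trans (congr_arg (fun x => x ≫ _)
      (totFunctor_map_hom (mk K).totModel.over_shiftZero).symm)
  commShiftIso_add a b := by
    ext K
    rw [Functor.CommShift.isoAdd_hom_app, ← (mk K).totModel.over_shiftAdd_hom]
    exact (totShiftIso_add (mk K) a b).trans (congr_arg (fun x => x ≫ _)
      (totFunctor_map_hom ((mk K).totModel.over_shiftAdd a b)).symm)

end StrictComplex

end HRS

end

/-! ### Triangles and boundedness -/

noncomputable section

namespace HRS

universe w w' v u

variable {A : Type u} [Category.{v} A] [Abelian A] {t : TorsionPair A}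

open Pretriangulated

namespace Model

variable {K : CochainComplex (Tilt t) ℤ} {E : CochainComplex A ℤ} (m : Model K E)

/-- The comparison of the total complex with a model, as an isomorphism. -/
def compareIso : (StrictComplex.mk K).totE ≅ E := asIso m.compare

lemma totShift_comp_compare (n : ℤ) :
    (StrictComplex.mk K).totShift n ≫ m.compare⟦n⟧' = (m.shift n).compare := by
  have h := ((StrictComplex.mk K).totModel.shift n).over_compare.comp (m.over_compare.shift n)
  have e : (fun p => (StrictHom.id ((K⟦n⟧).X p)).comp (StrictHom.id ((K⟦n⟧).X p))) =
      fun n => StrictHom.id _ := by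
    ext n
    · exact Category.id_comp _
    · exact Category.id_comp _
  exact Over.unique (e ▸ h) (m.shift n).over_compare

end Model

section

variable [HasDerivedCategory.{w'} (Tilt t)]

/-- A distinguished triangle comes from the cone of a morphism of complexes. Replacing its source by
an isomorphic complex makes this morphism strict, so that it is covered by the cones of models. -/
lemma exists_iso_Q_mapTriangle_incl (T : Triangle (DerivedCategory (Tilt t)))
    (hT : T ∈ distTriang (DerivedCategory (Tilt t))) :
    ∃ (X Y : StrictComplex t) (g : X ⟶ Y), Nonempty (T ≅ DerivedCategory.Q.mapTriangle.obj
      (CochainComplex.mappingCone.triangle (StrictComplex.over_totEMap g).hom)) := by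
  obtain ⟨K, L, f, ⟨e⟩⟩ := (DerivedCategory.mem_distTriang_iff T).1 hT
  obtain ⟨X, s, g, _, h⟩ := StrictComplex.exists_fac (X := ⟨K⟩) (Y := ⟨L⟩) f
  refine ⟨X, ⟨L⟩, g, ⟨e ≪≫ (isoTriangleOfIso₁₂ _ _
    (DerivedCategory.mappingCone_triangle_distinguished _)
    (DerivedCategory.mappingCone_triangle_distinguished _)
    (DerivedCategory.Q.mapIso (@asIso _ _ _ _ ((StrictComplex.incl t).map s) (by assumption)))
    (Iso.refl _) ?_).symm⟩⟩
  refine (Category.comp_id _).trans ?_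
  exact (congr_arg DerivedCategory.Q.map h.symm).trans (DerivedCategory.Q.map_comp _ _)

end

/-- The object `E i` is built from `X (i-1)` and `X i`, so exactness at `i` uses both degrees of
`K`. This costs one degree here and none for lower bounds; in the converse direction the roles are
exchanged. -/
lemma isLE_totE (X : StrictComplex t) (n : ℤ) (h : X.K.IsLE n) : X.totE.IsLE (n + 1) := by
  rw [CochainComplex.isLE_iff] at h ⊢
  exact fun i hi => X.totModel.exactAt (i - 1) i (by lia) (h _ (by lia)) (h _ (by lia))

lemma isGE_totE (X : StrictComplex t) (n : ℤ) (h : X.K.IsGE n) : X.totE.IsGE n := by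
  rw [CochainComplex.isGE_iff] at h ⊢
  exact fun i hi => X.totModel.exactAt (i - 1) i (by lia) (h _ (by lia)) (h _ (by lia))

lemma isLE_of_totE (X : StrictComplex t) (n : ℤ) (h : X.totE.IsLE n) : X.K.IsLE n := by
  rw [CochainComplex.isLE_iff] at h ⊢
  exact fun i hi => X.totModel.exactAt_of_model i (i + 1) rfl (h _ (by lia)) (h _ (by lia))

lemma isGE_of_totE (X : StrictComplex t) (n : ℤ) (h : X.totE.IsGE n) : X.K.IsGE (n - 1) := by
  rw [CochainComplex.isGE_iff] at h ⊢
  exact fun i hi => X.totModel.exactAt_of_model i (i + 1) rfl (h _ (by lia)) (h _ (by lia))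

section

variable [HasDerivedCategory.{w} A]

open CochainComplex StrictComplex

namespace Model

variable {K L : CochainComplex (Tilt t) ℤ} {E F : CochainComplex A ℤ} (m : Model K E)
  {m' : Model L F} {f : ∀ n, StrictHom (K.X n) (L.X n)} {φ : E ⟶ F}

/-- The comparison of the image of a complex in the derived category with a model. -/
def compareQ : (totFunctor t).obj K ≅ DerivedCategory.Q.obj E :=
  DerivedCategory.Q.mapIso m.compareIso

variable {m} in
lemma Over.map_comp_compareQ (h : Over m m' f φ) :
    (totFunctor t).map h.hom ≫ m'.compareQ.hom = m.compareQ.hom ≫ DerivedCategory.Q.map φ :=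
  (congr_arg (fun x => x ≫ m'.compareQ.hom) (totFunctor_map_hom h)).trans
    ((DerivedCategory.Q.map_comp _ _).symm.trans
      ((congr_arg DerivedCategory.Q.map h.totEMap_comp_compare).trans
        (DerivedCategory.Q.map_comp _ _)))

lemma commShiftIso_comp_compareQ (n : ℤ) :
    ((totFunctor t).commShiftIso n).hom.app K ≫ m.compareQ.hom⟦n⟧' =
      (m.shift n).compareQ.hom ≫ (DerivedCategory.Q.commShiftIso n).hom.app E := by
  change (DerivedCategory.Q.map ((StrictComplex.mk K).totShift n) ≫
    (DerivedCategory.Q.commShiftIso n).hom.app (StrictComplex.mk K).totE) ≫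
      (DerivedCategory.Q.map m.compare)⟦n⟧' = DerivedCategory.Q.map (m.shift n).compare ≫
        (DerivedCategory.Q.commShiftIso n).hom.app E
  rw [Category.assoc, ← Functor.commShiftIso_hom_naturality, ← m.totShift_comp_compare,
    Functor.map_comp_assoc]

variable {m} in
/-- The comparison of the image of a cone in the derived category with the cone of the models. -/
def Over.coneCompareQ (h : Over m m' f φ) :
    (totFunctor t).obj (mappingCone h.hom) ≅ DerivedCategory.Q.obj (mappingCone φ) :=
  (totFunctor t).mapIso (asIso h.coneDesc) ≪≫ h.coneModel.compareQ

variable {m} in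
/-- The functor `totFunctor` maps cones of morphisms of models to cones. -/
def Over.mapTriangleIso (h : Over m m' f φ) :
    (totFunctor t).mapTriangle.obj (mappingCone.triangle h.hom) ≅
      DerivedCategory.Q.mapTriangle.obj (mappingCone.triangle φ) :=
  Triangle.isoMk _ _ m.compareQ m'.compareQ h.coneCompareQ h.map_comp_compareQ
    (by
      change (totFunctor t).map (mappingCone.inr h.hom) ≫ (totFunctor t).map h.coneDesc ≫
        h.coneModel.compareQ.hom = m'.compareQ.hom ≫ DerivedCategory.Q.map (mappingCone.inr φ)
      rw [← Functor.map_comp_assoc, h.inr_coneDesc]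
      exact h.over_inr.map_comp_compareQ)
    (by
      have e := h.over_mor₃.map_comp_compareQ
      change ((totFunctor t).map (mappingCone.triangle h.hom).mor₃ ≫
        ((totFunctor t).commShiftIso (1 : ℤ)).hom.app K) ≫ m.compareQ.hom⟦(1 : ℤ)⟧' =
          ((totFunctor t).map h.coneDesc ≫ h.coneModel.compareQ.hom) ≫
            DerivedCategory.Q.map (mappingCone.triangle φ).mor₃ ≫
              (DerivedCategory.Q.commShiftIso (1 : ℤ)).hom.app E
      have e₁ : (totFunctor t).map h.coneDesc ≫ (totFunctor t).map h.over_mor₃.hom =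
          (totFunctor t).map (mappingCone.triangle h.hom).mor₃ :=
        ((totFunctor t).map_comp _ _).symm.trans (congr_arg (totFunctor t).map h.coneDesc_mor₃)
      refine (Category.assoc _ _ _).trans ((congr_arg (fun x => _ ≫ x)
        (m.commShiftIso_comp_compareQ 1)).trans ?_)
      refine (congr_arg (fun x => x ≫ _) e₁.symm).trans ((Category.assoc _ _ _).trans
        -- The connecting morphism of the cone is rewritten as `coneDesc` followed by the projection
        -- of the decorated cone. This projection is a morphism to the shifted model, and its
        -- compatibility with the comparisons is `e`.
        (Eq.trans ?_ (Category.assoc _ _ _).symm))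
      refine congr_arg (fun x => (totFunctor t).map h.coneDesc ≫ x) ?_
      refine (Category.assoc _ _ _).symm.trans ?_
      exact (congr_arg (fun x => x ≫ (DerivedCategory.Q.commShiftIso (1 : ℤ)).hom.app E)
        e).trans (Category.assoc _ _ _))

variable {m} in
lemma Over.mapTriangle_distinguished (h : Over m m' f φ) :
    (totFunctor t).mapTriangle.obj (mappingCone.triangle h.hom) ∈
      distTriang (DerivedCategory A) :=
  isomorphic_distinguished _ (DerivedCategory.mappingCone_triangle_distinguished φ) _
    h.mapTriangleIso

end Model

end

variable [HasDerivedCategory.{w} A] [HasDerivedCategory.{w'} (Tilt t)]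

instance : Localization.Lifting DerivedCategory.Q
    (HomologicalComplex.quasiIso (Tilt t) (ComplexShape.up ℤ)) (StrictComplex.totFunctor t)
    (phiTot t) := ⟨phiTotFac t⟩

instance : (phiTot t).CommShift ℤ :=
  Functor.commShiftOfLocalization DerivedCategory.Q
    (HomologicalComplex.quasiIso (Tilt t) (ComplexShape.up ℤ)) ℤ (StrictComplex.totFunctor t)
    (phiTot t)

instance : NatTrans.CommShift (phiTotFac t).hom ℤ :=
  NatTrans.commShift_iso_hom_of_localization DerivedCategory.Q
    (HomologicalComplex.quasiIso (Tilt t) (ComplexShape.up ℤ)) ℤ (StrictComplex.totFunctor t)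
    (phiTot t)

/-- Up to isomorphism the triangle is the cone of a strict morphism, and its image is the cone of
the total morphism by `Model.Over.mapTriangleIso`. -/
instance : (phiTot t).IsTriangulated where
  map_distinguished T hT := by
    obtain ⟨X, Y, g, ⟨e⟩⟩ := exists_iso_Q_mapTriangle_incl T hT
    exact isomorphic_distinguished _ (StrictComplex.over_totEMap g).mapTriangle_distinguished _
      ((phiTot t).mapTriangle.mapIso e ≪≫
        (Functor.mapTriangleCompIso DerivedCategory.Q (phiTot t)).symm.app _ ≪≫
        (Functor.mapTriangleIso (phiTotFac t)).app _)

lemma exists_iso_Q_obj (X : DerivedCategory (Tilt t)) :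
    ∃ K : StrictComplex t, Nonempty (X ≅ DerivedCategory.Q.obj K.K) ∧
      Nonempty ((phiTot t).obj X ≅ DerivedCategory.Q.obj K.totE) := by
  let e := DerivedCategory.Q.objObjPreimageIso X
  exact ⟨⟨DerivedCategory.Q.objPreimage X⟩, ⟨e.symm⟩,
    ⟨(phiTot t).mapIso e.symm ≪≫ (phiTotFac t).app _⟩⟩

/-- Reflection of boundedness matters as much as preservation: it makes the restricted functors
essentially surjective. -/
lemma minus_phiTot_iff (X : DerivedCategory (Tilt t)) :
    DerivedCategory.TStructure.t.minus ((phiTot t).obj X) ↔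
      DerivedCategory.TStructure.t.minus X := by
  obtain ⟨K, ⟨e⟩, ⟨e'⟩⟩ := exists_iso_Q_obj X
  refine (ObjectProperty.prop_iff_of_iso _ e').trans
    (Iff.trans ?_ (ObjectProperty.prop_iff_of_iso _ e).symm)
  constructor
  · rintro ⟨n, h⟩
    exact ⟨n, (DerivedCategory.isLE_Q_obj_iff _ _).2
      (isLE_of_totE K n ((DerivedCategory.isLE_Q_obj_iff _ _).1 h))⟩
  · rintro ⟨n, h⟩
    exact ⟨n + 1, (DerivedCategory.isLE_Q_obj_iff _ _).2
      (isLE_totE K n ((DerivedCategory.isLE_Q_obj_iff _ _).1 h))⟩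

lemma plus_phiTot_iff (X : DerivedCategory (Tilt t)) :
    DerivedCategory.TStructure.t.plus ((phiTot t).obj X) ↔
      DerivedCategory.TStructure.t.plus X := by
  obtain ⟨K, ⟨e⟩, ⟨e'⟩⟩ := exists_iso_Q_obj X
  refine (ObjectProperty.prop_iff_of_iso _ e').trans
    (Iff.trans ?_ (ObjectProperty.prop_iff_of_iso _ e).symm)
  constructor
  · rintro ⟨n, h⟩
    exact ⟨n - 1, (DerivedCategory.isGE_Q_obj_iff _ _).2
      (isGE_of_totE K n ((DerivedCategory.isGE_Q_obj_iff _ _).1 h))⟩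
  · rintro ⟨n, h⟩
    exact ⟨n, (DerivedCategory.isGE_Q_obj_iff _ _).2
      (isGE_totE K n ((DerivedCategory.isGE_Q_obj_iff _ _).1 h))⟩

lemma bounded_phiTot_iff (X : DerivedCategory (Tilt t)) :
    DerivedCategory.TStructure.t.bounded ((phiTot t).obj X) ↔
      DerivedCategory.TStructure.t.bounded X :=
  and_congr (plus_phiTot_iff X) (minus_phiTot_iff X)

end HRS

end

/-! ### Resolutions by complexes with torsion-free or torsion terms -/

noncomputable section

namespace HRS

universe w w' v u

open CochainComplex CochainComplex.HomComplex

section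

variable {C : Type u} [Category.{v} C] [Abelian C]

lemma leftShift_ofHom_v {K L : CochainComplex C ℤ} (f : K ⟶ L) (n : ℤ) :
    ((Cochain.ofHom f).leftShift 1 1 (zero_add 1)).v n (n + 1) rfl = -f.f (n + 1) := by
  rw [Cochain.leftShift_v _ 1 1 (zero_add 1) n (n + 1) rfl (n + 1) (by lia)]
  simp only [Cochain.ofHom_v]
  rw [show Int.negOnePow (1 * 1 + 1 * (1 - 1) / 2) = -1 from rfl, Units.neg_smul, one_smul]
  exact congr_arg Neg.neg (Category.id_comp _)

/-- The morphism `K⟦1⟧ ⟶ mappingCone g` attached to a sequence `K ⟶ L ⟶ M` with `g : L ⟶ M`. -/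
def shiftToMappingCone (S : ShortComplex (CochainComplex C ℤ)) :
    S.X₁⟦(1 : ℤ)⟧ ⟶ mappingCone S.g :=
  mappingCone.lift S.g (Cocycle.leftShift (Cocycle.ofHom S.f) 1 1 (zero_add 1)) 0 (by
    rw [δ_zero, zero_add]
    ext p q h
    obtain rfl : p + 1 = q := h
    have hw : S.f.f (p + 1) ≫ S.g.f (p + 1) = 0 :=
      congr_arg (fun φ => HomologicalComplex.Hom.f φ (p + 1)) S.zero
    rw [Cochain.comp_zero_cochain_v, Cochain.ofHom_v]
    refine (congr_arg (fun x => x ≫ S.g.f (p + 1)) (leftShift_ofHom_v S.f p)).trans ?_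
    exact (Preadditive.neg_comp _ _).trans ((congr_arg Neg.neg hw).trans neg_zero))

lemma shiftToMappingCone_f_snd (S : ShortComplex (CochainComplex C ℤ)) (n : ℤ) :
    (shiftToMappingCone S).f n ≫ (mappingCone.snd S.g).v n n (add_zero n) = 0 :=
  mappingCone.lift_f_snd_v _ _ _ _ _ _ _

lemma shiftToMappingCone_f_fst (S : ShortComplex (CochainComplex C ℤ)) (n : ℤ) :
    (shiftToMappingCone S).f n ≫ (mappingCone.fst S.g).1.v n (n + 1) rfl = -S.f.f (n + 1) :=
  (mappingCone.lift_f_fst_v _ _ _ _ _ _ _).trans (leftShift_ofHom_v S.f n)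

lemma shiftToMappingCone_f (S : ShortComplex (CochainComplex C ℤ)) (n : ℤ) :
    (shiftToMappingCone S).f n = -S.f.f (n + 1) ≫ (mappingCone.inl S.g).v (n + 1) n (by lia) :=
  mappingCone.ext_to _ n (n + 1) rfl
    ((shiftToMappingCone_f_fst S n).trans (by simp))
    ((shiftToMappingCone_f_snd S n).trans (by simp; rfl))

lemma shortExact_f {S : ShortComplex (CochainComplex C ℤ)} (hS : S.ShortExact) (n : ℤ) :
    (ShortComplex.mk (S.f.f n) (S.g.f n)
      (congr_arg (fun φ => HomologicalComplex.Hom.f φ n) S.zero)).ShortExact :=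
  hS.map_of_exact (HomologicalComplex.eval C (ComplexShape.up ℤ) n)

lemma mono_shiftToMappingCone_f {S : ShortComplex (CochainComplex C ℤ)} (hS : S.ShortExact)
    (n : ℤ) : Mono ((shiftToMappingCone S).f n) := by
  have := (shortExact_f hS (n + 1)).mono_f
  dsimp at this
  have h : Mono ((shiftToMappingCone S).f n ≫ (mappingCone.fst S.g).1.v n (n + 1) rfl) := by
    rw [shiftToMappingCone_f_fst]
    exact inferInstanceAs (Mono (-S.f.f (n + 1)))
  exact mono_of_mono _ ((mappingCone.fst S.g).1.v n (n + 1) rfl)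

/-- The cone of a monomorphism is quasi-isomorphic to its cokernel. -/
lemma quasiIso_of_acyclic_cokernel {S : ShortComplex (CochainComplex C ℤ)} (hS : S.ShortExact)
    (h : S.X₃.Acyclic) : QuasiIso S.f := by
  rw [quasiIso_iff_acyclic_mappingCone]
  have := mappingCone.quasiIso_descShortComplex hS
  exact fun n => (exactAt_iff_of_quasiIsoAt (mappingCone.descShortComplex S) n).2 (h n)

/-- The counterpart, for the kernel of an epimorphism, of the quasi-isomorphism from a cone to a
cokernel. The map is a monomorphism, so it suffices that its cokernel is acyclic, which is a diagram
chase. -/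
lemma quasiIso_shiftToMappingCone {S : ShortComplex (CochainComplex C ℤ)} (hS : S.ShortExact) :
    QuasiIso (shiftToMappingCone S) := by
  have : Mono (shiftToMappingCone S) :=
    have := mono_shiftToMappingCone_f hS
    HomologicalComplex.mono_of_mono_f _ this
  let W := ShortComplex.mk (shiftToMappingCone S) (cokernel.π (shiftToMappingCone S))
    (cokernel.condition _)
  have hW : W.ShortExact := ⟨ShortComplex.exact_cokernel _⟩
  refine quasiIso_of_acyclic_cokernel hW fun n => ?_
  rw [HomologicalComplex.exactAt_iff' _ (n - 1) n (n + 1) (by simp) (by simp),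
    ShortComplex.exact_iff_exact_up_to_refinements]
  intro T (x : T ⟶ W.X₃.X n) (hx : x ≫ W.X₃.d n (n + 1) = 0)
  have hWn := shortExact_f hW
  have := (hWn n).epi_g
  dsimp at this
  obtain ⟨T₁, a, _, y, hy⟩ := surjective_up_to_refinements_of_epi (W.g.f n) x
  -- The lift `y` of the cocycle has components `u` in `S.X₂` (degree `n + 1`) and `v` in `S.X₃`
  -- (degree `n`), and `v` lifts further to `c` in `S.X₂`.
  obtain ⟨u, v, huv⟩ := mappingCone.decomp_to S.g y (n + 1) rfl
  have := (shortExact_f hS n).epi_g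
  dsimp at this
  obtain ⟨T₂, b, _, c, hc⟩ := surjective_up_to_refinements_of_epi (S.g.f n) v
  have h1 : (y ≫ (mappingCone S.g).d n (n + 1)) ≫ W.g.f (n + 1) = 0 := by
    rw [Category.assoc]
    refine (y ≫= (W.g.comm n (n + 1)).symm).trans ?_
    rw [← Category.assoc, ← hy, Category.assoc, hx, comp_zero]
  obtain ⟨T₃, p, _, e, he⟩ := (hWn (n + 1)).exact.exact_up_to_refinements _ h1
  -- The boundary of `y` comes from `S.X₁⟦1⟧`, whose second component in the cone is zero.
  have h2 : u ≫ S.g.f (n + 1) + v ≫ S.X₃.d n (n + 1) = 0 := by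
    rw [← cancel_epi p, comp_zero]
    have h := he =≫ (mappingCone.snd S.g).v (n + 1) (n + 1) (add_zero _)
    have h' : (e ≫ W.f.f (n + 1)) ≫ (mappingCone.snd S.g).v (n + 1) (n + 1) (add_zero _) = 0 := by
      rw [Category.assoc]
      exact (e ≫= shiftToMappingCone_f_snd S (n + 1)).trans comp_zero
    refine Eq.trans ?_ (h.trans h')
    simp only [Category.assoc, mappingCone.d_snd_v S.g n (n + 1) rfl, huv, Preadditive.comp_add,
      Preadditive.add_comp, mappingCone.inl_v_snd_v_assoc, mappingCone.inl_v_fst_v_assoc,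
      mappingCone.inr_f_fst_v_assoc, mappingCone.inr_f_snd_v_assoc, zero_comp,
      add_zero, zero_add]
  have h3 : (b ≫ u + c ≫ S.X₂.d n (n + 1)) ≫ S.g.f (n + 1) = 0 := by
    rw [Preadditive.add_comp, Category.assoc, Category.assoc, ← S.g.comm n (n + 1),
      ← reassoc_of% hc, ← Preadditive.comp_add, h2, comp_zero]
  obtain ⟨w, hw⟩ : ∃ w : T₂ ⟶ S.X₁.X (n + 1),
      w ≫ S.f.f (n + 1) = b ≫ u + c ≫ S.X₂.d n (n + 1) :=
    ⟨_, (shortExact_f hS (n + 1)).fIsKernel.fac (KernelFork.ofι _ h3) WalkingParallelPair.zero⟩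
  -- Subtracting the boundary of `c` removes the second component of `y`. By `h3` the first
  -- component that is left comes from `S.X₁`, so it dies in the cokernel.
  have h4 : b ≫ y = (c ≫ (mappingCone.inl S.g).v n (n - 1) (by lia)) ≫
      (mappingCone S.g).d (n - 1) n - w ≫ (shiftToMappingCone S).f n := by
    have h5 : w ≫ (shiftToMappingCone S).f n =
        -(b ≫ u + c ≫ S.X₂.d n (n + 1)) ≫ (mappingCone.inl S.g).v (n + 1) n (by lia) := by
      rw [shiftToMappingCone_f, ← hw]
      simp
    rw [h5, Category.assoc, mappingCone.inl_v_d S.g n (n - 1) (n + 1) (by lia) (by lia), huv]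
    simp only [Preadditive.comp_add, Preadditive.comp_sub, Preadditive.add_comp,
      Category.assoc, reassoc_of% hc]
    abel
  have h6 : (shiftToMappingCone S).f n ≫ W.g.f n = 0 :=
    congr_arg (fun φ => HomologicalComplex.Hom.f φ n) W.zero
  have h7 : b ≫ a ≫ x = (c ≫ (mappingCone.inl S.g).v n (n - 1) (by lia)) ≫
      W.g.f (n - 1) ≫ W.X₃.d (n - 1) n := by
    rw [W.g.comm, hy]
    refine (Category.assoc _ _ _).symm.trans ((congr_arg (fun z => z ≫ W.g.f n) h4).trans ?_)
    have h8 : (w ≫ (shiftToMappingCone S).f n) ≫ W.g.f n = 0 :=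
      (Category.assoc _ _ _).trans ((congr_arg (w ≫ ·) h6).trans comp_zero)
    exact (Preadditive.sub_comp _ _ _).trans ((congr_arg _ h8).trans
      ((sub_zero _).trans (Category.assoc _ _ _)))
  exact ⟨T₂, b ≫ a, epi_comp _ _,
    (c ≫ (mappingCone.inl S.g).v n (n - 1) (by lia)) ≫ W.g.f (n - 1),
    (Category.assoc _ _ _).trans (h7.trans (Category.assoc _ _ _).symm)⟩

end

variable {A : Type u} [Category.{v} A] [Abelian A] (t : TorsionPair A)

lemma TorsionPair.free_mappingCone {K L : CochainComplex A ℤ} (f : K ⟶ L)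
    (hK : ∀ n, t.free (K.X n)) (hL : ∀ n, t.free (L.X n)) (n : ℤ) :
    t.free ((mappingCone f).X n) :=
  t.free_of_forall fun T hT g => mappingCone.ext_to f n (n + 1) rfl
    (by rw [zero_comp]; exact t.hom_eq_zero hT (hK _) _)
    (by rw [zero_comp]; exact t.hom_eq_zero hT (hL _) _)

lemma TorsionPair.torsion_mappingCone {K L : CochainComplex A ℤ} (f : K ⟶ L)
    (hK : ∀ n, t.torsion (K.X n)) (hL : ∀ n, t.torsion (L.X n)) (n : ℤ) :
    t.torsion ((mappingCone f).X n) :=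
  t.torsion_of_forall fun F hF g => mappingCone.ext_from f (n + 1) n rfl
    (by rw [comp_zero]; exact t.hom_eq_zero (hK _) hF _)
    (by rw [comp_zero]; exact t.hom_eq_zero (hL _) hF _)

variable {t}

/-- Any complex is a termwise quotient of a complex with torsion-free terms. -/
lemma TorsionPair.IsCotilting.exists_epi (ht : t.IsCotilting) (E : CochainComplex A ℤ) :
    ∃ (C : CochainComplex A ℤ) (p : C ⟶ E), Epi p ∧ ∀ n, t.free (C.X n) := by
  choose F p hF hp using fun n => ht (E.X n)
  -- The cone of `𝟙 G` has the first summand `G (n+1)` in degree `n`, hence the index shift. It maps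
  -- onto `E n` by `p`, and the boundary of this cochain of degree `-1` prescribes the map on the
  -- second summand.
  let G : CochainComplex A ℤ := { X := fun n => F (n - 1), d := fun _ _ => 0 }
  have hG : ∀ n, t.free (G.X n) := fun n => hF _
  let α : Cochain G E (-1) := Cochain.mk fun i j h =>
    p (i - 1) ≫ (E.XIsoOfEq (by lia : i - 1 = j)).hom
  let φ : mappingCone (𝟙 G) ⟶ E := mappingCone.desc (𝟙 G) α
    (Cocycle.homOf (Cocycle.mk (δ (-1) 0 α) 1 rfl (δ_δ _ _ _ _)))
    (by rw [Category.id_comp, Cocycle.cochain_ofHom_homOf_eq_coe]; rfl)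
  refine ⟨_, φ, ?_, t.free_mappingCone _ hG hG⟩
  have hφ : ∀ n, Epi (φ.f n) := fun n => by
    have := hp (n + 1 - 1)
    have h : Epi ((mappingCone.inl (𝟙 G)).v (n + 1) n (by lia) ≫ φ.f n) := by
      rw [mappingCone.inl_v_desc_f]
      exact inferInstanceAs (Epi (p (n + 1 - 1) ≫ (E.XIsoOfEq (by lia : n + 1 - 1 = n)).hom))
    exact @epi_of_epi _ _ _ _ _ _ _ h
  exact HomologicalComplex.epi_of_epi_f _ hφ

/-- Any complex is a termwise subobject of a complex with torsion terms. -/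
lemma TorsionPair.IsTilting.exists_mono (ht : t.IsTilting) (E : CochainComplex A ℤ) :
    ∃ (C : CochainComplex A ℤ) (i : E ⟶ C), Mono i ∧ ∀ n, t.torsion (C.X n) := by
  choose T i hT hi using fun n => ht (E.X n)
  let G : CochainComplex A ℤ := { X := T, d := fun _ _ => 0 }
  let β : Cochain E G 0 := Cochain.ofHoms i
  -- Here `i` is the component in the second summand, which needs no index shift; minus its boundary
  -- is the first component, as a chain map requires.
  let φ : E ⟶ mappingCone (𝟙 G) := mappingCone.lift (𝟙 G)
    (-Cocycle.mk (δ 0 1 β) 2 rfl (δ_δ _ _ _ _)) β (by simp)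
  refine ⟨_, φ, ?_, t.torsion_mappingCone _ hT hT⟩
  have hφ : ∀ n, Mono (φ.f n) := fun n => by
    have := hi n
    have h : Mono (φ.f n ≫ (mappingCone.snd (𝟙 G)).v n n (add_zero n)) := by
      rw [mappingCone.lift_f_snd_v, Cochain.ofHoms_v]
      exact hi n
    exact mono_of_mono _ ((mappingCone.snd (𝟙 G)).v n n (add_zero n))
  exact HomologicalComplex.mono_of_mono_f _ hφ

/-- In the cotilting case, any complex has a termwise epimorphic resolution by a complex with
torsion-free terms. -/
lemma TorsionPair.IsCotilting.exists_resolution (ht : t.IsCotilting) (E : CochainComplex A ℤ) :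
    ∃ (E' : CochainComplex A ℤ) (q : E' ⟶ E), QuasiIso q ∧ (∀ n, Epi (q.f n)) ∧
      ∀ n, t.free (E'.X n) := by
  obtain ⟨C, p, _, hC⟩ := ht.exists_epi E
  let S := ShortComplex.mk (kernel.ι p) p (kernel.condition p)
  have hS : S.ShortExact := ⟨ShortComplex.exact_kernel p⟩
  -- The cone of the kernel inclusion resolves `E`. Its terms are torsion-free since the kernel is a
  -- subobject of `C`, so one step suffices and no boundedness is needed.
  refine ⟨_, mappingCone.descShortComplex S, mappingCone.quasiIso_descShortComplex hS,
    fun n => ?_, t.free_mappingCone _ (fun n => ?_) hC⟩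
  · have : Epi (S.g.f n) := (shortExact_f hS n).epi_g
    rw [← mappingCone.inr_f_descShortComplex_f] at this
    exact epi_of_epi ((mappingCone.inr S.f).f n) _
  · have : Mono (S.f.f n) := (shortExact_f hS n).mono_f
    exact t.free_of_mono (S.f.f n) (hC n)

/-- In the tilting case, any complex has a termwise monomorphic resolution by a complex with
torsion terms. -/
lemma TorsionPair.IsTilting.exists_resolution (ht : t.IsTilting) (E : CochainComplex A ℤ) :
    ∃ (E' : CochainComplex A ℤ) (q : E ⟶ E'), QuasiIso q ∧ (∀ n, Mono (q.f n)) ∧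
      ∀ n, t.torsion (E'.X n) := by
  -- The map to the cone starts from the shifted kernel, so the embedding is chosen for `E⟦-1⟧`. The
  -- cokernel of `i` is a quotient of torsion terms and hence torsion.
  obtain ⟨C, i, _, hC⟩ := ht.exists_mono (E⟦(-1 : ℤ)⟧)
  let S := ShortComplex.mk i (cokernel.π i) (cokernel.condition i)
  have hS : S.ShortExact := ⟨ShortComplex.exact_cokernel i⟩
  have := quasiIso_shiftToMappingCone hS
  let e : E ≅ (E⟦(-1 : ℤ)⟧)⟦(1 : ℤ)⟧ :=
    ((shiftFunctorCompIsoId (CochainComplex A ℤ) (-1 : ℤ) 1 (by lia)).app E).symm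
  refine ⟨_, e.hom ≫ shiftToMappingCone S, quasiIso_comp _ _, fun n => ?_,
    t.torsion_mappingCone _ hC fun n => ?_⟩
  · have := mono_shiftToMappingCone_f hS n
    rw [HomologicalComplex.comp_f]
    exact mono_comp _ _
  · have : Epi (S.g.f n) := (shortExact_f hS n).epi_g
    exact t.torsion_of_epi (S.g.f n) (hC n)

end HRS
end

/-! ### Full and zero decorations; change of decoration along resolutions -/

noncomputable section

namespace HRS

universe w w' v u

variable {A : Type u} [Category.{v} A] [Abelian A] {t : TorsionPair A}

open ZeroObject

/-- A torsion-free object in degree `-1`. -/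
abbrev Tilt.ofFree (F : A) (hF : t.free F) : Tilt t where
  X₁ := F
  X₀ := 0
  d := 0
  free_kernel := t.free_of_mono (kernel.ι _) hF
  torsion_cokernel := t.torsion_of_forall fun F hF f => by
    rw [← cancel_epi (cokernel.π _)]
    exact (isZero_zero A).eq_of_src _ _

/-- A torsion object in degree `0`. -/
abbrev Tilt.ofTorsion (T : A) (hT : t.torsion T) : Tilt t where
  X₁ := 0
  X₀ := T
  d := 0
  free_kernel := t.free_of_forall fun T hT f => by
    rw [← cancel_mono (kernel.ι _)]
    exact (isZero_zero A).eq_of_tgt _ _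
  torsion_cokernel := t.torsion_of_epi (cokernel.π _) hT

/-- A complex with torsion-free terms, decorated by itself. -/
abbrev freeDecoration (E : CochainComplex A ℤ) (hE : ∀ n, t.free (E.X n)) :
    Decoration (fun n => Tilt.ofFree (E.X n) (hE n)) E where
  ι n := 𝟙 (E.X n)
  σ i j h := 0
  ισ i j h := by simp
  shortExact i j h := by
    have : Epi (0 : E.X j ⟶ (0 : A)) := ⟨fun _ _ _ => (isZero_zero A).eq_of_src _ _⟩
    exact ShortComplex.ShortExact.mk' ((ShortComplex.exact_iff_epi _ rfl).2
      (inferInstanceAs (Epi (𝟙 (E.X j))))) (inferInstanceAs (Mono (𝟙 (E.X j)))) this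
  ιdσ i j h := by simp

/-- A complex with torsion terms, decorated by zero. -/
abbrev torsionDecoration (E : CochainComplex A ℤ) (hE : ∀ n, t.torsion (E.X n)) :
    Decoration (fun n => Tilt.ofTorsion (E.X (n + 1)) (hE (n + 1))) E where
  ι n := 0
  σ i j h := (E.XIsoOfEq h.symm).hom
  ισ i j h := by simp
  shortExact i j h := by
    have : Mono (0 : (0 : A) ⟶ E.X j) := ⟨fun _ _ _ => (isZero_zero A).eq_of_tgt _ _⟩
    exact ShortComplex.ShortExact.mk' ((ShortComplex.exact_iff_mono _ rfl).2
      (inferInstanceAs (Mono (E.XIsoOfEq h.symm).hom))) this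
      (inferInstanceAs (Epi (E.XIsoOfEq h.symm).hom))
  ιdσ i j h := by simp

/-- A full decoration imposes no condition, so every morphism of complexes over `A` lifts to the
tilted category. This is the source of fullness. -/
lemma over_freeDecoration {E F : CochainComplex A ℤ} (hE : ∀ n, t.free (E.X n))
    (hF : ∀ n, t.free (F.X n)) (φ : E ⟶ F) :
    Model.Over (freeDecoration E hE).model (freeDecoration F hF).model
      (fun n => ⟨φ.f n, 0, by simp⟩) φ := ⟨by simp, by simp⟩

lemma over_torsionDecoration {E F : CochainComplex A ℤ} (hE : ∀ n, t.torsion (E.X n))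
    (hF : ∀ n, t.torsion (F.X n)) (φ : E ⟶ F) :
    Model.Over (torsionDecoration E hE).model (torsionDecoration F hF).model
      (fun n => ⟨0, φ.f (n + 1), by simp⟩) φ :=
  ⟨by simp, fun i j h => by subst h; simp⟩

namespace Model

variable {K : CochainComplex (Tilt t) ℤ} {E E' : CochainComplex A ℤ} (m : Model K E)

section

variable (q : E' ⟶ E) [hq : ∀ n, Epi (q.f n)] (hE' : ∀ n, t.free (E'.X n))

/-- The pullback of a two-term complex along a termwise epimorphism of models. -/
abbrev pullbackTilt (n : ℤ) : Tilt t where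
  X₁ := pullback (q.f n) (m.ι n)
  X₀ := (K.X n).X₀
  d := pullback.snd _ _ ≫ (K.X n).d
  free_kernel := t.free_of_mono (kernel.ι _ ≫ pullback.fst _ _) (hE' n)
  torsion_cokernel := by
    -- The projection of the pullback to `(K.X n).X₁` is epi, as `q` is, so the image of the
    -- differential and its cokernel do not change.
    let p : cokernel (K.X n).d ⟶ cokernel (pullback.snd (q.f n) (m.ι n) ≫ (K.X n).d) :=
      cokernel.desc _ (cokernel.π _) (by
        rw [← cancel_epi (pullback.snd (q.f n) (m.ι n)), comp_zero, ← Category.assoc,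
          cokernel.condition])
    have : Epi (cokernel.π (K.X n).d ≫ p) := by
      rw [cokernel.π_desc]
      infer_instance
    have : Epi p := epi_of_epi (cokernel.π _) p
    exact t.torsion_of_epi p (K.X n).torsion_cokernel

/-- The pullback of a decoration along a termwise epimorphism. -/
abbrev pullbackDecoration : Decoration (m.pullbackTilt q hE') E' where
  ι n := pullback.fst _ _
  σ i j h := q.f j ≫ m.σ i j h
  ισ i j h := by rw [pullback.condition_assoc, m.ισ, comp_zero]
  shortExact i j h := by
    have := m.epi_σ i j h
    refine ShortComplex.ShortExact.mk' ?_ (inferInstanceAs (Mono (pullback.fst (q.f j) (m.ι j))))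
      (inferInstanceAs (Epi (q.f j ≫ m.σ i j h)))
    refine ShortComplex.exact_of_f_is_kernel _ (KernelFork.IsLimit.ofι' _ _ fun {T} k hk => ?_)
    have hk' : (k ≫ q.f j) ≫ m.σ i j h = 0 := (Category.assoc _ _ _).trans hk
    have hl := (m.shortExact i j h).fIsKernel.fac (KernelFork.ofι _ hk') WalkingParallelPair.zero
    exact ⟨pullback.lift k _ hl.symm, pullback.lift_fst _ _ _⟩
  ιdσ i j h := by
    rw [← q.comm_assoc, pullback.condition_assoc, m.ιdσ]

/-- The morphism `q` carries the preimage of the decoration to the decoration; if `q` is a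
quasi-isomorphism, so is the induced morphism of complexes in the tilted category. -/
lemma over_pullbackDecoration :
    Over (m.pullbackDecoration q hE').model m
      (fun n => ⟨pullback.snd (q.f n) (m.ι n), 𝟙 _, by simp⟩) q :=
  ⟨fun n => pullback.condition, by simp⟩

/-- The identity of `E'` enlarges the decoration to all of `E'`. Being an isomorphism in `A`, it
induces a quasi-isomorphism in the tilted category, though in general not an isomorphism of
complexes. -/
lemma over_freeDecoration_of_pullback :
    Over (m.pullbackDecoration q hE').model (freeDecoration E' hE').model
      (fun n => ⟨pullback.fst (q.f n) (m.ι n), 0, by simp⟩) (𝟙 E') :=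
  ⟨by simp, by simp⟩

end

/-- The map of the cokernels induced by a termwise monomorphism of models. -/
def toPushoutX₀ (q : E ⟶ E') (n : ℤ) : (K.X n).X₀ ⟶ cokernel (m.ι (n + 1) ≫ q.f (n + 1)) :=
  (m.shortExact n (n + 1) rfl).gIsCokernel.desc (CokernelCofork.ofπ
    (q.f (n + 1) ≫ cokernel.π (m.ι (n + 1) ≫ q.f (n + 1)))
    ((Category.assoc _ _ _).symm.trans (cokernel.condition _)))

lemma σ_toPushoutX₀ (q : E ⟶ E') (n : ℤ) : m.σ n (n + 1) rfl ≫ m.toPushoutX₀ q n =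
    q.f (n + 1) ≫ cokernel.π (m.ι (n + 1) ≫ q.f (n + 1)) :=
  (m.shortExact n (n + 1) rfl).gIsCokernel.fac (CokernelCofork.ofπ
    (q.f (n + 1) ≫ cokernel.π (m.ι (n + 1) ≫ q.f (n + 1)))
    ((Category.assoc _ _ _).symm.trans (cokernel.condition _))) WalkingParallelPair.one

section

variable (q : E ⟶ E') [hq : ∀ n, Mono (q.f n)] (hE' : ∀ n, t.torsion (E'.X n))

/-- Since `q` is mono, a boundary that lies in the image of the decoration in `E'` already lies in
the decoration of `E`. So the kernel of the new differential embeds in the old torsion-free one. -/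
lemma comp_d_eq_zero_of_comp_cokernel_π_eq_zero {T : A} (n : ℤ) (k : T ⟶ (K.X n).X₁)
    (h : k ≫ m.ι n ≫ q.f n ≫ E'.d n (n + 1) ≫ cokernel.π (m.ι (n + 1) ≫ q.f (n + 1)) = 0) :
    k ≫ (K.X n).d = 0 := by
  rw [q.comm_assoc] at h
  have hk := Abelian.monoIsKernelOfCokernel _ (cokernelIsCokernel (m.ι (n + 1) ≫ q.f (n + 1)))
  have h' : (k ≫ m.ι n ≫ E.d n (n + 1) ≫ q.f (n + 1)) ≫
      cokernel.π (m.ι (n + 1) ≫ q.f (n + 1)) = 0 := by simpa using h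
  obtain ⟨z, hz⟩ : ∃ z : T ⟶ (K.X (n + 1)).X₁, z ≫ m.ι (n + 1) ≫ q.f (n + 1) =
      k ≫ m.ι n ≫ E.d n (n + 1) ≫ q.f (n + 1) :=
    ⟨hk.lift (KernelFork.ofι _ h'), hk.fac (KernelFork.ofι _ h') WalkingParallelPair.zero⟩
  have hz' : z ≫ m.ι (n + 1) = k ≫ m.ι n ≫ E.d n (n + 1) := by
    rw [← cancel_mono (q.f (n + 1))]
    simpa using hz
  rw [← m.ιdσ n (n + 1) rfl]
  have := hz' =≫ m.σ n (n + 1) rfl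
  rw [Category.assoc, m.ισ, comp_zero] at this
  simpa using this.symm

/-- The pushout of a two-term complex along a termwise monomorphism of models. -/
abbrev pushoutTilt (n : ℤ) : Tilt t where
  X₁ := (K.X n).X₁
  X₀ := cokernel (m.ι (n + 1) ≫ q.f (n + 1))
  d := m.ι n ≫ q.f n ≫ E'.d n (n + 1) ≫ cokernel.π _
  free_kernel := by
    let j : kernel (m.ι n ≫ q.f n ≫ E'.d n (n + 1) ≫
        cokernel.π (m.ι (n + 1) ≫ q.f (n + 1))) ⟶ kernel (K.X n).d :=
      kernel.lift _ (kernel.ι _) (m.comp_d_eq_zero_of_comp_cokernel_π_eq_zero q n _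
        (kernel.condition _))
    have : Mono (j ≫ kernel.ι _) := by
      rw [kernel.lift_ι]
      infer_instance
    have : Mono j := mono_of_mono j (kernel.ι _)
    exact t.free_of_mono j (K.X n).free_kernel
  torsion_cokernel := t.torsion_of_epi (cokernel.π _ ≫ cokernel.π _) (hE' (n + 1))

/-- The pushout of a decoration along a termwise monomorphism. -/
abbrev pushoutDecoration : Decoration (m.pushoutTilt q hE') E' where
  ι n := m.ι n ≫ q.f n
  σ i j h := (E'.XIsoOfEq h.symm).hom ≫ cokernel.π _
  ισ i j h := by
    subst h
    simp
  shortExact i j h := by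
    subst h
    have : Mono (m.ι (i + 1) ≫ q.f (i + 1)) := mono_comp _ _
    have hS : (ShortComplex.mk _ _ (cokernel.condition (m.ι (i + 1) ≫ q.f (i + 1)))).ShortExact :=
      ⟨ShortComplex.exact_cokernel _⟩
    convert hS using 2
    simp
  ιdσ i j h := by
    subst h
    simp

lemma over_pushoutDecoration :
    Over m (m.pushoutDecoration q hE').model
      (fun n => ⟨𝟙 _, m.toPushoutX₀ q n, by
        rw [← m.ιdσ n (n + 1) rfl, Category.assoc, Category.assoc, σ_toPushoutX₀,
          Category.id_comp]
        change m.ι n ≫ q.f n ≫ E'.d n (n + 1) ≫ cokernel.π _ = _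
        rw [q.comm_assoc]⟩) q :=
  ⟨fun n => (Category.id_comp _).symm, fun i j h => by
    subst h
    rw [σ_toPushoutX₀]
    simp⟩

/-- The identity of `E'` enlarges the zero decoration to the image of the decoration of `E`, and is
again a quasi-isomorphism for the tilted category. -/
lemma over_pushoutDecoration_of_torsionDecoration :
    Over (torsionDecoration E' hE').model (m.pushoutDecoration q hE').model
      (fun n => ⟨0, cokernel.π _, by simp⟩) (𝟙 E') :=
  ⟨fun _ => zero_comp.trans zero_comp.symm, fun _ _ _ => Category.id_comp _⟩

end

end Model

end HRS

end

/-! ### The equivalence on unbounded derived categories -/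

noncomputable section

namespace HRS

universe w w' v u

variable {A : Type u} [Category.{v} A] [Abelian A] {t : TorsionPair A}

open Pretriangulated

section

variable {C : Type u} [Category.{v} C] [Abelian C] [HasDerivedCategory.{w} C]

open ZeroObject in
lemma isZero_Q_obj_iff (K : CochainComplex C ℤ) :
    IsZero (DerivedCategory.Q.obj K) ↔ K.Acyclic := by
  have h0 : IsZero (0 : CochainComplex C ℤ) := isZero_zero _
  have h1 : IsZero (DerivedCategory.Q.obj (0 : CochainComplex C ℤ)) :=
    DerivedCategory.Q.map_isZero h0
  have h2 : (0 : CochainComplex C ℤ).Acyclic := fun n =>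
    ShortComplex.exact_of_isZero_X₂ _
      ((HomologicalComplex.eval C (ComplexShape.up ℤ) n).map_isZero h0)
  -- Being zero is phrased as invertibility of the map to the zero complex, which the derived
  -- category translates into a quasi-isomorphism.
  have h3 : IsZero (DerivedCategory.Q.obj K) ↔
      IsIso (DerivedCategory.Q.map (0 : K ⟶ 0)) :=
    ⟨fun h => h.isIso h1 _, fun h => h1.of_iso (asIso (DerivedCategory.Q.map (0 : K ⟶ 0)))⟩
  rw [h3, DerivedCategory.isIso_Q_map_iff_quasiIso]
  exact ⟨fun h n => (exactAt_iff_of_quasiIsoAt (0 : K ⟶ 0) n).2 (h2 n),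
    fun h => ⟨fun n => (quasiIsoAt_iff_exactAt _ n (h n)).2 (h2 n)⟩⟩

end

section

variable {C D : Type*} [Category* C] [Category* D] [HasShift C ℤ] [HasShift D ℤ]
  [HasZeroObject C] [HasZeroObject D] [Preadditive C] [Preadditive D]
  [∀ n : ℤ, (shiftFunctor C n).Additive] [∀ n : ℤ, (shiftFunctor D n).Additive]
  [Pretriangulated C] [Pretriangulated D] (F : C ⥤ D) [F.CommShift ℤ] [F.IsTriangulated]

lemma isIso_of_isIso_map (hF : ∀ X, IsZero (F.obj X) → IsZero X) {X Y : C} (f : X ⟶ Y)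
    [IsIso (F.map f)] : IsIso f := by
  obtain ⟨Z, g, h, hT⟩ := distinguished_cocone_triangle f
  refine (Triangle.isZero₃_iff_isIso₁ _ hT).1 (hF _ ?_)
  exact (Triangle.isZero₃_iff_isIso₁ _ (F.map_distinguished _ hT)).2 (inferInstanceAs
    (IsIso (F.map f)))

/-- If `F.map f = 0`, then the next map `g` of a triangle on `f` becomes a split monomorphism.
Fullness lifts a retraction to some `r`, the composite `g ≫ r` is invertible because `F` detects
isomorphisms, and `f ≫ g = 0` gives `f = 0`. -/
lemma faithful_of_full [F.Full] (hF : ∀ X, IsZero (F.obj X) → IsZero X) : F.Faithful := by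
  suffices ∀ {X Y : C} (f : X ⟶ Y), F.map f = 0 → f = 0 from
    ⟨fun {X Y f g} h => sub_eq_zero.1 (this _ (by rw [F.map_sub, h, sub_self]))⟩
  intro X Y f hf
  obtain ⟨Z, g, h, hT⟩ := distinguished_cocone_triangle f
  have hT' := F.map_distinguished _ hT
  obtain ⟨r, hr⟩ := Triangle.yoneda_exact₂ _ hT' (𝟙 (F.obj Y))
    ((Category.comp_id _).trans hf)
  obtain ⟨r, rfl⟩ : ∃ r' : Z ⟶ Y, F.map r' = r := F.map_surjective r
  have hi : IsIso (F.map (g ≫ r)) := by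
    have : F.map (g ≫ r) = 𝟙 _ := (F.map_comp _ _).trans hr.symm
    rw [this]
    infer_instance
  have := isIso_of_isIso_map F hF (g ≫ r)
  have h0 : f ≫ g = 0 := comp_distTriang_mor_zero₁₂ _ hT
  rw [← cancel_mono (g ≫ r), reassoc_of% h0, zero_comp, zero_comp]

end

lemma Model.Over.isIso_Q_map [HasDerivedCategory.{w'} (Tilt t)]
    {K L : CochainComplex (Tilt t) ℤ} {E F : CochainComplex A ℤ} {m : Model K E} {m' : Model L F}
    {f : ∀ n, StrictHom (K.X n) (L.X n)} {φ : E ⟶ F} (h : Over m m' f φ) [QuasiIso φ] :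
    IsIso (DerivedCategory.Q.map h.hom) :=
  (DerivedCategory.isIso_Q_map_iff_quasiIso _ _).2 (h.quasiIso_iff.1 inferInstance)

variable [HasDerivedCategory.{w} A] [HasDerivedCategory.{w'} (Tilt t)]

lemma isZero_of_isZero_phiTot (X : DerivedCategory (Tilt t)) (h : IsZero ((phiTot t).obj X)) :
    IsZero X := by
  obtain ⟨K, ⟨e⟩, ⟨e'⟩⟩ := exists_iso_Q_obj X
  exact (((isZero_Q_obj_iff _).2
    (K.totModel.acyclic_iff.1 ((isZero_Q_obj_iff _).1 (h.of_iso e'.symm)))).of_iso e)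

namespace Model

variable {K L : CochainComplex (Tilt t) ℤ} {E F : CochainComplex A ℤ} (m : Model K E)
  {m' : Model L F} {f : ∀ n, StrictHom (K.X n) (L.X n)} {φ : E ⟶ F}

/-- The comparison of the image of a complex under `phiTot` with a model. -/
def phiTotIso : (phiTot t).obj (DerivedCategory.Q.obj K) ≅ DerivedCategory.Q.obj E :=
  (phiTotFac t).app K ≪≫ m.compareQ

variable {m}

lemma Over.map_comp_phiTotIso (h : Over m m' f φ) :
    (phiTot t).map (DerivedCategory.Q.map h.hom) ≫ m'.phiTotIso.hom =
      m.phiTotIso.hom ≫ DerivedCategory.Q.map φ := by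
  have e : (phiTot t).map (DerivedCategory.Q.map h.hom) ≫ (phiTotFac t).hom.app L =
    (phiTotFac t).hom.app K ≫ (StrictComplex.totFunctor t).map h.hom :=
      (phiTotFac t).hom.naturality h.hom
  simp only [phiTotIso, Iso.trans_hom, Iso.app_hom, Category.assoc]
  rw [reassoc_of% e, h.map_comp_compareQ]

end Model

/-- A resolution of the total complex gets the pulled-back decoration. It is joined to the given
complex by the resolution and to the full decoration by the identity, and both become invertible in
the derived category. -/
lemma TorsionPair.IsCotilting.exists_iso (ht : t.IsCotilting) (X : DerivedCategory (Tilt t)) :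
    ∃ (E : CochainComplex A ℤ) (hE : ∀ n, t.free (E.X n)),
      Nonempty (X ≅ DerivedCategory.Q.obj (freeDecoration E hE).complex) := by
  obtain ⟨K, ⟨e⟩, -⟩ := exists_iso_Q_obj X
  obtain ⟨E, q, _, _, hE⟩ := ht.exists_resolution K.totE
  have h₁ := (K.totModel.over_pullbackDecoration q hE).isIso_Q_map
  have h₂ := (K.totModel.over_freeDecoration_of_pullback q hE).isIso_Q_map
  exact ⟨E, hE, ⟨e ≪≫ (@asIso _ _ _ _ _ h₁).symm ≪≫ @asIso _ _ _ _ _ h₂⟩⟩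

/-- The dual zigzag: the image of the decoration in the resolution receives a map from the given
complex and one from the zero decoration. -/
lemma TorsionPair.IsTilting.exists_iso (ht : t.IsTilting) (X : DerivedCategory (Tilt t)) :
    ∃ (E : CochainComplex A ℤ) (hE : ∀ n, t.torsion (E.X n)),
      Nonempty (X ≅ DerivedCategory.Q.obj (torsionDecoration E hE).complex) := by
  obtain ⟨K, ⟨e⟩, -⟩ := exists_iso_Q_obj X
  obtain ⟨E, q, _, _, hE⟩ := ht.exists_resolution K.totE
  have h₁ := (K.totModel.over_pushoutDecoration q hE).isIso_Q_map
  have h₂ := (K.totModel.over_pushoutDecoration_of_torsionDecoration q hE).isIso_Q_map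
  exact ⟨E, hE, ⟨e ≪≫ @asIso _ _ _ _ _ h₁ ≪≫ (@asIso _ _ _ _ _ h₂).symm⟩⟩

/-- Surjectivity on morphisms is invariant under isomorphisms of objects. -/
lemma map_surjective_of_iso {C D : Type*} [Category* C] [Category* D] (F : C ⥤ D)
    {X Y X' Y' : C} (e : X ≅ X') (e' : Y ≅ Y')
    (h : Function.Surjective (F.map : (X' ⟶ Y') → _)) :
    Function.Surjective (F.map : (X ⟶ Y) → _) := fun f => by
  obtain ⟨g, hg⟩ := h (F.map e.inv ≫ f ≫ F.map e'.hom)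
  exact ⟨e.hom ≫ g ≫ e'.inv, by simp [hg, ← F.map_comp, ← F.map_comp_assoc]⟩

lemma TorsionPair.IsCotilting.full_phiTot (ht : t.IsCotilting) : (phiTot t).Full := by
  refine ⟨fun {X Y} => ?_⟩
  obtain ⟨E, hE, ⟨e⟩⟩ := ht.exists_iso X
  obtain ⟨F, hF, ⟨e'⟩⟩ := ht.exists_iso Y
  refine map_surjective_of_iso _ e e' fun f => ?_
  set m := (freeDecoration E hE).model
  set m' := (freeDecoration F hF).model
  obtain ⟨Z, s, hs, g, hf⟩ := DerivedCategory.right_fac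
    (m.phiTotIso.inv ≫ f ≫ m'.phiTotIso.hom)
  -- The apex of the fraction is replaced by a complex with torsion-free terms; then numerator and
  -- denominator both lift to the tilted category.
  obtain ⟨Z', q, hq, _, hZ'⟩ := ht.exists_resolution Z
  have : QuasiIso s := (DerivedCategory.isIso_Q_map_iff_quasiIso _ _).1 hs
  have : QuasiIso (q ≫ s) := quasiIso_comp _ _
  have hs' := over_freeDecoration hZ' hE (q ≫ s)
  have hg := over_freeDecoration hZ' hF (q ≫ g)
  have := hs'.isIso_Q_map
  refine ⟨inv (DerivedCategory.Q.map hs'.hom) ≫ DerivedCategory.Q.map hg.hom, ?_⟩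
  rw [Functor.map_comp, Functor.map_inv, IsIso.inv_comp_eq, ← cancel_mono m'.phiTotIso.hom,
    Category.assoc, hg.map_comp_phiTotIso]
  rw [Iso.inv_comp_eq] at hf
  rw [hf, reassoc_of% hs'.map_comp_phiTotIso]
  simp

lemma TorsionPair.IsTilting.full_phiTot (ht : t.IsTilting) : (phiTot t).Full := by
  refine ⟨fun {X Y} => ?_⟩
  obtain ⟨E, hE, ⟨e⟩⟩ := ht.exists_iso X
  obtain ⟨F, hF, ⟨e'⟩⟩ := ht.exists_iso Y
  refine map_surjective_of_iso _ e e' fun f => ?_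
  set m := (torsionDecoration E hE).model
  set m' := (torsionDecoration F hF).model
  obtain ⟨Z, g, s, hs, hf⟩ := DerivedCategory.left_fac
    (m.phiTotIso.inv ≫ f ≫ m'.phiTotIso.hom)
  -- Here the fraction has its denominator on the target side, because torsion resolutions are maps
  -- out of `Z`.
  obtain ⟨Z', q, hq, _, hZ'⟩ := ht.exists_resolution Z
  have : QuasiIso s := (DerivedCategory.isIso_Q_map_iff_quasiIso _ _).1 hs
  have : QuasiIso (s ≫ q) := quasiIso_comp _ _
  have hs' := over_torsionDecoration hF hZ' (s ≫ q)
  have hg := over_torsionDecoration hE hZ' (g ≫ q)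
  have := hs'.isIso_Q_map
  refine ⟨DerivedCategory.Q.map hg.hom ≫ inv (DerivedCategory.Q.map hs'.hom), ?_⟩
  rw [Functor.map_comp, Functor.map_inv, IsIso.comp_inv_eq,
    ← cancel_mono (torsionDecoration Z' hZ').model.phiTotIso.hom,
    Category.assoc, hg.map_comp_phiTotIso, hs'.map_comp_phiTotIso]
  rw [Iso.inv_comp_eq] at hf
  rw [reassoc_of% hf]
  simp [m]

lemma TorsionPair.IsCotilting.isEquivalence_phiTot (ht : t.IsCotilting) :
    (phiTot t).IsEquivalence where
  full := ht.full_phiTot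
  faithful :=
    have := ht.full_phiTot
    faithful_of_full _ isZero_of_isZero_phiTot
  essSurj := ⟨fun X => by
    obtain ⟨E, q, _, _, hE⟩ := ht.exists_resolution (DerivedCategory.Q.objPreimage X)
    exact ⟨_, ⟨(freeDecoration E hE).model.phiTotIso ≪≫ asIso (DerivedCategory.Q.map q) ≪≫
      DerivedCategory.Q.objObjPreimageIso X⟩⟩⟩

lemma TorsionPair.IsTilting.isEquivalence_phiTot (ht : t.IsTilting) :
    (phiTot t).IsEquivalence where
  full := ht.full_phiTot
  faithful :=
    have := ht.full_phiTot
    faithful_of_full _ isZero_of_isZero_phiTot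
  essSurj := ⟨fun X => by
    obtain ⟨E, q, _, _, hE⟩ := ht.exists_resolution (DerivedCategory.Q.objPreimage X)
    exact ⟨_, ⟨(torsionDecoration E hE).model.phiTotIso ≪≫ (asIso (DerivedCategory.Q.map q)).symm ≪≫
      DerivedCategory.Q.objObjPreimageIso X⟩⟩⟩

end HRS

end

/-! ### Restriction to bounded subcategories -/

noncomputable section

namespace HRS

section

variable {C D : Type*} [Category* C] [Category* D]

/-- Full faithfulness is inherited. The equivalence in the hypothesis puts a preimage of an object
of `Q` into `P`. -/
lemma isEquivalence_restrict (F : C ⥤ D) [F.IsEquivalence] (P : ObjectProperty C)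
    (Q : ObjectProperty D) [Q.IsClosedUnderIsomorphisms] (h : ∀ X, Q (F.obj X) ↔ P X) :
    (restrict F P Q fun X => (h X).2).IsEquivalence where
  faithful := inferInstance
  full := inferInstance
  essSurj := ⟨fun Y => by
    have hX : P (F.objPreimage Y.obj) :=
      (h _).1 (Q.prop_of_iso (F.objObjPreimageIso Y.obj).symm Y.property)
    exact ⟨⟨_, hX⟩, ⟨Q.isoMk (F.objObjPreimageIso Y.obj)⟩⟩⟩

variable [HasShift C ℤ] [HasShift D ℤ]
  [HasZeroObject C] [HasZeroObject D] [Preadditive C] [Preadditive D]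
  [∀ n : ℤ, (shiftFunctor C n).Additive] [∀ n : ℤ, (shiftFunctor D n).Additive]
  [Pretriangulated C] [Pretriangulated D]

/-- A triangle equivalence restricts to triangulated subcategories that correspond to each
other. -/
lemma isTriangleEquivalence_restrict (F : C ⥤ D) [F.CommShift ℤ] [F.IsTriangulated]
    [F.IsEquivalence] (P : ObjectProperty C) (Q : ObjectProperty D) [P.IsTriangulated]
    [Q.IsTriangulated] [Q.IsClosedUnderIsomorphisms] (h : ∀ X, Q (F.obj X) ↔ P X) :
    IsTriangleEquivalence (restrict F P Q fun X => (h X).2) where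
  isTriangulated := inferInstance
  isEquivalence := isEquivalence_restrict F P Q h

end

end HRS

end

-- The theorem

universe w w'
universe v u

/-- The functor `Φ ∘ Tot` exists, is unique up to isomorphism, is triangulated and preserves each
kind of boundedness; in the cotilting (tilting) case it restricts to triangle equivalences of the
bounded above (bounded below) and of the bounded derived categories. -/
theorem theoremT {A : Type u} [Category.{v} A] [Abelian A] (t : HRS.TorsionPair A)
    [HasDerivedCategory.{w} A] [HasDerivedCategory.{w'} (HRS.Tilt t)] :
    (∃ Ψ : DerivedCategory (HRS.Tilt t) ⥤ DerivedCategory A, HRS.IsPhiTot t Ψ) ∧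
    (∀ Ψ Ψ' : DerivedCategory (HRS.Tilt t) ⥤ DerivedCategory A,
      HRS.IsPhiTot t Ψ → HRS.IsPhiTot t Ψ' → Nonempty (Ψ ≅ Ψ')) ∧
    ∀ Ψ : DerivedCategory (HRS.Tilt t) ⥤ DerivedCategory A, HRS.IsPhiTot t Ψ →
      ∃ (_ : Ψ.CommShift ℤ)
        (hm : ∀ X,
          (DerivedCategory.TStructure.t.minus : ObjectProperty (DerivedCategory (HRS.Tilt t))) X →
          (DerivedCategory.TStructure.t.minus : ObjectProperty (DerivedCategory A)) (Ψ.obj X))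
        (hp : ∀ X,
          (DerivedCategory.TStructure.t.plus : ObjectProperty (DerivedCategory (HRS.Tilt t))) X →
          (DerivedCategory.TStructure.t.plus : ObjectProperty (DerivedCategory A)) (Ψ.obj X))
        (hb : ∀ X,
          (DerivedCategory.TStructure.t.bounded : ObjectProperty (DerivedCategory (HRS.Tilt t))) X →
          (DerivedCategory.TStructure.t.bounded : ObjectProperty (DerivedCategory A)) (Ψ.obj X)),
        Ψ.IsTriangulated ∧
        (t.IsCotilting →
          HRS.IsTriangleEquivalence (HRS.restrict Ψ _ _ hm :
            DerivedCategory.Minus (HRS.Tilt t) ⥤ DerivedCategory.Minus A) ∧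
          HRS.IsTriangleEquivalence (HRS.restrict Ψ _ _ hb :
            DerivedCategory.Bounded (HRS.Tilt t) ⥤ DerivedCategory.Bounded A)) ∧
        (t.IsTilting →
          HRS.IsTriangleEquivalence (HRS.restrict Ψ _ _ hp :
            DerivedCategory.Plus (HRS.Tilt t) ⥤ DerivedCategory.Plus A) ∧
          HRS.IsTriangleEquivalence (HRS.restrict Ψ _ _ hb :
            DerivedCategory.Bounded (HRS.Tilt t) ⥤ DerivedCategory.Bounded A)) := by
  refine ⟨⟨_, HRS.isPhiTot_phiTot⟩, fun _ _ h h' => h.nonempty_iso h', fun Ψ hΨ => ?_⟩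
  -- By uniqueness it suffices to treat `phiTot`; its commutation with shifts, triangulated
  -- structure and boundedness are transported along `e` to the given functor.
  obtain ⟨e⟩ := HRS.IsPhiTot.nonempty_iso (HRS.isPhiTot_phiTot) hΨ
  let := Functor.CommShift.ofIso e ℤ
  have := Functor.CommShift.ofIso_compatibility e ℤ
  have hT : Ψ.IsTriangulated := Functor.isTriangulated_of_iso e
  have hm (X) : DerivedCategory.TStructure.t.minus (Ψ.obj X) ↔
      DerivedCategory.TStructure.t.minus X :=
    (ObjectProperty.prop_iff_of_iso _ (e.app X).symm).trans (HRS.minus_phiTot_iff X)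
  have hp (X) : DerivedCategory.TStructure.t.plus (Ψ.obj X) ↔
      DerivedCategory.TStructure.t.plus X :=
    (ObjectProperty.prop_iff_of_iso _ (e.app X).symm).trans (HRS.plus_phiTot_iff X)
  have hb (X) : DerivedCategory.TStructure.t.bounded (Ψ.obj X) ↔
      DerivedCategory.TStructure.t.bounded X :=
    (ObjectProperty.prop_iff_of_iso _ (e.app X).symm).trans (HRS.bounded_phiTot_iff X)
  refine ⟨inferInstance, fun X => (hm X).2, fun X => (hp X).2, fun X => (hb X).2, hT,
    fun ht => ?_, fun ht => ?_⟩
  · have := ht.isEquivalence_phiTot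
    have : Ψ.IsEquivalence := Functor.isEquivalence_of_iso e
    exact ⟨HRS.isTriangleEquivalence_restrict Ψ _ _ hm,
      HRS.isTriangleEquivalence_restrict Ψ _ _ hb⟩
  · have := ht.isEquivalence_phiTot
    have : Ψ.IsEquivalence := Functor.isEquivalence_of_iso e
    exact ⟨HRS.isTriangleEquivalence_restrict Ψ _ _ hp,
      HRS.isTriangleEquivalence_restrict Ψ _ _ hb⟩
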